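/- Let $F$ be a germ at the origin $O$ of a holomorphic self-map of $\mathbb{C}^2$ with $F(O)=O$ and $dF(O)=\mathrm{Id}$, and let $F=\mathrm{Id}+P_k+P_{k+1}+\cdots$ be its expansion in homogeneous polynomial maps, $\deg P_j=j$, with $k\ge 2$ and $P_k\not\equiv 0$. Let $[v]\in\mathbb{P}^1$ be a degenerate characteristic direction of $F$, i.e. $v\neq 0$ and $P_k(v)=0$. Choose linear coordinates in which $[v]=[1:0]$, write $P_k=(p_k,q_k)$ and $r(u)=q_k(1,u)-u\,p_k(1,u)$, and let $m$ and $n$ be the orders of vanishing at $u=0$ of $p_k(1,u)$ and of $r(u)$. Assume that $r\not\equiv 0$ (the origin is not dicritical) and that $[v]$ is irregular, i.e. $m+1<n<\infty$. Then there is an open basin $V$ attracted to the origin along $[v]$, contained in any prescribed neighbourhood of $O$: a nonempty connected open set $V$ with $F(V)\subseteq V$ such that for every $p\in V$ one has $F^{i}(p)\to O$ and $[F^{i}(p)]\to[v]$ in $\mathbb{P}^1$ as $i\to\infty$. If moreover $F$ is an automorphism of $\mathbb{C}^2$, then $V$ can be chosen so that in addition $\Omega=\bigcup_{i\ge 0}F^{-i}(V)$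 is biholomorphic to $\mathbb{C}^2$. -/

import Mathlib

open Filter Topology

noncomputable section

/-- `F` represents a germ at the origin of a holomorphic self-map of `ℂ²` that fixes the origin and
is tangent to the identity. -/
structure TangentToIdentity (F : ℂ × ℂ → ℂ × ℂ) : Prop where
  analyticAt : AnalyticAt ℂ F 0
  map_zero : F 0 = 0
  fderiv_eq : fderiv ℂ F 0 = ContinuousLinearMap.id ℂ (ℂ × ℂ)

/-- The homogeneous part `P_j` of degree `j` in the expansion of `F` at the origin:
`P_j(x) = (1/j!) D^jF(0)(x, …, x)`. -/
def homogPart (F : ℂ × ℂ → ℂ × ℂ) (j : ℕ) (x : ℂ × ℂ) : ℂ × ℂ :=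
  ((j.factorial : ℂ)⁻¹) • iteratedFDeriv ℂ j F 0 (fun _ => x)

/-- `k` is the order `ν(F)`: the least degree `k ≥ 2` with `P_k ≠ 0`
(for `F` tangent to the identity, `F = id + P_k + P_{k+1} + …`). -/
def IsOrder (F : ℂ × ℂ → ℂ × ℂ) (k : ℕ) : Prop :=
  IsLeast {j : ℕ | 2 ≤ j ∧ homogPart F j ≠ 0} k

/-- The line `[v]` is a characteristic direction of `F`: `v ≠ 0` and `P_k(v) = lam • v`
for some `lam`, where `k` is the order of `F`. -/
def IsCharacteristicDirection (F : ℂ × ℂ → ℂ × ℂ) (v : ℂ × ℂ) : Prop :=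
  v ≠ 0 ∧ ∃ k, IsOrder F k ∧ ∃ lam : ℂ, homogPart F k v = lam • v

/-- The characteristic direction `[v]` is degenerate: `P_k(v) = 0 • v`. -/
def IsDegenerateCharacteristicDirection (F : ℂ × ℂ → ℂ × ℂ) (v : ℂ × ℂ) : Prop :=
  IsCharacteristicDirection F v ∧ ∃ k, IsOrder F k ∧ homogPart F k v = 0

/-- `u ↦ p_k(1, u)`, where `P_k = (p_k, q_k)`. -/
def pPoly (F : ℂ × ℂ → ℂ × ℂ) (k : ℕ) (u : ℂ) : ℂ := (homogPart F k (1, u)).1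

/-- `u ↦ r(u) = q_k(1, u) - u p_k(1, u)`, where `P_k = (p_k, q_k)`. -/
def rPoly (F : ℂ × ℂ → ℂ × ℂ) (k : ℕ) (u : ℂ) : ℂ :=
  (homogPart F k (1, u)).2 - u * (homogPart F k (1, u)).1

/-- The direction `[1 : 0]` is irregular for `F`: with `k` the order of `F`, `m` the order of
vanishing at `u = 0` of `p_k(1, u)` and `n` that of `r(u)`, one has `m + 1 < n < ∞`.
(`n < ∞` says that the origin is not dicritical.) -/
def IsIrregularAtOneZero (F : ℂ × ℂ → ℂ × ℂ) : Prop :=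
  ∃ k, IsOrder F k ∧
    analyticOrderAt (pPoly F k) 0 + 1 < analyticOrderAt (rPoly F k) 0 ∧
    analyticOrderAt (rPoly F k) 0 < ⊤

/-- The direction `[v]` is irregular for `F`: after a linear change of coordinates that carries
`[v]` to `[1 : 0]`, the direction `[1 : 0]` is irregular. -/
def IsIrregularDirection (F : ℂ × ℂ → ℂ × ℂ) (v : ℂ × ℂ) : Prop :=
  ∃ A : (ℂ × ℂ) ≃L[ℂ] (ℂ × ℂ), A (1, 0) = v ∧
    IsIrregularAtOneZero (fun x => A.symm (F (A x)))

/-- The lines `[x i]` converge to `[v]` in the projective line: suitable multiples of the vectors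
`x i` converge to `v` (used with `v ≠ 0`, so that the `x i` are eventually nonzero). -/
def TendstoDirection (x : ℕ → ℂ × ℂ) (v : ℂ × ℂ) : Prop :=
  ∃ c : ℕ → ℂ, Tendsto (fun i => c i • x i) atTop (𝓝 v)

/-- `V` is an open basin attracted to the origin along `[v]`: a (nonempty) domain, mapped into
itself by `F`, all of whose points have orbits that tend to the origin tangentially to `[v]`. -/
structure IsBasinAlong (F : ℂ × ℂ → ℂ × ℂ) (v : ℂ × ℂ) (V : Set (ℂ × ℂ)) : Prop where
  isOpen : IsOpen V
  isConnected : IsConnected V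
  mapsTo : Set.MapsTo F V V
  tendsto_zero : ∀ x ∈ V, Tendsto (fun i : ℕ => F^[i] x) atTop (𝓝 0)
  tendsto_direction : ∀ x ∈ V, TendstoDirection (fun i : ℕ => F^[i] x) v

/-- `F` is a (biholomorphic) automorphism of `ℂ²`. -/
def IsAutomorphismC2 (F : ℂ × ℂ → ℂ × ℂ) : Prop :=
  Differentiable ℂ F ∧ ∃ G : ℂ × ℂ → ℂ × ℂ, Differentiable ℂ G ∧
    Function.LeftInverse G F ∧ Function.RightInverse G F

/-- The set `W` is open and biholomorphic to `ℂ²`. -/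
def IsBiholomorphicToC2 (W : Set (ℂ × ℂ)) : Prop :=
  IsOpen W ∧ ∃ Φ Ψ : ℂ × ℂ → ℂ × ℂ,
    DifferentiableOn ℂ Φ W ∧ Differentiable ℂ Ψ ∧ (∀ y, Ψ y ∈ W) ∧
    (∀ x ∈ W, Ψ (Φ x) = x) ∧ ∀ y, Φ (Ψ y) = y

end

/-!
Write `k` for the order of `F` and `K = k - 1`, and work in the chart `(x, u) ↦ (x, x u)` of the
blow-up, where `p_k(1, u) = u ^ m * ph u` and `r(u) = u ^ (m + 1 + l) * rh u` with `l ≥ 1`; this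
inequality is the irregularity of the direction. To leading order `F` is the time-one map of the
vector field `x ^ K (x u ^ m ph(u) ∂_x + u ^ (m + 1 + l) rh(u) ∂_u)`, and after the substitution
`x = α exp (-L / K)`, `u = μ Z ^ (-1 / l)` both `L` and a function `W` of `Z` with derivative close
to `1` move at the *same* speed, approximately `exp (-L) (u / μ) ^ m / 2`, for a suitable choice of
the constants `α` and `μ`. Hence `s = L - W` is almost invariant, and in the coordinates `(L, s)` on
the region `stripCone`, where `Re L` is large, `|Im L|` is less than `1/2` and `‖s‖` is less than
`δ Re L`, the map has the form `(L, s) ↦ (L + a, s + b)`. Here `a` pushes `L` to the right at a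
speed between `exp (-κ Re L)` and `exp (-Re L)`, with `κ` slightly larger than `1`, and towards the
middle of the strip, because the argument of `exp (-L)` is `-Im L` (`IsDrift`), while
`‖b‖ ≤ exp (-q Re L)` with `q > κ` (`IrregularExpansion.exists_model`). On the region `x → 0` and
`u → 0` as `Re L → ∞`, so its points are attracted to the origin along `[1 : 0]`.

For such a model map everything is explicit. Along an orbit, `Re L` grows so fast that the sums
`∑ b ∘ T ^ n` converge; adding the sum to `s` makes `s` exactly invariant (`exists_straightening`).
On each line `s = const` a Fatou coordinate `φ` with `φ ∘ T = φ + 1` is the primitive of a function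
`Y` with `Y(T) T' = Y`, which an orbit product constructs; as `Re Y > 0`, the map `φ` is injective
on lines, and the translates of its image cover the plane
(`exists_fatouCoordinate`). So `(φ, s)` conjugates the map to a translation of `ℂ²`. If `F` is an
automorphism, the preimages `F ^ (-i) (V)` of the basin are glued from copies of the region in the
same way as the translates of the image of `(φ, s)`, which exhaust `ℂ²`; therefore their union is
biholomorphic to `ℂ²` (`isBiholomorphicToC2_iUnion_preimage`).
-/

open Metric Set

/-! ### Holomorphic maps between normed spaces -/

section Holomorphic

variable {E F : Type*} [NormedAddCommGroup E] [NormedSpace ℂ E]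
  [NormedAddCommGroup F] [NormedSpace ℂ F]

/-- Cauchy's estimate for the Fréchet derivative at the centre of a ball. -/
theorem norm_fderiv_le_of_norm_le_on_ball {f : E → F} {c : E} {r M : ℝ} (hr : 0 < r)
    (hf : DifferentiableOn ℂ f (ball c r)) (hM : ∀ x ∈ ball c r, ‖f x‖ ≤ M) :
    ‖fderiv ℂ f c‖ ≤ 2 * M / r := by
  refine Complex.norm_fderiv_le_div_of_mapsTo_ball hf (fun x hx => ?_) hr
  rw [mem_closedBall, dist_eq_norm]
  have h1 := hM x hx
  have h2 := hM c (mem_ball_self hr)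
  have := norm_sub_le (f x) (f c)
  linarith

/-- By Cauchy's estimate, the derivative of a complex differentiable map is continuous. -/
theorem DifferentiableOn.continuousAt_fderiv_of_isOpen {f : E → F} {s : Set E} (hs : IsOpen s)
    (hf : DifferentiableOn ℂ f s) {a : E} (ha : a ∈ s) : ContinuousAt (fderiv ℂ f) a := by
  have hd : ∀ x ∈ s, DifferentiableAt ℂ f x := fun x hx => (hf x hx).differentiableAt (hs.mem_nhds hx)
  rw [Metric.continuousAt_iff']
  intro ε hε
  have hlo := (hd a ha).hasFDerivAt.isLittleO
  have hev := hlo.def (c := ε / 8) (by positivity)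
  obtain ⟨r, hr, hball⟩ := Metric.mem_nhds_iff.1 (inter_mem hev (hs.mem_nhds ha))
  filter_upwards [ball_mem_nhds a (half_pos hr)] with x hx
  have hxr : ball x (r / 2) ⊆ ball a r := by
    intro y hy
    rw [mem_ball] at *
    linarith [dist_triangle y x a]
  have hxs : x ∈ s := (hball (ball_subset_ball (by linarith) hx)).2
  -- Cauchy's estimate for the remainder of the linear approximation at `a`, which is `o(r)`
  set g : E → F := fun y => f y - f a - fderiv ℂ f a (y - a) with hg
  have hgd : DifferentiableOn ℂ g (ball x (r / 2)) := by
    have h1 : DifferentiableOn ℂ f (ball x (r / 2)) :=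
      hf.mono fun y hy => (hball (hxr hy)).2
    have h2 : Differentiable ℂ fun y => fderiv ℂ f a (y - a) :=
      (fderiv ℂ f a).differentiable.comp (differentiable_id.sub_const a)
    exact (h1.sub_const _).sub h2.differentiableOn
  have hgb : ∀ y ∈ ball x (r / 2), ‖g y‖ ≤ ε / 8 * r := by
    intro y hy
    have h1 : ‖g y‖ ≤ ε / 8 * ‖y - a‖ := (hball (hxr hy)).1
    have h2 : ‖y - a‖ ≤ r := by
      rw [← dist_eq_norm]; exact (hxr hy).le
    exact h1.trans (by gcongr)
  have hfd : fderiv ℂ g x = fderiv ℂ f x - fderiv ℂ f a := by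
    have h2 : HasFDerivAt (fun y => fderiv ℂ f a (y - a)) (fderiv ℂ f a) x :=
      ((fderiv ℂ f a).hasFDerivAt.comp x ((hasFDerivAt_id x).sub_const a))
    exact (((hd x hxs).hasFDerivAt.sub_const _).sub h2).fderiv
  have := norm_fderiv_le_of_norm_le_on_ball (half_pos hr) hgd hgb
  rw [hfd] at this
  rw [dist_eq_norm]
  calc _ ≤ _ := this
    _ = ε / 2 := by field_simp; ring
    _ < ε := by linarith

/-- In the complex setting, differentiability on an open set is strict. -/
theorem DifferentiableOn.hasStrictFDerivAt_of_isOpen {f : E → F} {s : Set E} (hs : IsOpen s)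
    (hf : DifferentiableOn ℂ f s) {a : E} (ha : a ∈ s) :
    HasStrictFDerivAt f (fderiv ℂ f a) a := by
  refine hasStrictFDerivAt_of_hasFDerivAt_of_continuousAt ?_ (hf.continuousAt_fderiv_of_isOpen hs ha)
  filter_upwards [hs.mem_nhds ha] with x hx
    using ((hf x hx).differentiableAt (hs.mem_nhds hx)).hasFDerivAt

/-- A series of holomorphic functions that is dominated by a convergent series of constants is
holomorphic. -/
theorem differentiableOn_tsum_of_norm_le [CompleteSpace F] {ι : Type*} {u : ι → ℝ}
    (hu : Summable u) {f : ι → E → F} {s : Set E} (hs : IsOpen s)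
    (hf : ∀ i, DifferentiableOn ℂ (f i) s) (hb : ∀ i, ∀ x ∈ s, ‖f i x‖ ≤ u i) :
    DifferentiableOn ℂ (fun x => ∑' i, f i x) s := by
  intro x hx
  obtain ⟨r, hr, hball⟩ := Metric.mem_nhds_iff.1 (hs.mem_nhds hx)
  have hsub : ∀ y ∈ ball x (r / 2), ball y (r / 2) ⊆ s := by
    intro y hy z hz
    refine hball ?_
    rw [mem_ball] at *
    linarith [dist_triangle z y x]
  have hmem : ∀ y ∈ ball x (r / 2), y ∈ s := fun y hy => hsub y hy (mem_ball_self (half_pos hr))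
  refine (hasFDerivAt_tsum_of_isPreconnected (𝕜 := ℂ) (u := fun i => 2 * u i / (r / 2))
    (f' := fun i => fderiv ℂ (f i)) (s := ball x (r / 2)) (x₀ := x) ((hu.mul_left 2).div_const _)
    isOpen_ball ?_ (fun i y hy => ?_) (fun i y hy => ?_) (mem_ball_self (half_pos hr)) ?_
    (mem_ball_self (half_pos hr))).differentiableAt.differentiableWithinAt
  · let _ : NormedSpace ℝ E := NormedSpace.restrictScalars ℝ ℂ E
    exact (convex_ball x (r / 2)).isPreconnected
  · exact ((hf i y (hmem y hy)).differentiableAt (hs.mem_nhds (hmem y hy))).hasFDerivAt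
  · exact norm_fderiv_le_of_norm_le_on_ball (half_pos hr) ((hf i).mono (hsub y hy))
      fun z hz => hb i z (hsub y hy hz)
  · exact Summable.of_norm_bounded hu fun i => hb i x hx

/-- `f` is univalent on `s`: an injective holomorphic map on the open set `s`. The injectivity of
its differential, automatic in finite dimension, is made part of the definition. -/
structure UnivalentOn (f : E → E) (s : Set E) : Prop where
  isOpen : IsOpen s
  differentiableOn : DifferentiableOn ℂ f s
  injOn : InjOn f s
  injective_fderiv : ∀ a ∈ s, Function.Injective (fderiv ℂ f a)

namespace UnivalentOn

variable {f g : E → E} {s t : Set E}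

theorem mono (h : UnivalentOn f s) (hts : t ⊆ s) (ht : IsOpen t) : UnivalentOn f t :=
  ⟨ht, h.differentiableOn.mono hts, h.injOn.mono hts, fun a ha => h.injective_fderiv a (hts ha)⟩

theorem differentiableAt (h : UnivalentOn f s) {a : E} (ha : a ∈ s) : DifferentiableAt ℂ f a :=
  (h.differentiableOn a ha).differentiableAt (h.isOpen.mem_nhds ha)

theorem comp (hg : UnivalentOn g t) (hf : UnivalentOn f s) (hst : MapsTo f s t) :
    UnivalentOn (g ∘ f) s where
  isOpen := hf.isOpen
  differentiableOn := hg.differentiableOn.comp hf.differentiableOn hst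
  injOn := hg.injOn.comp hf.injOn hst
  injective_fderiv a ha := by
    rw [fderiv_comp a (hg.differentiableAt (hst ha)) (hf.differentiableAt ha)]
    exact (hg.injective_fderiv _ (hst ha)).comp (hf.injective_fderiv a ha)

/-- A holomorphic map with a globally defined differentiable left inverse is univalent. -/
theorem of_leftInverse (hs : IsOpen s) (hf : Differentiable ℂ f) (hg : Differentiable ℂ g)
    (hgf : Function.LeftInverse g f) : UnivalentOn f s where
  isOpen := hs
  differentiableOn := hf.differentiableOn
  injOn := hgf.injective.injOn
  injective_fderiv a _ := by
    have h : fderiv ℂ (g ∘ f) a = ContinuousLinearMap.id ℂ E := by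
      rw [hgf.comp_eq_id]; exact fderiv_id
    rw [fderiv_comp a (hg _) (hf a)] at h
    have h2 : Function.LeftInverse (fderiv ℂ g (f a)) (fderiv ℂ f a) := fun x => by
      simpa using congrArg (fun T => T x) h
    exact h2.injective

variable [FiniteDimensional ℂ E]

theorem exists_equiv_hasStrictFDerivAt (h : UnivalentOn f s) {a : E} (ha : a ∈ s) :
    ∃ e : E ≃L[ℂ] E, HasStrictFDerivAt f (e : E →L[ℂ] E) a := by
  have hinj : Function.Injective (fderiv ℂ f a : E →ₗ[ℂ] E) := h.injective_fderiv a ha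
  refine ⟨(LinearEquiv.ofInjectiveEndo (fderiv ℂ f a : E →ₗ[ℂ] E) hinj).toContinuousLinearEquiv, ?_⟩
  convert h.differentiableOn.hasStrictFDerivAt_of_isOpen h.isOpen ha using 1
  ext x
  rfl

theorem isOpen_image (h : UnivalentOn f s) : IsOpen (f '' s) := by
  have : CompleteSpace E := FiniteDimensional.complete ℂ E
  rw [isOpen_iff_mem_nhds]
  rintro _ ⟨a, ha, rfl⟩
  obtain ⟨e, he⟩ := h.exists_equiv_hasStrictFDerivAt ha
  rw [← he.map_nhds_eq_of_equiv]
  exact image_mem_map (h.isOpen.mem_nhds ha)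

/-- The inverse of a univalent map is univalent on its image. -/
theorem invFunOn (h : UnivalentOn f s) : UnivalentOn (Function.invFunOn f s) (f '' s) := by
  have : CompleteSpace E := FiniteDimensional.complete ℂ E
  have key : ∀ a ∈ s, ∃ e : E ≃L[ℂ] E,
      HasFDerivAt (Function.invFunOn f s) (e : E →L[ℂ] E) (f a) := by
    intro a ha
    obtain ⟨e, he⟩ := h.exists_equiv_hasStrictFDerivAt ha
    refine ⟨e.symm, he.to_localInverse.hasFDerivAt.congr_of_eventuallyEq ?_⟩
    have h1 := he.eventually_right_inverse
    have h2 : ∀ᶠ y in 𝓝 (f a), he.localInverse f e a y ∈ s := by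
      have hc : Tendsto (he.localInverse f e a) (𝓝 (f a)) (𝓝 a) := by
        have := he.localInverse_continuousAt
        rwa [ContinuousAt, he.localInverse_apply_image] at this
      exact hc (h.isOpen.mem_nhds ha)
    filter_upwards [h1, h2] with y hy1 hy2
    have hy : ∃ x ∈ s, f x = y := ⟨_, hy2, hy1⟩
    exact h.injOn (Function.invFunOn_mem hy) hy2 ((Function.invFunOn_eq hy).trans hy1.symm)
  refine ⟨h.isOpen_image, ?_, ?_, ?_⟩
  · rintro _ ⟨a, ha, rfl⟩
    obtain ⟨e, he⟩ := key a ha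
    exact he.differentiableAt.differentiableWithinAt
  · rintro _ ⟨a, ha, rfl⟩ _ ⟨b, hb, rfl⟩ hab
    rw [h.injOn.leftInvOn_invFunOn ha, h.injOn.leftInvOn_invFunOn hb] at hab
    rw [hab]
  · rintro _ ⟨a, ha, rfl⟩
    obtain ⟨e, he⟩ := key a ha
    rw [he.fderiv]
    exact e.injective

end UnivalentOn

/-- Compatible local charts glue to a holomorphic map: if `χ n` are univalent on `D` and `φ n`
are holomorphic on `D`, and `φ` respects the identifications made by `χ`, then there is a
holomorphic map `Φ` on the union of the images of `χ n` with `Φ ∘ χ n = φ n`. -/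
theorem exists_glued_map [FiniteDimensional ℂ E] {ι : Type*} {D : Set E} {χ : ι → E → E}
    {φ : ι → E → F} (hχ : ∀ n, UnivalentOn (χ n) D) (hφ : ∀ n, DifferentiableOn ℂ (φ n) D)
    (h : ∀ n m, ∀ z ∈ D, ∀ w ∈ D, χ n z = χ m w → φ n z = φ m w) :
    ∃ Φ : E → F, DifferentiableOn ℂ Φ (⋃ n, χ n '' D) ∧ ∀ n, ∀ z ∈ D, Φ (χ n z) = φ n z := by
  classical
  have hex : ∀ x : E, ∃ y : F, ∀ n, ∀ z ∈ D, χ n z = x → y = φ n z := by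
    intro x
    by_cases hx : ∃ n, ∃ z ∈ D, χ n z = x
    · obtain ⟨n, z, hz, rfl⟩ := hx
      exact ⟨φ n z, fun m w hw hwz => h n m z hz w hw hwz.symm⟩
    · push Not at hx
      exact ⟨0, fun n z hz hzx => absurd hzx (hx n z hz)⟩
  choose Φ hΦ using hex
  have hΦ' : ∀ n, ∀ z ∈ D, Φ (χ n z) = φ n z := fun n z hz => hΦ _ n z hz rfl
  refine ⟨Φ, ?_, hΦ'⟩
  intro x hx
  obtain ⟨n, hn⟩ := mem_iUnion.1 hx
  have hinv := (hχ n).invFunOn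
  have hm : MapsTo (Function.invFunOn (χ n) D) (χ n '' D) D := by
    intro y hy
    exact Function.invFunOn_mem hy
  have hd : DifferentiableOn ℂ Φ (χ n '' D) := by
    refine ((hφ n).comp hinv.differentiableOn hm).congr ?_
    intro y hy
    have := hΦ' n _ (hm hy)
    rw [Function.invFunOn_eq hy] at this
    exact this
  exact ((hd x hn).differentiableAt (hinv.isOpen.mem_nhds hn)).differentiableWithinAt

end Holomorphic

/-- A holomorphic function with nonzero derivative that is injective on an open set of the plane is
univalent there. -/
theorem UnivalentOn.of_deriv_ne_zero {f : ℂ → ℂ} {s : Set ℂ} (hs : IsOpen s)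
    (hf : DifferentiableOn ℂ f s) (hi : InjOn f s) (hd : ∀ a ∈ s, deriv f a ≠ 0) :
    UnivalentOn f s where
  isOpen := hs
  differentiableOn := hf
  injOn := hi
  injective_fderiv a ha := by
    rw [injective_iff_map_eq_zero]
    intro x hx
    rw [fderiv_eq_smul_deriv, smul_eq_mul, mul_eq_zero] at hx
    exact hx.resolve_right (hd a ha)

/-- Triangular criterion: a holomorphic map of `ℂ²` whose first component depends on the first
variable only has injective differential as soon as both diagonal derivatives are nonzero. -/
theorem injective_fderiv_of_triangular {f : ℂ × ℂ → ℂ × ℂ} {a : ℂ × ℂ} {g : ℂ → ℂ} {c d : ℂ}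
    (hf : DifferentiableAt ℂ f a) (hg : HasDerivAt g c a.1) (hc : c ≠ 0)
    (hfg : ∀ᶠ z in 𝓝 a, (f z).1 = g z.1)
    (hd : HasDerivAt (fun w => (f (a.1, w)).2) d a.2) (hd0 : d ≠ 0) :
    Function.Injective (fderiv ℂ f a) := by
  rw [injective_iff_map_eq_zero]
  rintro ⟨x, y⟩ hxy
  have h1 : HasFDerivAt (fun z => (f z).1)
      ((ContinuousLinearMap.fst ℂ ℂ ℂ).comp (fderiv ℂ f a)) a :=
    hasFDerivAt_fst.comp a hf.hasFDerivAt
  have h2 : HasFDerivAt (fun z : ℂ × ℂ => g z.1)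
      ((ContinuousLinearMap.toSpanSingleton ℂ c).comp (ContinuousLinearMap.fst ℂ ℂ ℂ)) a :=
    hg.hasFDerivAt.comp a hasFDerivAt_fst
  have h3 := (h1.congr_of_eventuallyEq (hfg.mono fun z hz => hz.symm)).unique h2
  have h4 := congrArg (fun T => T (x, y)) h3
  have hx : x = 0 := by
    simp only [ContinuousLinearMap.comp_apply, hxy] at h4
    simpa [hc] using h4.symm
  subst hx
  have h5 : HasDerivAt (fun w => f (a.1, w)) (fderiv ℂ f a (0, 1)) a.2 := by
    have hl : HasDerivAt (fun w : ℂ => ((a.1, w) : ℂ × ℂ)) (0, 1) a.2 :=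
      (hasDerivAt_const _ _).prodMk (hasDerivAt_id _)
    exact hf.hasFDerivAt.comp_hasDerivAt a.2 hl
  have h6 : d = (fderiv ℂ f a (0, 1)).2 := hd.unique h5.snd
  have h7 : fderiv ℂ f a (0, y) = y • fderiv ℂ f a (0, 1) := by
    rw [← map_smul]; simp
  rw [h7] at hxy
  have h8 := congrArg Prod.snd hxy
  simp only [Prod.smul_snd, smul_eq_mul, ← h6, Prod.snd_zero, mul_eq_zero] at h8
  simp [h8.resolve_right hd0]

/-! ### Functions of one complex variable -/

/-- Along a segment on which `f` is holomorphic, the real part of the slope of `f` is attained by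
the real part of the derivative. -/
theorem exists_re_slope_eq_re_deriv {f f' : ℂ → ℂ} {s : Set ℂ} (hs : Convex ℝ s)
    (hf : ∀ z ∈ s, HasDerivAt f (f' z) z) {z w : ℂ} (hz : z ∈ s) (hw : w ∈ s) (hzw : z ≠ w) :
    ∃ ζ ∈ s, ((f z - f w) / (z - w)).re = (f' ζ).re := by
  have hsub : z - w ≠ 0 := sub_ne_zero.2 hzw
  have hmem : ∀ t ∈ Icc (0 : ℝ) 1, w + t * (z - w) ∈ s := by
    intro t ht
    have := hs.add_smul_sub_mem hw hz ht
    simpa using this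
  set g : ℝ → ℝ := fun t => (f (w + t * (z - w)) / (z - w)).re with hg
  have hder : ∀ t ∈ Icc (0 : ℝ) 1, HasDerivAt g (f' (w + t * (z - w))).re t := by
    intro t ht
    have h1 : HasDerivAt (fun u : ℂ => w + u * (z - w)) (z - w) (t : ℂ) := by
      simpa using ((hasDerivAt_id (t : ℂ)).mul_const (z - w)).const_add w
    have h2 := ((hf _ (hmem t ht)).comp (t : ℂ) h1).div_const (z - w)
    rw [mul_div_assoc, div_self hsub, mul_one] at h2
    exact h2.real_of_complex
  obtain ⟨t, ht, hgt⟩ := exists_hasDerivAt_eq_slope g (fun t => (f' (w + t * (z - w))).re)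
    one_pos (fun t ht => (hder t ht).continuousAt.continuousWithinAt)
    (fun t ht => hder t ⟨ht.1.le, ht.2.le⟩)
  refine ⟨_, hmem t ⟨ht.1.le, ht.2.le⟩, ?_⟩
  rw [hgt]
  simp [hg, sub_div]

/-- The Noshiro–Warschawski criterion. -/
theorem injOn_of_re_deriv_pos {f f' : ℂ → ℂ} {s : Set ℂ} (hs : Convex ℝ s)
    (hf : ∀ z ∈ s, HasDerivAt f (f' z) z) (hpos : ∀ z ∈ s, 0 < (f' z).re) : InjOn f s := by
  intro z hz w hw hzw
  by_contra hne
  obtain ⟨ζ, hζ, h⟩ := exists_re_slope_eq_re_deriv hs hf hz hw hne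
  have := hpos ζ hζ
  rw [← h, hzw] at this
  simp at this

theorem mul_norm_sub_le_of_le_re_deriv {f f' : ℂ → ℂ} {s : Set ℂ} (hs : Convex ℝ s)
    (hf : ∀ z ∈ s, HasDerivAt f (f' z) z) {m : ℝ} (hm : ∀ z ∈ s, m ≤ (f' z).re) {z w : ℂ}
    (hz : z ∈ s) (hw : w ∈ s) : m * ‖z - w‖ ≤ ‖f z - f w‖ := by
  rcases eq_or_ne z w with rfl | hne
  · simp
  obtain ⟨ζ, hζ, h⟩ := exists_re_slope_eq_re_deriv hs hf hz hw hne
  have h1 : m ≤ ‖(f z - f w) / (z - w)‖ := (hm ζ hζ).trans (h ▸ Complex.re_le_norm _)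
  rwa [norm_div, le_div_iff₀ (norm_pos_iff.2 (sub_ne_zero.2 hne))] at h1

/-- Second order Taylor estimate with a Cauchy bound for the remainder. -/
theorem norm_sub_sub_deriv_mul_le {f : ℂ → ℂ} {c z : ℂ} {r M : ℝ}
    (hf : DifferentiableOn ℂ f (ball c r)) (hM : ∀ x ∈ ball c r, ‖f x‖ ≤ M) (hz : z ∈ ball c r) :
    ‖f z - f c - deriv f c * (z - c)‖ ≤ 4 * M * (‖z - c‖ / r) ^ 2 := by
  have hr : 0 < r := pos_of_mem_ball hz
  have hdc : HasDerivAt f (deriv f c) c :=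
    (hf.differentiableAt (ball_mem_nhds c hr)).hasDerivAt
  have hM0 : 0 ≤ M := (norm_nonneg _).trans (hM z hz)
  have hd : ‖deriv f c‖ ≤ 2 * M / r := by
    rw [norm_deriv_eq_norm_fderiv]; exact norm_fderiv_le_of_norm_le_on_ball hr hf hM
  set g : ℂ → ℂ := fun x => f x - deriv f c * (x - c) with hg
  have hgc : g c = f c := by simp [hg]
  have hgd : DifferentiableOn ℂ g (ball c r) :=
    hf.sub ((differentiable_id.sub_const c).const_mul _).differentiableOn
  have hmaps : MapsTo g (ball c r) (closedBall (g c) (4 * M)) := by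
    intro x hx
    rw [mem_closedBall, dist_eq_norm, hgc]
    have h1 : ‖deriv f c * (x - c)‖ ≤ 2 * M := by
      rw [norm_mul]
      have h2 : ‖x - c‖ ≤ r := by rw [← dist_eq_norm]; exact (mem_ball.1 hx).le
      calc _ ≤ 2 * M / r * r := by gcongr
        _ = 2 * M := by field_simp
    calc ‖g x - f c‖ = ‖f x - f c - deriv f c * (x - c)‖ := by rw [hg]; ring_nf
      _ ≤ ‖f x‖ + ‖f c‖ + ‖deriv f c * (x - c)‖ :=
        (norm_sub_le _ _).trans (by gcongr; exact norm_sub_le _ _)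
      _ ≤ M + M + 2 * M := by
        gcongr
        exacts [hM x hx, hM c (mem_ball_self hr)]
      _ = 4 * M := by ring
  have hlo : (g · - g c) =o[𝓝 c] (fun w ↦ ‖w - c‖ ^ 1) := by
    have := hdc.isLittleO
    simp only [pow_one]
    refine (this.norm_right).congr_left fun x => ?_
    simp only [hg, smul_eq_mul]
    ring
  have := Complex.dist_le_mul_div_pow_of_mapsTo_ball_of_isLittleO hgd hmaps hlo hz
  rw [dist_eq_norm, dist_eq_norm, hgc] at this
  calc _ = ‖g z - f c‖ := by rw [hg]; ring_nf
    _ ≤ _ := this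

/-- A holomorphic function on a disc that contains `closedBall 0 r` in its interior is approximated
uniformly on `ball 0 r` by entire functions. -/
theorem exists_entire_approx {f : ℂ → ℂ} {r r' : ℝ} (hr : 0 ≤ r) (hrr' : r < r')
    (hf : DifferentiableOn ℂ f (ball 0 r')) {ε : ℝ} (hε : 0 < ε) :
    ∃ q : ℂ → ℂ, Differentiable ℂ q ∧ ∀ z ∈ ball (0 : ℂ) r, ‖f z - q z‖ ≤ ε := by
  obtain ⟨ρ, h1, h2⟩ := exists_between hrr'
  lift ρ to NNReal using hr.trans h1.le
  lift r to NNReal using hr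
  have hρ : 0 < ρ := lt_of_le_of_lt (zero_le) (NNReal.coe_lt_coe.1 h1)
  have hp := (hf.mono (closedBall_subset_ball h2)).hasFPowerSeriesOnBall hρ
  have hu := hp.tendstoUniformlyOn (r' := r) (by exact_mod_cast h1)
  obtain ⟨n, hn⟩ := ((Metric.tendstoUniformlyOn_iff.1 hu) ε hε).exists
  refine ⟨fun z => (cauchyPowerSeries f 0 ρ).partialSum n (z - 0), ?_, fun z hz => ?_⟩
  · simp only [FormalMultilinearSeries.partialSum, FormalMultilinearSeries.apply_eq_pow_smul_coeff]
    fun_prop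
  · simpa [dist_eq_norm] using (hn z hz).le

/-- The additive Cousin problem for the exhaustion of the plane by the discs `|s| < N + 1`. -/
theorem exists_cousin_solution {c : ℕ → ℂ → ℂ}
    (hc : ∀ N : ℕ, DifferentiableOn ℂ (c N) (ball 0 (N + 1))) :
    ∃ γ : ℕ → ℂ → ℂ, (∀ N : ℕ, DifferentiableOn ℂ (γ N) (ball 0 (N + 1))) ∧
      ∀ N : ℕ, ∀ s ∈ ball (0 : ℂ) (N + 1), γ N s - γ (N + 1) s = c N s := by
  have hex : ∀ N : ℕ, ∃ q : ℂ → ℂ, Differentiable ℂ q ∧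
      ∀ z ∈ ball (0 : ℂ) N, ‖c N z - q z‖ ≤ (1 / 2 : ℝ) ^ N := fun N =>
    exists_entire_approx (Nat.cast_nonneg N) (lt_add_one _) (hc N) (by positivity)
  choose q hq hcq using hex
  have hsub : ∀ N j : ℕ, ball (0 : ℂ) (N + 1) ⊆ ball (0 : ℂ) ((N + 1 + j : ℕ) : ℝ) := by
    intro N j
    apply ball_subset_ball
    push_cast
    linarith [(Nat.cast_nonneg j : (0 : ℝ) ≤ j)]
  have hb : ∀ N j : ℕ, ∀ s ∈ ball (0 : ℂ) (N + 1),
      ‖c (N + 1 + j) s - q (N + 1 + j) s‖ ≤ (1 / 2 : ℝ) ^ j := by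
    intro N j s hs
    refine (hcq _ s (hsub N j hs)).trans ?_
    exact pow_le_pow_of_le_one (by norm_num) (by norm_num) (by omega)
  have hdiff : ∀ N : ℕ, DifferentiableOn ℂ
      (fun s => ∑' j, (c (N + 1 + j) s - q (N + 1 + j) s)) (ball 0 (N + 1)) := by
    intro N
    refine differentiableOn_tsum_of_norm_le summable_geometric_two isOpen_ball (fun j => ?_)
      (fun j s hs => hb N j s hs)
    refine ((hc _).mono ?_).sub (hq _).differentiableOn
    exact (hsub N j).trans (ball_subset_ball (by linarith))
  -- formally `γ N = ∑ j ≥ N, c j`; the entire functions `q j` make the series converge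
  refine ⟨fun N s => (c N s - q N s) + ∑' j, (c (N + 1 + j) s - q (N + 1 + j) s) -
    ∑ j ∈ Finset.range N, q j s, fun N => ?_, fun N s hs => ?_⟩
  · refine (((hc N).sub (hq N).differentiableOn).add (hdiff N)).sub ?_
    exact (Differentiable.fun_sum fun j _ => hq j).differentiableOn
  · have hs' : Summable fun j => c (N + 1 + j) s - q (N + 1 + j) s :=
      Summable.of_norm_bounded summable_geometric_two fun j => hb N j s hs
    have h0 : ∑' j, (c (N + 1 + j) s - q (N + 1 + j) s) = (c (N + 1) s - q (N + 1) s) +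
        ∑' j, (c (N + 1 + 1 + j) s - q (N + 1 + 1 + j) s) := by
      rw [hs'.tsum_eq_zero_add]
      refine congrArg _ (tsum_congr fun j => ?_)
      rw [show N + 1 + (j + 1) = N + 1 + 1 + j by ring]
    dsimp only
    rw [h0, Finset.sum_range_succ]
    ring

/-- If the real part of the derivative is at least `m` on a convex set that contains a closed disc of
radius `r`, the image of that disc contains a disc of radius `m * r / 2`. -/
theorem ball_subset_image_closedBall_of_le_re_deriv {f f' : ℂ → ℂ} {s : Set ℂ} (hs : Convex ℝ s)
    (hf : ∀ z ∈ s, HasDerivAt f (f' z) z) {m : ℝ} (hm0 : 0 < m) (hm : ∀ z ∈ s, m ≤ (f' z).re)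
    {z₀ : ℂ} {r : ℝ} (hr : 0 < r) (hball : closedBall z₀ r ⊆ s) :
    ball (f z₀) (m * r / 2) ⊆ f '' closedBall z₀ r := by
  have hz₀ : z₀ ∈ s := hball (mem_closedBall_self hr.le)
  have hd : DifferentiableOn ℂ f (closedBall z₀ r) := fun z hz =>
    (hf z (hball hz)).differentiableAt.differentiableWithinAt
  refine DiffContOnCl.ball_subset_image_closedBall (hd.diffContOnCl_ball Subset.rfl) hr (fun z hz => ?_) ?_
  · have := mul_norm_sub_le_of_le_re_deriv hs hf hm (hball (sphere_subset_closedBall hz)) hz₀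
    rwa [mem_sphere_iff_norm.1 hz] at this
  · have h1 : ∀ᶠ z in 𝓝[≠] z₀, f z ≠ f z₀ := by
      filter_upwards [self_mem_nhdsWithin,
        mem_nhdsWithin_of_mem_nhds (closedBall_mem_nhds z₀ hr)] with z hz hzb heq
      have := mul_norm_sub_le_of_le_re_deriv hs hf hm (hball hzb) hz₀
      rw [heq, sub_self, norm_zero] at this
      exact absurd this (not_le.2 (mul_pos hm0 (norm_pos_iff.2 (sub_ne_zero.2 hz))))
    exact h1.frequently.filter_mono nhdsWithin_le_nhds

/-- A directional derivative of a holomorphic function is holomorphic: it is the locally uniform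
limit of difference quotients. -/
theorem differentiableOn_fderiv_apply {E : Type*} [NormedAddCommGroup E] [NormedSpace ℂ E]
    {f : E → ℂ} {s : Set E} (hs : IsOpen s) (hf : DifferentiableOn ℂ f s) (v : E) :
    DifferentiableOn ℂ (fun z => fderiv ℂ f z v) s := by
  intro x hx
  obtain ⟨ρ, hρ, hρs⟩ := Metric.mem_nhds_iff.1 (inter_mem (hs.mem_nhds hx)
    ((hf.continuousOn.continuousAt (hs.mem_nhds hx)).norm.eventually_lt_const
      (lt_add_one ‖f x‖)))
  set M := ‖f x‖ + 1 with hM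
  set r := ρ / 2 / (‖v‖ + 1) with hr
  have hv : 0 < ‖v‖ + 1 := by positivity
  have hr0 : 0 < r := by positivity
  have hmem : ∀ z ∈ ball x (ρ / 2), ∀ w ∈ ball (0 : ℂ) r, z + w • v ∈ ball x ρ := by
    intro z hz w hw
    rw [mem_ball_zero_iff] at hw
    rw [mem_ball, dist_eq_norm] at hz ⊢
    have h1 : ‖w • v‖ ≤ ρ / 2 := by
      rw [norm_smul]
      calc ‖w‖ * ‖v‖ ≤ r * (‖v‖ + 1) := by gcongr; linarith
        _ = ρ / 2 := by rw [hr]; field_simp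
    calc ‖z + w • v - x‖ = ‖(z - x) + w • v‖ := by congr 1; abel
      _ ≤ ‖z - x‖ + ‖w • v‖ := norm_add_le _ _
      _ < ρ := by linarith
  have hsub : ball x (ρ / 2) ⊆ ball x ρ := ball_subset_ball (by linarith)
  set ε : ℕ → ℂ := fun n => (r / 2 * (1 / 2 : ℝ) ^ n : ℝ) with hε
  have hεn : ∀ n, ‖ε n‖ = r / 2 * (1 / 2 : ℝ) ^ n := fun n => by
    simp only [hε, Complex.norm_real]
    exact Real.norm_of_nonneg (by positivity)
  have hε0 : ∀ n, ε n ≠ 0 := fun n => by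
    rw [← norm_pos_iff, hεn]; positivity
  have hεr : ∀ n, ε n ∈ ball (0 : ℂ) r := fun n => by
    rw [mem_ball_zero_iff, hεn]
    have : (1 / 2 : ℝ) ^ n ≤ 1 := pow_le_one₀ (by norm_num) (by norm_num)
    nlinarith
  -- difference quotients, and their limit as a telescoping series
  set Q : ℕ → E → ℂ := fun n z => (f (z + ε n • v) - f z) * (ε n)⁻¹ with hQ
  set C := 4 * M / r ^ 2 with hC
  have hQd : ∀ n, DifferentiableOn ℂ (Q n) (ball x (ρ / 2)) := by
    intro n
    refine DifferentiableOn.mul_const (DifferentiableOn.fun_sub ?_ ?_) (ε n)⁻¹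
    · exact hf.comp (by fun_prop) fun z hz => (hρs (hmem z hz _ (hεr n))).1
    · exact hf.mono fun z hz => (hρs (hsub hz)).1
  have hQb : ∀ n, ∀ z ∈ ball x (ρ / 2), ‖Q n z - fderiv ℂ f z v‖ ≤ C * ‖ε n‖ := by
    intro n z hz
    have hl : ∀ w : ℂ, HasDerivAt (fun w : ℂ => z + w • v) v w := by
      intro w
      simpa using ((hasDerivAt_id w).smul_const v).const_add z
    have hd : ∀ w ∈ ball (0 : ℂ) r, DifferentiableAt ℂ f (z + w • v) := fun w hw =>
      hf.differentiableAt (hs.mem_nhds (hρs (hmem z hz w hw)).1)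
    have h1 : DifferentiableOn ℂ (fun w : ℂ => f (z + w • v)) (ball 0 r) := fun w hw =>
      ((hd w hw).hasFDerivAt.comp_hasDerivAt w (hl w)).differentiableAt.differentiableWithinAt
    have h2 : deriv (fun w : ℂ => f (z + w • v)) 0 = fderiv ℂ f z v := by
      have := ((hd 0 (mem_ball_self hr0)).hasFDerivAt.comp_hasDerivAt 0 (hl 0)).deriv
      simpa [Function.comp_def] using this
    have h3 := norm_sub_sub_deriv_mul_le h1 (M := M)
      (fun w hw => (hρs (hmem z hz w hw)).2.le) (hεr n)
    simp only [zero_smul, add_zero, sub_zero, h2] at h3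
    have h4 : Q n z - fderiv ℂ f z v =
        (f (z + ε n • v) - f z - fderiv ℂ f z v * ε n) / ε n := by
      rw [hQ]; field_simp [hε0 n]
    rw [h4, norm_div, div_le_iff₀ (norm_pos_iff.2 (hε0 n))]
    calc _ ≤ _ := h3
      _ = C * ‖ε n‖ * ‖ε n‖ := by rw [hC]; field_simp
  have hC0 : 0 ≤ C := by positivity
  have hb : ∀ n, ∀ z ∈ ball x (ρ / 2), ‖Q (n + 1) z - Q n z‖ ≤ C * r * (1 / 2 : ℝ) ^ n := by
    intro n z hz
    have h1 := hQb n z hz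
    have h2 := hQb (n + 1) z hz
    rw [hεn] at h1 h2
    calc ‖Q (n + 1) z - Q n z‖ = ‖(Q (n + 1) z - fderiv ℂ f z v) - (Q n z - fderiv ℂ f z v)‖ := by
          congr 1; ring
      _ ≤ _ := norm_sub_le _ _
      _ ≤ C * (r / 2 * (1 / 2 : ℝ) ^ (n + 1)) + C * (r / 2 * (1 / 2 : ℝ) ^ n) := add_le_add h2 h1
      _ = C * r * (1 / 2 : ℝ) ^ n * (3 / 4) := by rw [pow_succ]; ring
      _ ≤ C * r * (1 / 2 : ℝ) ^ n * 1 := by gcongr; norm_num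
      _ = _ := mul_one _
  have hu : Summable fun n : ℕ => C * r * (1 / 2 : ℝ) ^ n := summable_geometric_two.mul_left _
  have htsum := differentiableOn_tsum_of_norm_le hu isOpen_ball
    (fun n => (hQd (n + 1)).sub (hQd n)) hb
  have heq : ∀ z ∈ ball x (ρ / 2), fderiv ℂ f z v = Q 0 z + ∑' n, (Q (n + 1) z - Q n z) := by
    intro z hz
    have h1 : Tendsto (fun n => ∑ i ∈ Finset.range n, (Q (i + 1) z - Q i z)) atTop
        (𝓝 (fderiv ℂ f z v - Q 0 z)) := by
      simp only [Finset.sum_range_sub (fun i => Q i z)]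
      refine Tendsto.sub_const ?_ _
      rw [tendsto_iff_norm_sub_tendsto_zero]
      refine squeeze_zero (fun _ => norm_nonneg _) (fun n => hQb n z hz) ?_
      simp only [hεn]
      have := ((tendsto_pow_atTop_nhds_zero_of_lt_one (r := (1 / 2 : ℝ)) (by norm_num)
        (by norm_num)).const_mul (r / 2)).const_mul C
      simpa using this
    have h2 := (Summable.of_norm_bounded hu fun n => hb n z hz).hasSum.tendsto_sum_nat
    rw [← tendsto_nhds_unique h1 h2]
    ring
  have hfin := ((hQd 0).add htsum).congr heq
  exact (hfin.differentiableAt (ball_mem_nhds x (by positivity))).differentiableWithinAt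

/-! ### Primitives along the fibres of `(L, s) ↦ s` -/

/-- The primitive of `Y(·, s)` that vanishes at `L₀`, obtained by integration along the segment
from `L₀` to `L`. -/
noncomputable def segmentPrimitive (Y : ℂ × ℂ → ℂ) (L₀ : ℂ) (z : ℂ × ℂ) : ℂ :=
  (z.1 - L₀) * ∫ t in (0 : ℝ)..1, Y (L₀ + t * (z.1 - L₀), z.2)

section SegmentPrimitive

variable {Y : ℂ × ℂ → ℂ} {L₀ : ℂ} {S : Set (ℂ × ℂ)}

/-- Differentiation under the integral sign: the derivative of the integrand is continuous, hence
bounded near the segment. -/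
theorem differentiableOn_integral_segment (hS : IsOpen S) (hY : DifferentiableOn ℂ Y S)
    (hstar : ∀ z ∈ S, ∀ t ∈ Icc (0 : ℝ) 1, (L₀ + t * (z.1 - L₀), z.2) ∈ S) :
    DifferentiableOn ℂ (fun z : ℂ × ℂ => ∫ t in (0 : ℝ)..1, Y (L₀ + t * (z.1 - L₀), z.2)) S := by
  intro z₀ hz₀
  set A : ℝ → (ℂ × ℂ) →L[ℂ] (ℂ × ℂ) := fun t =>
    ((t : ℂ) • ContinuousLinearMap.fst ℂ ℂ ℂ).prod (ContinuousLinearMap.snd ℂ ℂ ℂ) with hA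
  have hAc : Continuous A := by
    have h : A = fun t : ℝ => (t : ℂ) • ((ContinuousLinearMap.fst ℂ ℂ ℂ).prod
        (0 : ℂ × ℂ →L[ℂ] ℂ)) + ((0 : ℂ × ℂ →L[ℂ] ℂ).prod (ContinuousLinearMap.snd ℂ ℂ ℂ)) := by
      funext t
      ext <;> simp [hA]
    rw [h]
    exact (Complex.continuous_ofReal.smul continuous_const).add continuous_const
  have hγ : ∀ (z : ℂ × ℂ) (t : ℝ),
      HasFDerivAt (fun z : ℂ × ℂ => (L₀ + t * (z.1 - L₀), z.2)) (A t) z := by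
    intro z t
    have h1 : HasFDerivAt (fun z : ℂ × ℂ => L₀ + t * (z.1 - L₀))
        ((t : ℂ) • ContinuousLinearMap.fst ℂ ℂ ℂ) z :=
      ((hasFDerivAt_fst.sub_const L₀).const_mul (t : ℂ)).const_add L₀
    exact h1.prodMk hasFDerivAt_snd
  have hγc : Continuous fun p : (ℂ × ℂ) × ℝ => ((L₀ + p.2 * (p.1.1 - L₀), p.1.2) : ℂ × ℂ) := by
    fun_prop
  set G' : ℂ × ℂ → ℝ → (ℂ × ℂ) →L[ℂ] ℂ := fun z t =>
    (fderiv ℂ Y (L₀ + t * (z.1 - L₀), z.2)).comp (A t) with hG'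
  have hG'c : ∀ t ∈ Icc (0 : ℝ) 1, ContinuousAt (fun p : (ℂ × ℂ) × ℝ => G' p.1 p.2) (z₀, t) := by
    intro t ht
    have h1 : ContinuousAt (fun p : (ℂ × ℂ) × ℝ =>
        fderiv ℂ Y (L₀ + p.2 * (p.1.1 - L₀), p.1.2)) (z₀, t) := by
      have h2 := hY.continuousAt_fderiv_of_isOpen hS (hstar z₀ hz₀ t ht)
      exact ContinuousAt.comp (f := fun p : (ℂ × ℂ) × ℝ => ((L₀ + p.2 * (p.1.1 - L₀), p.1.2) : ℂ × ℂ))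
        (x := (z₀, t)) h2 hγc.continuousAt
    exact h1.clm_comp (hAc.comp continuous_snd).continuousAt
  have hG'c0 : ContinuousOn (G' z₀) (Icc 0 1) := fun t ht =>
    (ContinuousAt.comp (f := fun t : ℝ => (z₀, t)) (x := t) (hG'c t ht)
      (by fun_prop)).continuousWithinAt
  obtain ⟨M, hM⟩ := isCompact_Icc.exists_bound_of_continuousOn hG'c0
  have hev : ∀ᶠ z in 𝓝 z₀, ∀ t ∈ Icc (0 : ℝ) 1, ‖G' z t‖ ≤ M + 1 ∧ z ∈ S := by
    refine isCompact_Icc.eventually_forall_of_forall_eventually fun t ht => ?_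
    have h1 : ∀ᶠ p : (ℂ × ℂ) × ℝ in 𝓝 (z₀, t), ‖G' p.1 p.2‖ < M + 1 :=
      (hG'c t ht).norm.eventually_lt_const (by have := hM t ht; linarith)
    have h2 : ∀ᶠ p : (ℂ × ℂ) × ℝ in 𝓝 (z₀, t), p.1 ∈ S :=
      continuous_fst.continuousAt.eventually (hS.mem_nhds hz₀)
    filter_upwards [h1, h2] with p hp1 hp2 using ⟨hp1.le, hp2⟩
  have hIoc : uIoc (0 : ℝ) 1 = Ioc 0 1 := uIoc_of_le zero_le_one
  have hcont : ∀ z ∈ S, ContinuousOn (fun t : ℝ => Y (L₀ + t * (z.1 - L₀), z.2)) (Icc 0 1) := by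
    intro z hz
    exact hY.continuousOn.comp (by fun_prop) fun t ht => hstar z hz t ht
  refine (intervalIntegral.hasFDerivAt_integral_of_dominated_of_fderiv_le (F' := G')
    (bound := fun _ => M + 1) hev ?_ ?_ ?_ ?_ ?_ ?_).differentiableAt.differentiableWithinAt
  · filter_upwards [hS.mem_nhds hz₀] with z hz
    rw [hIoc]
    exact ((hcont z hz).mono Ioc_subset_Icc_self).aestronglyMeasurable measurableSet_Ioc
  · exact (hcont z₀ hz₀).intervalIntegrable_of_Icc zero_le_one
  · rw [hIoc]
    exact (hG'c0.mono Ioc_subset_Icc_self).aestronglyMeasurable measurableSet_Ioc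
  · refine Eventually.of_forall fun t ht z hz => ?_
    rw [hIoc] at ht
    exact (hz t ⟨ht.1.le, ht.2⟩).1
  · exact intervalIntegrable_const
  · refine Eventually.of_forall fun t ht z hz => ?_
    rw [hIoc] at ht
    have ht' : t ∈ Icc (0 : ℝ) 1 := ⟨ht.1.le, ht.2⟩
    have hmem := hstar z (hz t ht').2 t ht'
    exact ((hY _ hmem).differentiableAt (hS.mem_nhds hmem)).hasFDerivAt.comp z (hγ z t)

theorem differentiableOn_segmentPrimitive (hS : IsOpen S) (hY : DifferentiableOn ℂ Y S)
    (hstar : ∀ z ∈ S, ∀ t ∈ Icc (0 : ℝ) 1, (L₀ + t * (z.1 - L₀), z.2) ∈ S) :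
    DifferentiableOn ℂ (segmentPrimitive Y L₀) S :=
  ((differentiable_fst.sub_const L₀).differentiableOn).mul
    (differentiableOn_integral_segment hS hY hstar)

theorem hasDerivAt_segmentPrimitive (hS : IsOpen S) (hY : DifferentiableOn ℂ Y S)
    (hstar : ∀ z ∈ S, ∀ t ∈ Icc (0 : ℝ) 1, (L₀ + t * (z.1 - L₀), z.2) ∈ S) {z : ℂ × ℂ}
    (hz : z ∈ S) :
    HasDerivAt (fun w => segmentPrimitive Y L₀ (w, z.2)) (Y z) z.1 := by
  have hl : HasDerivAt (fun w : ℂ => ((w, z.2) : ℂ × ℂ)) (1, 0) z.1 :=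
    (hasDerivAt_id _).prodMk (hasDerivAt_const _ _)
  rcases eq_or_ne z.1 L₀ with h0 | h0
  · -- at the base point the factor `L - L₀` vanishes and the integral equals `Y z`
    have hJ := ((differentiableOn_integral_segment hS hY hstar z hz).differentiableAt
      (hS.mem_nhds hz)).hasFDerivAt.comp_hasDerivAt z.1 hl
    have := ((hasDerivAt_id z.1).sub_const L₀).mul hJ
    have hz' : (L₀, z.2) = z := by rw [← h0]
    simpa [h0, segmentPrimitive, Function.comp_def, Pi.mul_def, hz'] using this
  · have hv := ((differentiableOn_segmentPrimitive hS hY hstar z hz).differentiableAt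
      (hS.mem_nhds hz)).hasFDerivAt.comp_hasDerivAt z.1 hl
    set d := fderiv ℂ (segmentPrimitive Y L₀) z (1, 0)
    suffices h : d = Y z by
      rw [← h]; exact hv
    -- compare two computations of the derivative along the segment, at its end point
    have hp : HasDerivAt (fun τ : ℝ => L₀ + τ * (z.1 - L₀)) (z.1 - L₀) 1 := by
      have : HasDerivAt (fun τ : ℂ => L₀ + τ * (z.1 - L₀)) (z.1 - L₀) ((1 : ℝ) : ℂ) := by
        simpa using ((hasDerivAt_id ((1 : ℝ) : ℂ)).mul_const (z.1 - L₀)).const_add L₀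
      exact this.comp_ofReal
    have h1 : HasDerivAt (fun τ : ℝ => segmentPrimitive Y L₀ (L₀ + τ * (z.1 - L₀), z.2))
        (d * (z.1 - L₀)) 1 := by
      have hv' : HasDerivAt (fun w => segmentPrimitive Y L₀ (w, z.2)) d
          (L₀ + ((1 : ℝ) : ℂ) * (z.1 - L₀)) := by
        have : L₀ + ((1 : ℝ) : ℂ) * (z.1 - L₀) = z.1 := by simp
        rw [this]; exact hv
      exact hv'.comp (1 : ℝ) hp
    have hcont : ContinuousOn (fun t : ℝ => Y (L₀ + t * (z.1 - L₀), z.2)) (Icc 0 1) :=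
      hY.continuousOn.comp (by fun_prop) fun t ht => hstar z hz t ht
    have h2 : HasDerivWithinAt (fun τ : ℝ => (z.1 - L₀) *
        ∫ t in (0 : ℝ)..τ, Y (L₀ + t * (z.1 - L₀), z.2))
        ((z.1 - L₀) * Y z) (Icc 0 1) 1 := by
      have : Fact ((1 : ℝ) ∈ Icc (0 : ℝ) 1) := ⟨right_mem_Icc.2 zero_le_one⟩
      have := intervalIntegral.integral_hasDerivWithinAt_right (s := Icc (0 : ℝ) 1) (t := Icc 0 1)
        (a := 0) (b := 1)
        (f := fun t : ℝ => Y (L₀ + t * (z.1 - L₀), z.2)) (hcont.intervalIntegrable_of_Icc zero_le_one)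
        ?_ (hcont 1 (right_mem_Icc.2 zero_le_one))
      · have h3 := this.const_mul (z.1 - L₀)
        simpa using h3
      · exact ⟨Icc 0 1, self_mem_nhdsWithin, hcont.aestronglyMeasurable measurableSet_Icc⟩
    have h3 : HasDerivWithinAt (fun τ : ℝ => segmentPrimitive Y L₀ (L₀ + τ * (z.1 - L₀), z.2))
        ((z.1 - L₀) * Y z) (Icc 0 1) 1 := by
      refine h2.congr_of_mem (fun τ _ => ?_) (right_mem_Icc.2 zero_le_one)
      simp only [segmentPrimitive, add_sub_cancel_left]
      have := intervalIntegral.smul_integral_comp_mul_right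
        (fun t : ℝ => Y (L₀ + t * (z.1 - L₀), z.2)) (a := 0) (b := 1) τ
      simp only [zero_mul, one_mul] at this
      rw [← this, Complex.real_smul]
      simp only [Complex.ofReal_mul]
      simp only [mul_assoc]
      ring
    have h4 := (uniqueDiffOn_Icc zero_lt_one 1 (right_mem_Icc.2 zero_le_one)).eq_deriv _
      h1.hasDerivWithinAt h3
    rw [mul_comm] at h4
    exact mul_left_cancel₀ (sub_ne_zero.2 h0) h4

end SegmentPrimitive

/-! ### The model domains -/

/-- The model domain: pairs `(L, s)` with `L` in a half strip around the positive real axis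
and `s` in a disc whose radius grows linearly with `Re L`. -/
def stripCone (R θ δ : ℝ) : Set (ℂ × ℂ) :=
  {z | R < z.1.re ∧ |z.1.im| < θ ∧ ‖z.2‖ < δ * z.1.re}

theorem isOpen_stripCone (R θ δ : ℝ) : IsOpen (stripCone R θ δ) := by
  refine IsOpen.inter ?_ (IsOpen.inter ?_ ?_)
  · exact isOpen_lt continuous_const (Complex.continuous_re.comp continuous_fst)
  · exact isOpen_lt (Complex.continuous_im.comp continuous_fst).abs continuous_const
  · exact isOpen_lt continuous_snd.norm
      (continuous_const.mul (Complex.continuous_re.comp continuous_fst))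

theorem convex_stripCone (R θ δ : ℝ) : Convex ℝ (stripCone R θ δ) := by
  intro z hz w hw a b ha hb hab
  obtain ⟨hz1, hz2, hz3⟩ := hz
  obtain ⟨hw1, hw2, hw3⟩ := hw
  have key : ∀ {x y x' y' : ℝ}, x < x' → y < y' → a * x + b * y < a * x' + b * y' := by
    intro x y x' y' hx hy
    rcases ha.eq_or_lt with rfl | ha'
    · have : b = 1 := by linarith
      subst this; linarith
    · have h1 := mul_lt_mul_of_pos_left hx ha'
      have h2 := mul_le_mul_of_nonneg_left hy.le hb
      linarith
  refine ⟨?_, ?_, ?_⟩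
  · have := key hz1 hw1
    have h : a * R + b * R = R := by rw [← add_mul, hab, one_mul]
    simp only [Prod.fst_add, Prod.smul_fst, Complex.add_re, Complex.smul_re, smul_eq_mul]
    linarith
  · have := key hz2 hw2
    have h : a * θ + b * θ = θ := by rw [← add_mul, hab, one_mul]
    simp only [Prod.fst_add, Prod.smul_fst, Complex.add_im, Complex.smul_im, smul_eq_mul]
    calc _ ≤ |a * z.1.im| + |b * w.1.im| := abs_add_le _ _
      _ = a * |z.1.im| + b * |w.1.im| := by rw [abs_mul, abs_mul, abs_of_nonneg ha, abs_of_nonneg hb]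
      _ < θ := by linarith
  · have := key hz3 hw3
    simp only [Prod.fst_add, Prod.smul_fst, Complex.add_re, Complex.smul_re, smul_eq_mul,
      Prod.snd_add, Prod.smul_snd]
    calc _ ≤ ‖a • z.2‖ + ‖b • w.2‖ := norm_add_le _ _
      _ = a * ‖z.2‖ + b * ‖w.2‖ := by
        rw [norm_smul, norm_smul, Real.norm_of_nonneg ha, Real.norm_of_nonneg hb]
      _ < δ * (a * z.1.re + b * w.1.re) := by linarith

theorem stripCone_subset {R R' θ θ' δ δ' : ℝ} (hR : R' ≤ R) (hR0 : 0 ≤ R) (hθ : θ ≤ θ')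
    (hδ : δ ≤ δ') : stripCone R θ δ ⊆ stripCone R' θ' δ' := by
  rintro z ⟨h1, h2, h3⟩
  refine ⟨hR.trans_lt h1, h2.trans_le hθ, h3.trans_le ?_⟩
  exact mul_le_mul_of_nonneg_right hδ (hR0.trans h1.le)

/-- Every fibre of `(L, s) ↦ s` meets the model domain in a neighbourhood of `+∞`. -/
theorem ofReal_mem_stripCone {R θ δ x : ℝ} {s : ℂ} (hθ : 0 < θ) (hx : R < x) (hs : ‖s‖ < δ * x) :
    ((x : ℂ), s) ∈ stripCone R θ δ := by
  refine ⟨by simpa using hx, by simpa using hθ, by simpa using hs⟩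

theorem exists_ofReal_mem_stripCone (R : ℝ) {θ δ : ℝ} (hθ : 0 < θ) (hδ : 0 < δ) (s : ℂ) :
    ∃ x₀ : ℝ, ∀ x : ℝ, x₀ < x → ((x : ℂ), s) ∈ stripCone R θ δ := by
  refine ⟨max R (‖s‖ / δ), fun x hx => ?_⟩
  rw [max_lt_iff, div_lt_iff₀ hδ] at hx
  exact ofReal_mem_stripCone hθ hx.1 (by linarith)

theorem isConnected_stripCone (R : ℝ) {θ δ : ℝ} (hθ : 0 < θ) (hδ : 0 < δ) :
    IsConnected (stripCone R θ δ) := by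
  obtain ⟨x₀, h⟩ := exists_ofReal_mem_stripCone R hθ hδ 0
  exact ⟨⟨_, h (x₀ + 1) (by linarith)⟩, (convex_stripCone R θ δ).isPreconnected⟩

theorem convex_fiber_stripCone (R θ δ : ℝ) (s : ℂ) :
    Convex ℝ {L : ℂ | (L, s) ∈ stripCone R θ δ} := by
  intro z hz w hw a b ha hb hab
  have := convex_stripCone R θ δ hz hw ha hb hab
  have hs : a • s + b • s = s := by rw [← add_smul, hab, one_smul]
  rw [Prod.smul_mk, Prod.smul_mk, Prod.mk_add_mk, hs] at this
  exact this

/-- On a model domain every holomorphic function has a holomorphic primitive along the fibres of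
`(L, s) ↦ s`. Base points that depend holomorphically on `s` exist only over bounded sets of `s`,
so the primitives over discs are corrected by a solution of a Cousin problem. -/
theorem exists_fiberPrimitive {R θ δ : ℝ} (hθ : 0 < θ) (hδ : 0 < δ) {Y : ℂ × ℂ → ℂ}
    (hY : DifferentiableOn ℂ Y (stripCone R θ δ)) :
    ∃ φ : ℂ × ℂ → ℂ, DifferentiableOn ℂ φ (stripCone R θ δ) ∧
      ∀ z ∈ stripCone R θ δ, HasDerivAt (fun w => φ (w, z.2)) (Y z) z.1 := by
  set D := stripCone R θ δ with hD
  set b : ℕ → ℝ := fun N => |R| + 1 + (N + 1) / δ with hb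
  have hbmem : ∀ N : ℕ, ∀ s : ℂ, ‖s‖ < N + 1 → ((b N : ℂ), s) ∈ D := by
    intro N s hs
    refine ofReal_mem_stripCone hθ ?_ ?_
    · have : 0 < ((N : ℝ) + 1) / δ := by positivity
      linarith [le_abs_self R]
    · have h1 : δ * b N = δ * (|R| + 1) + (N + 1) := by simp only [hb]; field_simp
      have h2 : 0 < δ * (|R| + 1) := by positivity
      linarith
  -- `S N` is star-shaped along the fibres, with the base point `b N`
  set S : ℕ → Set (ℂ × ℂ) := fun N => D ∩ {z | ‖z.2‖ < N + 1} with hS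
  have hSo : ∀ N, IsOpen (S N) := fun N =>
    (isOpen_stripCone R θ δ).inter (isOpen_lt continuous_snd.norm continuous_const)
  have hstar : ∀ N, ∀ z ∈ S N, ∀ t ∈ Icc (0 : ℝ) 1,
      ((b N : ℂ) + t * (z.1 - b N), z.2) ∈ S N := by
    rintro N z ⟨hz, hz2⟩ t ht
    refine ⟨?_, hz2⟩
    have := (convex_fiber_stripCone R θ δ z.2).add_smul_sub_mem (hbmem N z.2 hz2) hz ht
    simpa using this
  have hYS : ∀ N, DifferentiableOn ℂ Y (S N) := fun N => hY.mono inter_subset_left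
  set p : ℕ → ℂ × ℂ → ℂ := fun N => segmentPrimitive Y (b N) with hp
  have hpd : ∀ N, DifferentiableOn ℂ (p N) (S N) := fun N =>
    differentiableOn_segmentPrimitive (hSo N) (hYS N) (hstar N)
  have hpder : ∀ N, ∀ z ∈ S N, HasDerivAt (fun w => p N (w, z.2)) (Y z) z.1 := fun N z hz =>
    hasDerivAt_segmentPrimitive (hSo N) (hYS N) (hstar N) hz
  have hSmono : ∀ N, S N ⊆ S (N + 1) := by
    rintro N z ⟨h1, h2⟩
    refine ⟨h1, ?_⟩
    simp only [mem_ofPred_eq, Nat.cast_add, Nat.cast_one] at h2 ⊢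
    linarith
  set c : ℕ → ℂ → ℂ := fun N s => p (N + 1) (b N, s) with hc
  have hcd : ∀ N : ℕ, DifferentiableOn ℂ (c N) (ball 0 (N + 1)) := by
    intro N
    refine (hpd (N + 1)).comp (f := fun s : ℂ => ((b N : ℂ), s)) (by fun_prop) fun s hs => ?_
    rw [mem_ball_zero_iff] at hs
    exact hSmono N ⟨hbmem N s hs, hs⟩
  obtain ⟨γ, hγd, hγ⟩ := exists_cousin_solution hcd
  -- two primitives on the same fibre differ by a constant
  have hdiff : ∀ N, ∀ z ∈ S N, p (N + 1) z - p N z = c N z.2 := by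
    rintro N ⟨L, s⟩ hz
    have hfc : Convex ℝ {w : ℂ | (w, s) ∈ S N} := by
      intro x hx y hy u v hu hv huv
      exact ⟨convex_fiber_stripCone R θ δ s hx.1 hy.1 hu hv huv, hx.2⟩
    have hfo : IsOpen {w : ℂ | (w, s) ∈ S N} := (hSo N).preimage (by fun_prop)
    have hder : ∀ w ∈ {w : ℂ | (w, s) ∈ S N},
        HasDerivAt (fun w => p (N + 1) (w, s) - p N (w, s)) 0 w := by
      intro w hw
      have := (hpder (N + 1) (w, s) (hSmono N hw)).fun_sub (hpder N (w, s) hw)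
      rwa [sub_self] at this
    have hconst := hfo.is_const_of_deriv_eq_zero (𝕜 := ℂ) hfc.isPreconnected
      (f := fun w => p (N + 1) (w, s) - p N (w, s))
      (fun w hw => (hder w hw).differentiableAt.differentiableWithinAt)
      (fun w hw => (hder w hw).deriv) hz (y := (b N : ℂ)) ⟨hbmem N s hz.2, hz.2⟩
    have h0 : p N (b N, s) = 0 := by simp [hp, segmentPrimitive]
    simp only [h0, sub_zero] at hconst
    exact hconst
  have hstep : ∀ N, ∀ z ∈ S N, p (N + 1) z + γ (N + 1) z.2 = p N z + γ N z.2 := by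
    intro N z hz
    have h1 := hdiff N z hz
    have h2 := hγ N z.2 (by simpa using hz.2)
    linear_combination h1 - h2
  -- by `hstep` the corrected primitives agree where two of them are defined
  set φ : ℂ × ℂ → ℂ := fun z => p ⌊‖z.2‖⌋₊ z + γ ⌊‖z.2‖⌋₊ z.2 with hφ
  have hφeq : ∀ N, ∀ z ∈ S N, φ z = p N z + γ N z.2 := by
    intro N z hz
    have hle : ⌊‖z.2‖⌋₊ ≤ N := by
      rw [← Nat.lt_succ_iff, Nat.floor_lt (norm_nonneg _)]
      simpa using hz.2
    have h0 : z ∈ S ⌊‖z.2‖⌋₊ := ⟨hz.1, Nat.lt_floor_add_one ‖z.2‖⟩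
    induction N, hle using Nat.le_induction with
    | base => rfl
    | succ n hn ih =>
      have hzn : z ∈ S n := by
        have h1 : ‖z.2‖ < ⌊‖z.2‖⌋₊ + 1 := h0.2
        have h2 : (⌊‖z.2‖⌋₊ : ℝ) ≤ n := by exact_mod_cast hn
        have h3 : ‖z.2‖ < n + 1 := by linarith
        exact ⟨hz.1, h3⟩
      rw [ih hzn, hstep n z hzn]
  have hφS : ∀ z ∈ D, z ∈ S ⌊‖z.2‖⌋₊ := fun z hz => ⟨hz, Nat.lt_floor_add_one ‖z.2‖⟩
  have hγS : ∀ N, DifferentiableOn ℂ (fun z : ℂ × ℂ => p N z + γ N z.2) (S N) := fun N =>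
    (hpd N).add ((hγd N).comp differentiable_snd.differentiableOn
      fun z hz => by simpa using hz.2)
  refine ⟨φ, fun z hz => ?_, fun z hz => ?_⟩
  · have hn := (hSo ⌊‖z.2‖⌋₊).mem_nhds (hφS z hz)
    have := ((hγS _).congr (hφeq _)).differentiableAt hn
    exact this.differentiableWithinAt
  · have hfo : IsOpen {w : ℂ | (w, z.2) ∈ S ⌊‖z.2‖⌋₊} := (hSo _).preimage (by fun_prop)
    refine ((hpder _ z (hφS z hz)).add_const (γ ⌊‖z.2‖⌋₊ z.2)).congr_of_eventuallyEq ?_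
    filter_upwards [hfo.mem_nhds (hφS z hz)] with w hw using hφeq _ _ hw

/-! ### Sums along orbits -/

section OrbitSums

variable {T : ℂ × ℂ → ℂ × ℂ} {D : Set (ℂ × ℂ)} {κ : ℝ}

/-- A drift of size `exp (-κ Re L) / 2` increases `exp (κ Re L)` by at least `1/2` in each step. -/
theorem exp_mul_re_iterate_ge (hκ : 1 ≤ κ) (hT : MapsTo T D D)
    (hre : ∀ z ∈ D, z.1.re + Real.exp (-κ * z.1.re) / 2 ≤ (T z).1.re)
    (hpos : ∀ z ∈ D, 0 ≤ z.1.re) {z : ℂ × ℂ} (hz : z ∈ D) (n : ℕ) :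
    ((n : ℝ) + 1) / 2 ≤ Real.exp (κ * (T^[n] z).1.re) := by
  suffices h : 1 + (n : ℝ) / 2 ≤ Real.exp (κ * (T^[n] z).1.re) by linarith
  induction n with
  | zero => simpa using Real.one_le_exp (mul_nonneg (by linarith) (hpos z hz))
  | succ n ih =>
    rw [Function.iterate_succ_apply']
    set w := T^[n] z
    have hw : w ∈ D := hT.iterate n hz
    have h1 := hre w hw
    have h2 : Real.exp (κ * w.1.re) * Real.exp (-κ * w.1.re) = 1 := by
      rw [← Real.exp_add]; simp
    have h3 : κ * w.1.re + κ * (Real.exp (-κ * w.1.re) / 2) ≤ κ * (T w).1.re := by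
      rw [← mul_add]; exact mul_le_mul_of_nonneg_left h1 (by linarith)
    have h4 : 1 + κ * (Real.exp (-κ * w.1.re) / 2) ≤ Real.exp (κ * (Real.exp (-κ * w.1.re) / 2)) := by
      linarith [Real.add_one_le_exp (κ * (Real.exp (-κ * w.1.re) / 2))]
    have h5 := Real.exp_pos (κ * w.1.re)
    calc 1 + ((n + 1 : ℕ) : ℝ) / 2 = 1 + (n : ℝ) / 2 + 1 / 2 := by push_cast; ring
      _ ≤ Real.exp (κ * w.1.re) + κ / 2 := by linarith
      _ = Real.exp (κ * w.1.re) * (1 + κ * (Real.exp (-κ * w.1.re) / 2)) := by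
        linear_combination (-κ / 2) * h2
      _ ≤ Real.exp (κ * w.1.re) * Real.exp (κ * (Real.exp (-κ * w.1.re) / 2)) := by gcongr
      _ = Real.exp (κ * w.1.re + κ * (Real.exp (-κ * w.1.re) / 2)) := by rw [Real.exp_add]
      _ ≤ _ := Real.exp_le_exp.2 h3

theorem tendsto_re_iterate (hκ : 1 ≤ κ) (hT : MapsTo T D D)
    (hre : ∀ z ∈ D, z.1.re + Real.exp (-κ * z.1.re) / 2 ≤ (T z).1.re)
    (hpos : ∀ z ∈ D, 0 ≤ z.1.re) {z : ℂ × ℂ} (hz : z ∈ D) :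
    Tendsto (fun n => (T^[n] z).1.re) atTop atTop := by
  have h1 : Tendsto (fun n : ℕ => ((n : ℝ) + 1) / 2) atTop atTop :=
    (tendsto_atTop_add_const_right _ _ tendsto_natCast_atTop_atTop).atTop_div_const two_pos
  have h2 := tendsto_atTop_mono (exp_mul_re_iterate_ge hκ hT hre hpos hz) h1
  have h3 := Real.tendsto_log_atTop.comp h2
  simp only [Function.comp_def, Real.log_exp] at h3
  refine (h3.atTop_div_const (by linarith : 0 < κ)).congr fun n => ?_
  field_simp

/-- If `g` decays faster along the real direction than the drift of `T`, the sum of `g` along the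
orbits of `T` is holomorphic. It solves the equation `G ∘ T = G - g`, and it is small far away. -/
theorem exists_orbitSum (hκ : 1 ≤ κ) (hT : MapsTo T D D) (hD : IsOpen D)
    (hTd : DifferentiableOn ℂ T D)
    (hre : ∀ z ∈ D, z.1.re + Real.exp (-κ * z.1.re) / 2 ≤ (T z).1.re)
    (hpos : ∀ z ∈ D, 0 ≤ z.1.re) {q C : ℝ} (hq : κ < q) (hq2 : q ≤ κ + 2)
    {g : ℂ × ℂ → ℂ} (hg : DifferentiableOn ℂ g D)
    (hgb : ∀ z ∈ D, ‖g z‖ ≤ C * Real.exp (-q * z.1.re)) :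
    ∃ G : ℂ × ℂ → ℂ, DifferentiableOn ℂ G D ∧ (∀ z ∈ D, G (T z) = G z - g z) ∧
      ∀ z ∈ D, ‖G z‖ ≤ C * (4 / (q - κ)) * Real.exp (-(q - κ) * z.1.re) := by
  rcases D.eq_empty_or_nonempty with rfl | ⟨z₁, hz₁⟩
  · exact ⟨0, by simp⟩
  have hC : 0 ≤ C := by
    have := (norm_nonneg _).trans (hgb z₁ hz₁)
    exact nonneg_of_mul_nonneg_left this (Real.exp_pos _)
  have hTn : ∀ n, MapsTo T^[n] D D := fun n => hT.iterate n
  have hdn : ∀ n, DifferentiableOn ℂ T^[n] D := by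
    intro n
    induction n with
    | zero => exact differentiableOn_id
    | succ n ih => exact ih.comp hTd hT
  -- along an orbit `exp (-q Re L)` is at most of the order of `n ^ (-q / κ)`
  have hp : 1 < q / κ := by rw [one_lt_div (by linarith)]; exact hq
  have hu : Summable fun n : ℕ => C * (((n : ℝ) + 1) / 2) ^ (-(q / κ)) := by
    have h1 : Summable fun n : ℕ => ((n + 1 : ℕ) : ℝ) ^ (-(q / κ)) :=
      (summable_nat_add_iff 1).2 (Real.summable_nat_rpow.2 (by linarith))
    have h2 := (h1.mul_right ((2 : ℝ)⁻¹ ^ (-(q / κ)))).mul_left C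
    refine h2.congr fun n => ?_
    rw [div_eq_mul_inv ((n : ℝ) + 1) 2, Real.mul_rpow (by positivity) (by positivity)]
    push_cast
    rfl
  have hbound : ∀ n, ∀ z ∈ D, ‖g (T^[n] z)‖ ≤ C * (((n : ℝ) + 1) / 2) ^ (-(q / κ)) := by
    intro n z hz
    refine (hgb _ (hTn n hz)).trans (mul_le_mul_of_nonneg_left ?_ hC)
    have h1 := exp_mul_re_iterate_ge hκ hT hre hpos hz n
    have h2 : Real.exp (-q * (T^[n] z).1.re) =
        Real.exp (κ * (T^[n] z).1.re) ^ (-(q / κ)) := by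
      rw [← Real.exp_mul]
      congr 1
      field_simp
    rw [h2]
    exact Real.rpow_le_rpow_of_nonpos (by positivity) h1 (by linarith)
  have hsum : ∀ z ∈ D, Summable fun n => ‖g (T^[n] z)‖ := fun z hz =>
    Summable.of_nonneg_of_le (fun _ => norm_nonneg _) (fun n => hbound n z hz) hu
  refine ⟨fun z => ∑' n, g (T^[n] z), ?_, ?_, ?_⟩
  · exact differentiableOn_tsum_of_norm_le hu hD (fun n => hg.comp (hdn n) (hTn n)) hbound
  · intro z hz
    have h := (hsum z hz).of_norm.tsum_eq_zero_add
    simp only [Function.iterate_zero, id, Function.iterate_succ_apply] at h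
    dsimp only
    rw [h]
    ring
  · intro z hz
    set η := q - κ with hη
    have hη0 : 0 < η := by linarith
    -- each term is dominated by a difference of consecutive values of `exp (-η Re L)`
    have hstep : ∀ w ∈ D, ‖g w‖ ≤
        C * (4 / η) * (Real.exp (-η * w.1.re) - Real.exp (-η * (T w).1.re)) := by
      intro w hw
      set d := Real.exp (-κ * w.1.re) / 2 with hd
      have hd0 : 0 < d := by positivity
      have hd1 : d ≤ 1 / 2 := by
        have : Real.exp (-κ * w.1.re) ≤ 1 := by
          rw [Real.exp_le_one_iff]
          nlinarith [hpos w hw]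
        linarith
      have hx0 : 0 < η * d := by positivity
      have hx1 : η * d ≤ 1 := by nlinarith
      have h1 : Real.exp (-(η * d)) ≤ 1 - η * d / 2 := by
        have h2 := Real.add_one_le_exp (η * d)
        have h3 : Real.exp (-(η * d)) * Real.exp (η * d) = 1 := by
          rw [← Real.exp_add]; simp
        have h4 := Real.exp_pos (-(η * d))
        nlinarith
      have h2 : Real.exp (-η * (T w).1.re) ≤ Real.exp (-η * w.1.re) * Real.exp (-(η * d)) := by
        rw [← Real.exp_add, Real.exp_le_exp]
        nlinarith [hre w hw]
      have h3 : Real.exp (-η * w.1.re) * (η * d / 2) = η / 4 * Real.exp (-q * w.1.re) := by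
        have : Real.exp (-q * w.1.re) = Real.exp (-η * w.1.re) * Real.exp (-κ * w.1.re) := by
          rw [← Real.exp_add]; congr 1; rw [hη]; ring
        rw [this, hd]; ring
      have h4 : Real.exp (-q * w.1.re) ≤
          4 / η * (Real.exp (-η * w.1.re) - Real.exp (-η * (T w).1.re)) := by
        have h5 : Real.exp (-η * w.1.re) * Real.exp (-(η * d)) ≤
            Real.exp (-η * w.1.re) * (1 - η * d / 2) := by gcongr
        have h6 : η / 4 * Real.exp (-q * w.1.re) ≤
            Real.exp (-η * w.1.re) - Real.exp (-η * (T w).1.re) := by linarith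
        calc Real.exp (-q * w.1.re) = 4 / η * (η / 4 * Real.exp (-q * w.1.re)) := by
              field_simp
          _ ≤ _ := by gcongr
      calc ‖g w‖ ≤ C * Real.exp (-q * w.1.re) := hgb w hw
        _ ≤ C * (4 / η * (Real.exp (-η * w.1.re) - Real.exp (-η * (T w).1.re))) := by gcongr
        _ = _ := by ring
    have hpart : ∀ N, ∑ n ∈ Finset.range N, ‖g (T^[n] z)‖ ≤
        C * (4 / η) * Real.exp (-η * z.1.re) := by
      intro N
      have h1 : ∑ n ∈ Finset.range N, ‖g (T^[n] z)‖ ≤ C * (4 / η) *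
          (Real.exp (-η * z.1.re) - Real.exp (-η * (T^[N] z).1.re)) := by
        induction N with
        | zero => simp
        | succ N ih =>
          rw [Finset.sum_range_succ, Function.iterate_succ_apply']
          have := hstep _ (hTn N hz)
          linarith
      refine h1.trans ?_
      have : 0 ≤ C * (4 / η) := by positivity
      gcongr
      linarith [Real.exp_pos (-η * (T^[N] z).1.re)]
    exact (norm_tsum_le_tsum_norm (hsum z hz)).trans
      (Real.tsum_le_of_sum_range_le (fun _ => norm_nonneg _) hpart)

end OrbitSums

/-! ### Drifts on model domains -/

/-- `a` is a drift on the model domain: the `L`-component of a holomorphic map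
`(L, s) ↦ (L + a, …)` that pushes `L` to the right, at a speed between `exp (-κ Re L)` and
`exp (-Re L)`, and towards the middle of the strip. -/
structure IsDrift (κ R θ δ : ℝ) (a : ℂ × ℂ → ℂ) : Prop where
  differentiableOn : DifferentiableOn ℂ a (stripCone R θ δ)
  lower : ∀ z ∈ stripCone R θ δ, Real.exp (-κ * z.1.re) ≤ ‖a z‖
  upper : ∀ z ∈ stripCone R θ δ, ‖a z‖ ≤ Real.exp (-z.1.re)
  half_norm_le_re : ∀ z ∈ stripCone R θ δ, ‖a z‖ / 2 ≤ (a z).re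
  im_neg : ∀ z ∈ stripCone R θ δ, 1 / 4 ≤ z.1.im → (a z).im < 0
  im_pos : ∀ z ∈ stripCone R θ δ, z.1.im ≤ -(1 / 4) → 0 < (a z).im

namespace IsDrift

variable {κ R θ δ R' θ' δ' : ℝ} {a : ℂ × ℂ → ℂ}

theorem mono (h : IsDrift κ R θ δ a) (hs : stripCone R' θ' δ' ⊆ stripCone R θ δ) :
    IsDrift κ R' θ' δ' a :=
  ⟨h.differentiableOn.mono hs, fun z hz => h.lower z (hs hz), fun z hz => h.upper z (hs hz),
    fun z hz => h.half_norm_le_re z (hs hz), fun z hz => h.im_neg z (hs hz),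
    fun z hz => h.im_pos z (hs hz)⟩

theorem ne_zero (h : IsDrift κ R θ δ a) {z : ℂ × ℂ} (hz : z ∈ stripCone R θ δ) : a z ≠ 0 := by
  intro h0
  have := h.lower z hz
  rw [h0, norm_zero] at this
  exact absurd this (not_le.2 (Real.exp_pos _))

theorem re_add_le (h : IsDrift κ R θ δ a) {z : ℂ × ℂ} (hz : z ∈ stripCone R θ δ) :
    z.1.re + Real.exp (-κ * z.1.re) / 2 ≤ (z.1 + a z).re := by
  have h1 := h.lower z hz
  have h2 := h.half_norm_le_re z hz
  rw [Complex.add_re]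
  linarith

theorem norm_lt (h : IsDrift κ R θ δ a) (hR : 3 ≤ R) {z : ℂ × ℂ}
    (hz : z ∈ stripCone R θ δ) : ‖a z‖ < 1 / 16 := by
  refine (h.upper z hz).trans_lt ?_
  have h1 : Real.exp (-z.1.re) < Real.exp (-3) := Real.exp_lt_exp.2 (by linarith [hz.1])
  have h2 : Real.exp (-3) < 1 / 16 := by
    have h3 : Real.exp (-3) = (Real.exp 1 ^ 3)⁻¹ := by
      rw [← Real.exp_nat_mul, ← Real.exp_neg]; norm_num
    rw [h3, one_div]
    apply inv_strictAnti₀ (by norm_num)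
    have := Real.exp_one_gt_d9
    calc (16 : ℝ) < 2.7 ^ 3 := by norm_num
      _ ≤ _ := by gcongr; linarith
  linarith

theorem abs_im_add_lt (h : IsDrift κ R θ δ a) (hR : 3 ≤ R) (hθ' : 5 / 16 ≤ θ') {z : ℂ × ℂ}
    (hz : z ∈ stripCone R θ δ) (hz' : |z.1.im| < θ') : |(z.1 + a z).im| < θ' := by
  have h1 := (abs_le.1 (Complex.abs_im_le_norm (a z)))
  have h2 := h.norm_lt hR hz
  have h3 := h.im_neg z hz
  have h4 := h.im_pos z hz
  rw [Complex.add_im]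
  rw [abs_lt] at hz' ⊢
  by_cases hc1 : 1 / 4 ≤ z.1.im
  · have := h3 hc1
    constructor <;> linarith
  by_cases hc2 : z.1.im ≤ -(1 / 4)
  · have := h4 hc2
    constructor <;> linarith
  · push Not at hc1 hc2
    constructor <;> linarith

end IsDrift

/-! ### Straightening the invariant coordinate -/

/-- A map `(L, ψ) ↦ (L + a, ψ + b)` whose transversal part `b` decays faster than the drift `a` is
conjugate to `(L, s) ↦ (L + f, s)`, with a drift `f`: the limit `s` of `ψ` along the orbits is an
invariant function that is close to `ψ`. The conjugation `B` preserves the first coordinate. -/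
theorem exists_straightening {κ q R δ : ℝ} {a b : ℂ × ℂ → ℂ} (hκ : 1 ≤ κ) (hq : κ < q)
    (hq2 : q ≤ κ + 2) (hδ : 0 < δ) (ha : IsDrift κ R (1 / 2) δ a)
    (hb : DifferentiableOn ℂ b (stripCone R (1 / 2) δ))
    (hbq : ∀ z ∈ stripCone R (1 / 2) δ, ‖b z‖ ≤ Real.exp (-q * z.1.re)) :
    ∃ R' : ℝ, ∃ δ' : ℝ, 0 < δ' ∧ ∃ B : ℂ × ℂ → ℂ × ℂ, ∃ f : ℂ × ℂ → ℂ,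
      IsDrift κ R' (1 / 2) δ' f ∧ UnivalentOn B (stripCone R' (1 / 2) δ') ∧
      ∀ z ∈ stripCone R' (1 / 2) δ', (B z).1 = z.1 ∧ B z ∈ stripCone R (1 / 2) δ ∧
        ((B z).1 + a (B z), (B z).2 + b (B z)) = B (z.1 + f z, z.2) := by
  set η := q - κ with hη
  have hη0 : 0 < η := by linarith
  obtain ⟨R₁, hR₁R, hR₁3, hR₁δ, hR₁e, hR₁e'⟩ : ∃ R₁ : ℝ, R ≤ R₁ ∧ 3 ≤ R₁ ∧ 4 ≤ δ * R₁ ∧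
      Real.exp (-η * R₁) ≤ δ / 4 ∧ 4 / η * Real.exp (-η * R₁) ≤ 1 / 8 := by
    have ht : Tendsto (fun R₁ : ℝ => Real.exp (-η * R₁)) atTop (𝓝 0) :=
      Real.tendsto_exp_atBot.comp (tendsto_id.const_mul_atTop_of_neg (by linarith))
    have ht' : Tendsto (fun R₁ : ℝ => 4 / η * Real.exp (-η * R₁)) atTop (𝓝 0) := by
      simpa using ht.const_mul (4 / η)
    have h4 : ∀ᶠ R₁ : ℝ in atTop, 4 ≤ δ * R₁ :=
      (tendsto_id.const_mul_atTop hδ).eventually_ge_atTop 4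
    obtain ⟨R₁, h⟩ := ((eventually_ge_atTop R).and ((eventually_ge_atTop 3).and
      (h4.and ((ht.eventually_le_const (by positivity : (0 : ℝ) < δ / 4)).and
        (ht'.eventually_le_const (by norm_num : (0 : ℝ) < 1 / 8)))))).exists
    exact ⟨R₁, h.1, h.2.1, h.2.2.1, h.2.2.2.1, h.2.2.2.2⟩
  set D₁ := stripCone R₁ (1 / 2) δ with hD₁
  set D₂ := stripCone R₁ (1 / 2) (δ / 2) with hD₂
  set D₃ := stripCone R₁ (1 / 2) (δ / 4) with hD₃
  have hR₁0 : 0 ≤ R₁ := by linarith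
  have hD₁D : D₁ ⊆ stripCone R (1 / 2) δ := stripCone_subset hR₁R hR₁0 le_rfl le_rfl
  have hD₂₁ : D₂ ⊆ D₁ := stripCone_subset le_rfl hR₁0 le_rfl (by linarith)
  have hD₃₂ : D₃ ⊆ D₂ := stripCone_subset le_rfl hR₁0 le_rfl (by linarith)
  have ha₁ : IsDrift κ R₁ (1 / 2) δ a := ha.mono hD₁D
  set T : ℂ × ℂ → ℂ × ℂ := fun z => (z.1 + a z, z.2 + b z) with hT
  have hexp : ∀ {t : ℝ}, R₁ ≤ t → Real.exp (-η * t) ≤ Real.exp (-η * R₁) := fun {t} ht =>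
    Real.exp_le_exp.2 (by nlinarith)
  have hTm : ∀ δ' : ℝ, δ / 2 ≤ δ' → δ' ≤ δ →
      MapsTo T (stripCone R₁ (1 / 2) δ') (stripCone R₁ (1 / 2) δ') := by
    intro δ' h1 h2 z hz
    have hz1 : z ∈ D₁ := stripCone_subset le_rfl hR₁0 le_rfl h2 hz
    have hre := ha₁.re_add_le hz1
    refine ⟨?_, ha₁.abs_im_add_lt hR₁3 (by norm_num) hz1 hz.2.1, ?_⟩
    · have := Real.exp_pos (-κ * z.1.re)
      have := hz.1
      simp only [hT]
      linarith
    · have h3 : Real.exp (-q * z.1.re) = Real.exp (-κ * z.1.re) * Real.exp (-η * z.1.re) := by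
        rw [← Real.exp_add]; congr 1; rw [hη]; ring
      have h4 := hexp hz.1.le
      have h5 : Real.exp (-q * z.1.re) ≤ Real.exp (-κ * z.1.re) * (δ / 4) := by
        rw [h3]; gcongr; linarith
      have h6 := hbq z (hD₁D hz1)
      have h7 : δ' * (z.1.re + Real.exp (-κ * z.1.re) / 2) ≤ δ' * (z.1 + a z).re :=
        mul_le_mul_of_nonneg_left hre (by linarith)
      have h8 := Real.exp_pos (-κ * z.1.re)
      have h9 := norm_add_le z.2 (b z)
      have h10 := hz.2.2
      simp only [hT]
      nlinarith
  have hTd : DifferentiableOn ℂ T D₁ :=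
    (differentiable_fst.differentiableOn.add ha₁.differentiableOn).prodMk
      (differentiable_snd.differentiableOn.add (hb.mono hD₁D))
  obtain ⟨G, hGd, hGT, hGb⟩ := exists_orbitSum (T := T) (D := D₁) (κ := κ) (C := 1) hκ
    (hTm δ (by linarith) le_rfl)
    (isOpen_stripCone _ _ _) hTd (fun z hz => ha₁.re_add_le hz) (fun z hz => hR₁0.trans hz.1.le)
    hq hq2 (hb.mono hD₁D) (fun z hz => by simpa using hbq z (hD₁D hz))
  have hG8 : ∀ z ∈ D₁, ‖G z‖ ≤ 1 / 8 := by
    intro z hz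
    refine (hGb z hz).trans ?_
    rw [one_mul]
    refine le_trans ?_ hR₁e'
    exact mul_le_mul_of_nonneg_left (hexp hz.1.le) (by positivity)
  set Ξ : ℂ × ℂ → ℂ × ℂ := fun z => (z.1, z.2 + G z) with hΞ
  -- enlarging the second coordinate by at most one doubles the opening of the cone at most
  have hroom : ∀ {δ' : ℝ}, δ / 4 ≤ δ' → ∀ {L s w : ℂ}, (L, s) ∈ stripCone R₁ (1 / 2) δ' →
      ‖w - s‖ ≤ 1 → (L, w) ∈ stripCone R₁ (1 / 2) (2 * δ') := by
    intro δ' hδ' L s w h hw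
    refine ⟨h.1, h.2.1, ?_⟩
    have h1 : ‖w‖ ≤ ‖s‖ + ‖w - s‖ := by
      calc ‖w‖ = ‖s + (w - s)‖ := by congr 1; ring
        _ ≤ _ := norm_add_le _ _
    have h2 : ‖s‖ < δ' * L.re := h.2.2
    have h3 : R₁ < L.re := h.1
    have h4 : 1 ≤ δ' * L.re := by nlinarith
    change ‖w‖ < 2 * δ' * L.re
    linarith
  -- on each line `L = const`, `Ξ` is close to the identity in the `C^1` sense
  have hder : ∀ z ∈ D₂, ∃ d : ℂ, HasDerivAt (fun w => w + G (z.1, w)) (1 + d) z.2 ∧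
      ‖d‖ ≤ 1 / 4 := by
    rintro ⟨L, s⟩ hz
    have hmem : ∀ w ∈ ball s 1, (L, w) ∈ D₁ := by
      intro w hw
      rw [mem_ball, dist_eq_norm] at hw
      have := hroom (by linarith) hz hw.le
      rwa [mul_div_cancel₀ δ two_ne_zero] at this
    have hd : DifferentiableOn ℂ (fun w => G (L, w)) (ball s 1) :=
      hGd.comp (f := fun w => (L, w)) (by fun_prop) hmem
    refine ⟨deriv (fun w => G (L, w)) s, ?_, ?_⟩
    · exact (hasDerivAt_id s).add (hd.differentiableAt (ball_mem_nhds s one_pos)).hasDerivAt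
    · rw [norm_deriv_eq_norm_fderiv]
      refine (norm_fderiv_le_of_norm_le_on_ball one_pos hd (M := 1 / 8) fun w hw => ?_).trans ?_
      · exact hG8 _ (hmem w hw)
      · norm_num
  choose! d hdd hdb using hder
  have hfib : ∀ L : ℂ, Convex ℝ {w : ℂ | (L, w) ∈ D₂} := by
    intro L z hz w hw u v hu hv huv
    have := convex_stripCone R₁ (1 / 2) (δ / 2) hz hw hu hv huv
    have hs : u • L + v • L = L := by rw [← add_smul, huv, one_smul]
    rw [Prod.smul_mk, Prod.smul_mk, Prod.mk_add_mk, hs] at this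
    exact this
  have hre34 : ∀ L : ℂ, ∀ w ∈ {w : ℂ | (L, w) ∈ D₂}, 3 / 4 ≤ (1 + d (L, w)).re := by
    intro L w hw
    have h1 := hdb (L, w) hw
    have h2 := (abs_le.1 (Complex.abs_re_le_norm (d (L, w)))).1
    rw [Complex.add_re, Complex.one_re]
    linarith
  have hΞd : DifferentiableOn ℂ Ξ D₂ :=
    differentiable_fst.differentiableOn.prodMk
      (differentiable_snd.differentiableOn.add (hGd.mono hD₂₁))
  have hD₂o : IsOpen D₂ := isOpen_stripCone _ _ _
  have hΞu : UnivalentOn Ξ D₂ := by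
    refine ⟨hD₂o, hΞd, ?_, ?_⟩
    · rintro ⟨L, s⟩ hz ⟨L', s'⟩ hw h
      simp only [hΞ, Prod.mk.injEq] at h
      obtain ⟨rfl, h⟩ := h
      have := injOn_of_re_deriv_pos (f := fun w => w + G (L, w)) (hfib L) (fun w hw => hdd (L, w) hw)
        (fun w hw => lt_of_lt_of_le (by norm_num) (hre34 L w hw)) hz hw h
      rw [this]
    · intro z hz
      refine injective_fderiv_of_triangular (g := id) (hΞd.differentiableAt (hD₂o.mem_nhds hz))
        (hasDerivAt_id _) one_ne_zero (Eventually.of_forall fun _ => rfl) (hdd z hz) ?_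
      intro h0
      have := hre34 z.1 z.2 hz
      rw [h0] at this
      norm_num at this
  have hsurj : ∀ z ∈ D₃, ∃ w ∈ D₂, Ξ w = z := by
    rintro ⟨L, s⟩ hz
    have hz₂ : (L, s) ∈ D₂ := hD₃₂ hz
    have hball : closedBall s 1 ⊆ {w : ℂ | (L, w) ∈ D₂} := by
      intro w hw
      rw [mem_closedBall, dist_eq_norm] at hw
      have := hroom le_rfl hz hw
      rw [show 2 * (δ / 4) = δ / 2 by ring] at this
      exact this
    have himg := ball_subset_image_closedBall_of_le_re_deriv (f := fun w => w + G (L, w)) (hfib L)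
      (fun w hw => hdd (L, w) hw) (by norm_num) (hre34 L) one_pos hball
    have hs : s ∈ ball (s + G (L, s)) (3 / 4 * 1 / 2) := by
      rw [mem_ball, dist_eq_norm, sub_add_cancel_left, norm_neg]
      exact (hG8 _ (hD₂₁ hz₂)).trans_lt (by norm_num)
    obtain ⟨w, hw, hws⟩ := himg hs
    exact ⟨(L, w), hball hw, by simp only [hΞ]; exact congrArg _ hws⟩
  set B := Function.invFunOn Ξ D₂ with hB
  have hBmem : ∀ z ∈ D₃, B z ∈ D₂ := fun z hz => Function.invFunOn_mem (hsurj z hz)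
  have hBeq : ∀ z ∈ D₃, Ξ (B z) = z := fun z hz => Function.invFunOn_eq (hsurj z hz)
  have hB1 : ∀ z ∈ D₃, (B z).1 = z.1 := fun z hz => by
    have := congrArg Prod.fst (hBeq z hz)
    exact this
  have hB2 : ∀ z ∈ D₃, (B z).2 + G (B z) = z.2 := fun z hz => by
    have := congrArg Prod.snd (hBeq z hz)
    exact this
  have hBu : UnivalentOn B D₃ :=
    hΞu.invFunOn.mono (fun z hz => hsurj z hz) (isOpen_stripCone _ _ _)
  refine ⟨R₁, δ / 4, by positivity, B, fun z => a (B z), ?_, hBu, fun z hz =>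
    ⟨hB1 z hz, hD₁D (hD₂₁ (hBmem z hz)), ?_⟩⟩
  · have ha₂ : IsDrift κ R₁ (1 / 2) (δ / 2) a := ha₁.mono hD₂₁
    refine ⟨ha₂.differentiableOn.comp hBu.differentiableOn hBmem, fun z hz => ?_, fun z hz => ?_,
      fun z hz => ha₂.half_norm_le_re _ (hBmem z hz), fun z hz => ?_, fun z hz => ?_⟩
    · rw [← hB1 z hz]; exact ha₂.lower _ (hBmem z hz)
    · rw [← hB1 z hz]; exact ha₂.upper _ (hBmem z hz)
    · rw [← hB1 z hz]; exact ha₂.im_neg _ (hBmem z hz)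
    · rw [← hB1 z hz]; exact ha₂.im_pos _ (hBmem z hz)
  · change T (B z) = _
    have hTB : T (B z) ∈ D₂ := hTm (δ / 2) le_rfl (by linarith) (hBmem z hz)
    have h1 : Ξ (T (B z)) = (z.1 + a (B z), z.2) := by
      have h2 := hGT (B z) (hD₂₁ (hBmem z hz))
      have h3 := hB2 z hz
      refine Prod.ext ?_ ?_
      · simp only [hΞ, hT, hB1 z hz]
      · simp only [hΞ]
        rw [h2, ← h3]
        simp only [hT]
        ring
    rw [← h1]
    exact (hΞu.injOn.leftInvOn_invFunOn hTB).symm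

/-! ### Fatou coordinates -/

section FatouCoordinate

variable {κ R δ : ℝ} {f : ℂ × ℂ → ℂ}

/-- The partial derivative of `f` in the first variable. -/
noncomputable def partialFst (f : ℂ × ℂ → ℂ) (z : ℂ × ℂ) : ℂ := fderiv ℂ f z (1, 0)

theorem hasDerivAt_partialFst {z : ℂ × ℂ} (hf : DifferentiableAt ℂ f z) :
    HasDerivAt (fun w => f (w, z.2)) (partialFst f z) z.1 := by
  have hl : HasDerivAt (fun w : ℂ => ((w, z.2) : ℂ × ℂ)) (1, 0) z.1 :=
    (hasDerivAt_id _).prodMk (hasDerivAt_const _ _)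
  exact hf.hasFDerivAt.comp_hasDerivAt z.1 hl

/-- Room to move `L` by `r` when passing to a smaller model domain. -/
theorem mem_stripCone_of_norm_sub_lt {R θ δ r R' θ' δ' : ℝ} (hR : R + r ≤ R')
    (hθ : θ' + r ≤ θ) (hδ : 0 < δ) (hδ' : 2 * δ' = δ) (hr : 2 * r ≤ R') {z : ℂ × ℂ}
    (hz : z ∈ stripCone R' θ' δ') {w : ℂ} (hw : ‖w - z.1‖ ≤ r) : (w, z.2) ∈ stripCone R θ δ := by
  obtain ⟨h1, h2, h3⟩ := hz
  have h4 := (abs_le.1 ((Complex.abs_re_le_norm (w - z.1)).trans hw)).1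
  have h5 := (Complex.abs_im_le_norm (w - z.1)).trans hw
  rw [Complex.sub_re] at h4
  rw [Complex.sub_im] at h5
  refine ⟨?_, ?_, ?_⟩
  · change R < w.re
    linarith
  · change |w.im| < θ
    calc |w.im| = |z.1.im + (w.im - z.1.im)| := by congr 1; ring
      _ ≤ |z.1.im| + |w.im - z.1.im| := abs_add_le _ _
      _ < θ := by linarith
  · change ‖z.2‖ < δ * w.re
    have h6 : δ * (z.1.re - r) ≤ δ * w.re := mul_le_mul_of_nonneg_left (by linarith) hδ.le
    have h7 : 0 ≤ δ * (z.1.re - 2 * r) := mul_nonneg hδ.le (by linarith)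
    have h8 : δ' = δ / 2 := by linarith
    rw [h8] at h3
    linarith

/-- Cauchy estimates for a drift, on a smaller model domain. -/
theorem IsDrift.norm_sub_sub_le (hf : IsDrift κ R (1 / 2) δ f) (hδ : 0 < δ) {R₁ : ℝ}
    (hR₁ : R + 1 ≤ R₁) (hR₁3 : 3 ≤ R₁) {z : ℂ × ℂ} (hz : z ∈ stripCone R₁ (3 / 8) (δ / 2)) :
    ‖partialFst f z‖ ≤ 32 * Real.exp (-z.1.re) ∧ ∀ w : ℂ, ‖w - z.1‖ < 1 / 8 →
      ‖f (w, z.2) - f z - partialFst f z * (w - z.1)‖ ≤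
        512 * Real.exp (-z.1.re) * ‖w - z.1‖ ^ 2 := by
  have hmem : ∀ w : ℂ, ‖w - z.1‖ < 1 / 8 → (w, z.2) ∈ stripCone R (1 / 2) δ := fun w hw =>
    mem_stripCone_of_norm_sub_lt (by linarith) (by norm_num) hδ (by ring) (by linarith) hz hw.le
  have hz0 : z ∈ stripCone R (1 / 2) δ := hmem z.1 (by simp)
  have hd : DifferentiableOn ℂ (fun w => f (w, z.2)) (ball z.1 (1 / 8)) :=
    hf.differentiableOn.comp (f := fun w => (w, z.2)) (by fun_prop)
      fun w hw => hmem w (by rwa [mem_ball, dist_eq_norm] at hw)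
  have hM : ∀ w ∈ ball z.1 (1 / 8), ‖f (w, z.2)‖ ≤ 2 * Real.exp (-z.1.re) := by
    intro w hw
    rw [mem_ball, dist_eq_norm] at hw
    have h4 := (abs_le.1 ((Complex.abs_re_le_norm (w - z.1)).trans hw.le)).1
    rw [Complex.sub_re] at h4
    refine (hf.upper _ (hmem w hw)).trans ?_
    have h5 : Real.exp (-w.re) ≤ Real.exp (1 / 8) * Real.exp (-z.1.re) := by
      rw [← Real.exp_add]
      exact Real.exp_le_exp.2 (by linarith)
    refine h5.trans ?_
    have h6 : Real.exp (1 / 8) ≤ 2 := by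
      have := Real.exp_bound_div_one_sub_of_interval (x := 1 / 8) (by norm_num) (by norm_num)
      linarith
    gcongr
  have hder : deriv (fun w => f (w, z.2)) z.1 = partialFst f z :=
    (hasDerivAt_partialFst (hf.differentiableOn.differentiableAt
      ((isOpen_stripCone _ _ _).mem_nhds hz0))).deriv
  constructor
  · have := norm_fderiv_le_of_norm_le_on_ball (by norm_num) hd hM
    rw [← norm_deriv_eq_norm_fderiv, hder] at this
    linarith
  · intro w hw
    have := norm_sub_sub_deriv_mul_le hd hM (z := w) (by rwa [mem_ball, dist_eq_norm])
    rw [hder] at this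
    calc _ ≤ _ := this
      _ = _ := by ring

/-- **Fatou coordinates.** A fibre preserving map `(L, s) ↦ (L + f, s)` with a drift `f` is
conjugate on a smaller model domain, by a univalent map `(φ, s)`, to the translation
`(w, s) ↦ (w + 1, s)`. Moreover the translates of the image of `(φ, s)` cover `ℂ²`.

The form `dL / f` on the fibres is invariant up to the factor `ρ = (1 + ∂f) f / (f ∘ T)`, which
differs from `1` by `O (exp (-2 Re L))`. So `Y = exp (∑ log ρ ∘ T ^ n) / f` is the density of an
invariant form, and `φ` is a primitive of it. -/
theorem exists_fatouCoordinate (hκ : 1 ≤ κ) (hκ2 : κ < 2) (hδ : 0 < δ)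
    (hf : IsDrift κ R (1 / 2) δ f) :
    ∃ R' δ' : ℝ, 0 ≤ R' ∧ 0 < δ' ∧ stripCone R' (3 / 8) δ' ⊆ stripCone R (1 / 2) δ ∧
      (∀ z ∈ stripCone R' (3 / 8) δ', (z.1 + f z, z.2) ∈ stripCone R' (3 / 8) δ') ∧
      ∃ φ : ℂ × ℂ → ℂ, UnivalentOn (fun z => (φ z, z.2)) (stripCone R' (3 / 8) δ') ∧
        (∀ z ∈ stripCone R' (3 / 8) δ', φ (z.1 + f z, z.2) = φ z + 1) ∧
        ∀ ζ s : ℂ, ∃ n : ℕ, ∃ z ∈ stripCone R' (3 / 8) δ', z.2 = s ∧ φ z = ζ + n := by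
  set η := 2 - κ with hη
  have hη0 : 0 < η := by linarith
  -- the constant in the bound for the orbit sum of `log ρ`, where `‖log ρ‖ ≤ 1536 exp (-2 Re L)`
  set Cl := 1536 * (4 / η) with hCl
  have hCl0 : 0 < Cl := by positivity
  obtain ⟨R₁, hR₁R, hR₁3, hR₁e, hR₁l⟩ : ∃ R₁ : ℝ, R + 1 ≤ R₁ ∧ 3 ≤ R₁ ∧
      Real.exp (-R₁) ≤ 1 / 1024 ∧ Cl * Real.exp (-η * R₁) ≤ 1 / 16 := by
    have ht : Tendsto (fun R₁ : ℝ => Cl * Real.exp (-η * R₁)) atTop (𝓝 0) := by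
      simpa using (Real.tendsto_exp_atBot.comp
        (tendsto_id.const_mul_atTop_of_neg (by linarith : -η < 0))).const_mul Cl
    have ht' : Tendsto (fun R₁ : ℝ => Real.exp (-R₁)) atTop (𝓝 0) :=
      Real.tendsto_exp_neg_atTop_nhds_zero
    obtain ⟨R₁, h⟩ := ((eventually_ge_atTop (R + 1)).and ((eventually_ge_atTop 3).and
      ((ht'.eventually_le_const (by norm_num : (0 : ℝ) < 1 / 1024)).and
        (ht.eventually_le_const (by norm_num : (0 : ℝ) < 1 / 16))))).exists
    exact ⟨R₁, h.1, h.2.1, h.2.2.1, h.2.2.2⟩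
  have hR₁0 : 0 ≤ R₁ := by linarith
  set D := stripCone R₁ (3 / 8) (δ / 2) with hD
  have hDo : IsOpen D := isOpen_stripCone _ _ _
  have hDD₀ : D ⊆ stripCone R (1 / 2) δ :=
    stripCone_subset (by linarith) hR₁0 (by norm_num) (by linarith)
  have hfD : IsDrift κ R₁ (3 / 8) (δ / 2) f := hf.mono hDD₀
  have hfat : ∀ z ∈ D, DifferentiableAt ℂ f z := fun z hz =>
    hfD.differentiableOn.differentiableAt (hDo.mem_nhds hz)
  have hexp : ∀ z ∈ D, Real.exp (-z.1.re) ≤ 1 / 1024 := fun z hz =>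
    (Real.exp_le_exp.2 (by linarith [hz.1])).trans hR₁e
  set T : ℂ × ℂ → ℂ × ℂ := fun z => (z.1 + f z, z.2) with hT
  -- the map preserves every smaller strip that is not too thin
  have hTm : ∀ {R₂ θ₂ δ₂ : ℝ}, 5 / 16 ≤ θ₂ → 0 ≤ δ₂ → stripCone R₂ θ₂ δ₂ ⊆ D →
      MapsTo T (stripCone R₂ θ₂ δ₂) (stripCone R₂ θ₂ δ₂) := by
    intro R₂ θ₂ δ₂ h1 h2 h3 z hz
    have hre := hfD.re_add_le (h3 hz)
    have hp := Real.exp_pos (-κ * z.1.re)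
    refine ⟨?_, hfD.abs_im_add_lt hR₁3 h1 (h3 hz) hz.2.1, ?_⟩
    · have := hz.1
      simp only [hT]
      linarith
    · have := hz.2.2
      simp only [hT]
      nlinarith
  have hTD : MapsTo T D D := hTm (by norm_num) (by positivity) Subset.rfl
  have hTd : DifferentiableOn ℂ T D :=
    (differentiable_fst.differentiableOn.add hfD.differentiableOn).prodMk
      differentiable_snd.differentiableOn
  have hre : ∀ z ∈ D, z.1.re + Real.exp (-κ * z.1.re) / 2 ≤ (T z).1.re := fun z hz =>
    hfD.re_add_le hz
  have hpos : ∀ z ∈ D, 0 ≤ z.1.re := fun z hz => hR₁0.trans hz.1.le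
  -- during one step `f` varies by a small relative amount
  have hnear : ∀ z ∈ D, ∀ w : ℂ, ‖w - z.1‖ ≤ ‖f z‖ →
      ‖f (w, z.2) - f z‖ ≤ 64 * Real.exp (-z.1.re) * ‖f z‖ := by
    intro z hz w hw
    obtain ⟨h1, h2⟩ := hf.norm_sub_sub_le hδ hR₁R hR₁3 hz
    have h3 := hfD.norm_lt hR₁3 hz
    have h4 := h2 w (by linarith)
    have h5 : ‖partialFst f z * (w - z.1)‖ ≤ 32 * Real.exp (-z.1.re) * ‖f z‖ := by
      rw [norm_mul]; gcongr
    have h6 : 512 * Real.exp (-z.1.re) * ‖w - z.1‖ ^ 2 ≤ 32 * Real.exp (-z.1.re) * ‖f z‖ := by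
      calc 512 * Real.exp (-z.1.re) * ‖w - z.1‖ ^ 2
          ≤ 512 * Real.exp (-z.1.re) * ((1 / 16) * ‖f z‖) := by
            rw [sq]; gcongr; linarith
        _ = _ := by ring
    calc ‖f (w, z.2) - f z‖ = ‖(f (w, z.2) - f z - partialFst f z * (w - z.1)) +
          partialFst f z * (w - z.1)‖ := by congr 1; ring
      _ ≤ _ := norm_add_le _ _
      _ ≤ _ := by linarith
  have hnear2 : ∀ z ∈ D, ∀ w : ℂ, ‖w - z.1‖ ≤ ‖f z‖ → ‖f z‖ / 2 ≤ ‖f (w, z.2)‖ := by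
    intro z hz w hw
    have h1 := hnear z hz w hw
    have h2 := hexp z hz
    have h3 := norm_sub_norm_le (f z) (f (w, z.2))
    rw [norm_sub_rev] at h3
    nlinarith [norm_nonneg (f z)]
  have hf0 : ∀ z ∈ D, f z ≠ 0 := fun z hz => hfD.ne_zero hz
  -- the distortion of `dL / f`
  set ρ : ℂ × ℂ → ℂ := fun z => (1 + partialFst f z) * f z * (f (T z))⁻¹ with hρ
  have hρ1 : ∀ z ∈ D, ‖ρ z - 1‖ ≤ 1024 * Real.exp (-2 * z.1.re) := by
    intro z hz
    obtain ⟨h1, h2⟩ := hf.norm_sub_sub_le hδ hR₁R hR₁3 hz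
    have h3 := hfD.norm_lt hR₁3 hz
    have hw : ‖z.1 + f z - z.1‖ = ‖f z‖ := by rw [add_sub_cancel_left]
    have h4 := h2 (z.1 + f z) (by rw [hw]; linarith)
    have h5 := hnear2 z hz (z.1 + f z) hw.le
    have h6 : ρ z - 1 = -(f (T z) - f z - partialFst f z * (z.1 + f z - z.1)) / f (T z) := by
      have := hf0 _ (hTD hz)
      rw [hρ]
      field_simp
      ring
    have hfz : 0 < ‖f z‖ := norm_pos_iff.2 (hf0 z hz)
    have h7 := hfD.upper z hz
    rw [h6, norm_div, norm_neg, div_le_iff₀ (by change 0 < ‖f (z.1 + f z, z.2)‖; linarith)]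
    rw [hw] at h4
    have h8 : Real.exp (-2 * z.1.re) = Real.exp (-z.1.re) * Real.exp (-z.1.re) := by
      rw [← Real.exp_add]; congr 1; ring
    calc _ ≤ 512 * Real.exp (-z.1.re) * ‖f z‖ ^ 2 := h4
      _ = 1024 * (Real.exp (-z.1.re) * ‖f z‖) * (‖f z‖ / 2) := by ring
      _ ≤ 1024 * (Real.exp (-z.1.re) * Real.exp (-z.1.re)) * ‖f (T z)‖ := by gcongr
      _ = _ := by rw [h8]
  have hρhalf : ∀ z ∈ D, ‖ρ z - 1‖ ≤ 1 / 2 := by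
    intro z hz
    refine (hρ1 z hz).trans ?_
    have h8 : Real.exp (-2 * z.1.re) = Real.exp (-z.1.re) * Real.exp (-z.1.re) := by
      rw [← Real.exp_add]; congr 1; ring
    have := hexp z hz
    have := Real.exp_pos (-z.1.re)
    rw [h8]
    nlinarith
  have hρre : ∀ z ∈ D, 0 < (ρ z).re := by
    intro z hz
    have h1 := (abs_le.1 ((Complex.abs_re_le_norm _).trans (hρhalf z hz))).1
    rw [Complex.sub_re, Complex.one_re] at h1
    linarith
  have hρd : DifferentiableOn ℂ ρ D := by
    have h1 : DifferentiableOn ℂ (f ∘ T) D := DifferentiableOn.comp hfD.differentiableOn hTd hTD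
    refine DifferentiableOn.fun_mul ?_ (h1.fun_inv fun z hz => hf0 _ (hTD hz))
    refine DifferentiableOn.fun_mul ?_ hfD.differentiableOn
    exact (differentiableOn_fderiv_apply hDo hfD.differentiableOn (1, 0)).const_add 1
  obtain ⟨lam, hlamd, hlamT, hlamb⟩ := exists_orbitSum (T := T) (D := D) (κ := κ) (q := 2)
    (C := 1536) (g := fun z => Complex.log (ρ z)) hκ hTD hDo hTd hre hpos hκ2 (by linarith)
    (hρd.clog fun z hz => Or.inl (hρre z hz)) (fun z hz => by
      have h1 := Complex.norm_log_one_add_half_le_self (hρhalf z hz)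
      rw [add_sub_cancel] at h1
      linarith [hρ1 z hz])
  have hlam16 : ∀ z ∈ D, ‖lam z‖ ≤ 1 / 16 := by
    intro z hz
    refine (hlamb z hz).trans (le_trans ?_ hR₁l)
    refine mul_le_mul_of_nonneg_left (Real.exp_le_exp.2 ?_) hCl0.le
    nlinarith [hz.1]
  have hexplam : ∀ z ∈ D, ‖Complex.exp (lam z) - 1‖ ≤ 2 * ‖lam z‖ := fun z hz =>
    Complex.norm_exp_sub_one_le ((hlam16 z hz).trans (by norm_num))
  -- the density of the invariant form `Y dL`
  set Y : ℂ × ℂ → ℂ := fun z => Complex.exp (lam z) * (f z)⁻¹ with hY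
  have hYd : DifferentiableOn ℂ Y D := hlamd.cexp.fun_mul (hfD.differentiableOn.fun_inv hf0)
  have hYT : ∀ z ∈ D, Y (T z) * (1 + partialFst f z) = Y z := by
    intro z hz
    have h1 : ρ z ≠ 0 := fun h => by
      have := hρre z hz
      rw [h] at this
      simp at this
    have h2 : Complex.exp (lam (T z)) * ρ z = Complex.exp (lam z) := by
      rw [hlamT z hz, Complex.exp_sub, Complex.exp_log h1, div_mul_cancel₀ _ h1]
    have h3 := hf0 z hz
    have h4 := hf0 _ (hTD hz)
    rw [hY]
    simp only
    rw [← h2, hρ]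
    simp only
    field_simp
  have hYre : ∀ z ∈ D, Real.exp z.1.re / 4 ≤ (Y z).re := by
    intro z hz
    have hfz : 0 < ‖f z‖ := norm_pos_iff.2 (hf0 z hz)
    have h1 : Y z = (f z)⁻¹ + (Complex.exp (lam z) - 1) * (f z)⁻¹ := by rw [hY]; ring
    have h2 : 1 / (2 * ‖f z‖) ≤ ((f z)⁻¹).re := by
      rw [Complex.inv_re, ← Complex.sq_norm, div_le_div_iff₀ (by positivity) (by positivity)]
      nlinarith [hfD.half_norm_le_re z hz]
    have h3 : ‖(Complex.exp (lam z) - 1) * (f z)⁻¹‖ ≤ 1 / 8 * ‖f z‖⁻¹ := by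
      rw [norm_mul, norm_inv]
      have := hexplam z hz
      have := hlam16 z hz
      gcongr
      linarith
    have h4 := (abs_le.1 ((Complex.abs_re_le_norm _).trans h3)).1
    have h5 : Real.exp z.1.re ≤ ‖f z‖⁻¹ := by
      rw [le_inv_comm₀ (Real.exp_pos _) hfz, ← Real.exp_neg]
      exact hfD.upper z hz
    have h6 : 1 / (2 * ‖f z‖) = ‖f z‖⁻¹ / 2 := by field_simp
    have h7 := inv_pos.2 hfz
    rw [h1, Complex.add_re]
    linarith
  have hYpos : ∀ z ∈ D, 0 < (Y z).re := fun z hz =>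
    lt_of_lt_of_le (by positivity) (hYre z hz)
  obtain ⟨φ, hφd, hφder⟩ := exists_fiberPrimitive (by norm_num) (by positivity) hYd
  have hfib : ∀ s : ℂ, Convex ℝ {w : ℂ | (w, s) ∈ D} := convex_fiber_stripCone _ _ _
  -- the functional equation holds up to a constant on each fibre, and asymptotically at infinity
  have hφT : ∀ z ∈ D, φ (T z) = φ z + 1 := by
    rintro ⟨L, s⟩ hz
    have hder : ∀ w ∈ {w : ℂ | (w, s) ∈ D},
        HasDerivAt (fun w => φ (T (w, s)) - φ (w, s)) 0 w := by
      intro w hw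
      have h1 : HasDerivAt (fun w => w + f (w, s)) (1 + partialFst f (w, s)) w :=
        (hasDerivAt_id w).add (hasDerivAt_partialFst (hfat (w, s) hw))
      have h2 : HasDerivAt (fun w => φ (w, s)) (Y (T (w, s))) (w + f (w, s)) :=
        hφder (T (w, s)) (hTD hw)
      have h3 := (h2.comp w h1).fun_sub (hφder (w, s) hw)
      rw [hYT (w, s) hw, sub_self] at h3
      exact h3
    -- between `x` and `x + f`, the density `Y` is almost the constant `1 / f`, whose integral is `1`
    have hest : ∀ x : ℝ, ((x : ℂ), s) ∈ D → ‖φ (T (x, s)) - φ (x, s) - 1‖ ≤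
        4 * (Cl * Real.exp (-η * x)) + 128 * Real.exp (-x) := by
      intro x hx
      have hxT := hTD hx
      set a := f (x, s) with ha
      have ha0 : a ≠ 0 := hf0 _ hx
      have hseg : ∀ w ∈ segment ℝ (x : ℂ) (x + a), (w, s) ∈ D := fun w hw =>
        (hfib s).segment_subset hx hxT hw
      have hw1 : ∀ w ∈ segment ℝ (x : ℂ) (x + a), ‖w - x‖ ≤ ‖a‖ ∧ x ≤ w.re := by
        rintro w ⟨u, v, hu, hv, huv, rfl⟩
        have h1 : u • (x : ℂ) + v • ((x : ℂ) + a) = x + v • a := by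
          rw [smul_add, ← add_assoc, ← add_smul, huv, one_smul]
        have h2 : v ≤ 1 := by linarith
        rw [h1]
        constructor
        · rw [add_sub_cancel_left, norm_smul, Real.norm_of_nonneg hv]
          nlinarith [norm_nonneg a]
        · have h3 : ‖a‖ / 2 ≤ a.re := hfD.half_norm_le_re _ hx
          have h4 : 0 ≤ v * a.re := mul_nonneg hv (by linarith [norm_nonneg a])
          simpa using h4
      have hbd : ∀ w ∈ segment ℝ (x : ℂ) (x + a), ‖Y (w, s) - a⁻¹‖ ≤
          (4 * (Cl * Real.exp (-η * x)) + 128 * Real.exp (-x)) * ‖a‖⁻¹ := by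
        intro w hw
        have hwD := hseg w hw
        have hfw0 := hf0 _ hwD
        obtain ⟨h1, h2⟩ := hw1 w hw
        have h3 : ‖f (w, s) - a‖ ≤ 64 * Real.exp (-x) * ‖a‖ := hnear _ hx w h1
        have h4 : ‖a‖ / 2 ≤ ‖f (w, s)‖ := hnear2 _ hx w h1
        have h5 : ‖Complex.exp (lam (w, s)) - 1‖ ≤ 2 * (Cl * Real.exp (-η * x)) := by
          refine (hexplam _ hwD).trans ?_
          refine mul_le_mul_of_nonneg_left ((hlamb _ hwD).trans ?_) (by norm_num)
          refine mul_le_mul_of_nonneg_left (Real.exp_le_exp.2 ?_) hCl0.le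
          change -η * w.re ≤ -η * x
          nlinarith
        have h6 : Y (w, s) - a⁻¹ =
            ((Complex.exp (lam (w, s)) - 1) * a - (f (w, s) - a)) / f (w, s) * a⁻¹ := by
          rw [hY]
          field_simp
          ring
        have hap : 0 < ‖a‖ := norm_pos_iff.2 ha0
        rw [h6, norm_mul, norm_inv, norm_div]
        refine mul_le_mul_of_nonneg_right ?_ (by positivity)
        rw [div_le_iff₀ (by linarith)]
        set E₁ := Cl * Real.exp (-η * x)
        set E₂ := Real.exp (-x)
        have hE₁ : 0 ≤ E₁ := by positivity
        have hE₂ : 0 ≤ E₂ := by positivity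
        calc _ ≤ ‖(Complex.exp (lam (w, s)) - 1) * a‖ + ‖f (w, s) - a‖ := norm_sub_le _ _
          _ ≤ 2 * E₁ * ‖a‖ + 64 * E₂ * ‖a‖ := by
            rw [norm_mul]; gcongr
          _ = (4 * E₁ + 128 * E₂) * (‖a‖ / 2) := by ring
          _ ≤ _ := by gcongr
      have hmv := (convex_segment (𝕜 := ℝ) (x : ℂ) (x + a)).norm_image_sub_le_of_norm_hasDerivWithin_le
        (f := fun w => φ (w, s) - w * a⁻¹) (f' := fun w => Y (w, s) - a⁻¹)
        (C := (4 * (Cl * Real.exp (-η * x)) + 128 * Real.exp (-x)) * ‖a‖⁻¹)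
        (fun w hw => by
          have h1 := (hφder (w, s) (hseg w hw)).sub ((hasDerivAt_id w).mul_const a⁻¹)
          rw [one_mul] at h1
          exact h1.hasDerivWithinAt) hbd
        (left_mem_segment ℝ _ _) (right_mem_segment ℝ _ _)
      rw [add_sub_cancel_left, mul_assoc, inv_mul_cancel₀ (norm_ne_zero_iff.2 ha0), mul_one] at hmv
      refine le_trans (le_of_eq ?_) hmv
      congr 1
      simp only [hT, ← ha]
      field_simp
      ring
    obtain ⟨x₀, hx₀⟩ := exists_ofReal_mem_stripCone R₁ (θ := 3 / 8) (δ := δ / 2) (by norm_num)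
      (by positivity) s
    have hfo : IsOpen {w : ℂ | (w, s) ∈ D} := hDo.preimage (by fun_prop)
    have hconst : ∀ x : ℝ, x₀ < x → φ (T (L, s)) - φ (L, s) = φ (T (x, s)) - φ (x, s) :=
      fun x hx => hfo.is_const_of_deriv_eq_zero (𝕜 := ℂ) (hfib s).isPreconnected
        (f := fun w => φ (T (w, s)) - φ (w, s))
        (fun w hw => (hder w hw).differentiableAt.differentiableWithinAt)
        (fun w hw => (hder w hw).deriv) hz (hx₀ x hx)
    have hlim : Tendsto (fun x : ℝ => 4 * (Cl * Real.exp (-η * x)) + 128 * Real.exp (-x)) atTop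
        (𝓝 0) := by
      have ht : Tendsto (fun x : ℝ => Real.exp (-η * x)) atTop (𝓝 0) :=
        Real.tendsto_exp_atBot.comp (tendsto_id.const_mul_atTop_of_neg (by linarith : -η < 0))
      have := ((ht.const_mul Cl).const_mul 4).add
        (Real.tendsto_exp_neg_atTop_nhds_zero.const_mul 128)
      simpa using this
    have hle : ‖φ (T (L, s)) - φ (L, s) - 1‖ ≤ 0 := by
      refine ge_of_tendsto hlim ?_
      filter_upwards [eventually_gt_atTop x₀] with x hx
      rw [hconst x hx]
      exact hest x (hx₀ x hx)
    have := norm_le_zero_iff.1 hle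
    linear_combination this
  have hφTn : ∀ n : ℕ, ∀ z ∈ D, φ (T^[n] z) = φ z + n ∧ (T^[n] z).2 = z.2 := by
    intro n z hz
    induction n with
    | zero => simp
    | succ n ih =>
      rw [Function.iterate_succ_apply', hφT _ (hTD.iterate n hz), ih.1]
      refine ⟨by push_cast; ring, ?_⟩
      simp only [hT]
      exact ih.2
  refine ⟨R₁, δ / 2, hR₁0, by positivity, hDD₀, hTD, φ, ⟨hDo, ?_, ?_, ?_⟩, hφT, ?_⟩
  · exact hφd.prodMk differentiable_snd.differentiableOn
  · rintro ⟨L, s⟩ hz ⟨L', s'⟩ hw h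
    simp only [Prod.mk.injEq] at h
    obtain ⟨h, rfl⟩ := h
    have := injOn_of_re_deriv_pos (f := fun w => φ (w, s)) (hfib s)
      (fun w hw => hφder (w, s) hw) (fun w hw => hYpos (w, s) hw) hz hw h
    rw [this]
  · intro z hz
    have hφz := hφd.differentiableAt (hDo.mem_nhds hz)
    have h1 : HasFDerivAt (fun z => (φ z, z.2))
        ((fderiv ℂ φ z).prod (ContinuousLinearMap.snd ℂ ℂ ℂ)) z :=
      hφz.hasFDerivAt.prodMk hasFDerivAt_snd
    have h2 : partialFst φ z = Y z := (hasDerivAt_partialFst hφz).unique (hφder z hz)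
    rw [h1.fderiv, injective_iff_map_eq_zero]
    rintro ⟨x, y⟩ hxy
    simp only [ContinuousLinearMap.prod_apply, ContinuousLinearMap.coe_snd', Prod.mk_eq_zero] at hxy
    obtain ⟨hx, rfl⟩ := hxy
    have h3 : fderiv ℂ φ z (x, 0) = x • partialFst φ z := by
      rw [partialFst, ← map_smul]; simp
    rw [h3, h2, smul_eq_mul, mul_eq_zero] at hx
    have h4 : Y z ≠ 0 := fun h => by
      have := hYpos z hz
      rw [h] at this
      simp at this
    simp [hx.resolve_right h4]
  · -- on the fibre of `s` the image of `φ` contains a disc around the `n`-th point of an orbit,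
    -- whose radius tends to infinity with `n`, as `Re Y` is at least `exp (Re L) / 4`
    intro ζ s
    -- an orbit that stays away from the boundary of the strip
    set D₂ := stripCone (R₁ + 1) (5 / 16) (δ / 4) with hD₂
    have hD₂D : D₂ ⊆ D :=
      stripCone_subset (by linarith) (by linarith) (by norm_num) (by linarith)
    have hTD₂ : MapsTo T D₂ D₂ := hTm le_rfl (by positivity) hD₂D
    obtain ⟨x₀, hx₀⟩ := exists_ofReal_mem_stripCone (R₁ + 1) (θ := 5 / 16) (δ := δ / 4)
      (by norm_num) (by positivity) s
    have hz₀ := hx₀ (x₀ + 1) (by linarith)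
    set z₀ : ℂ × ℂ := (((x₀ + 1 : ℝ) : ℂ), s) with hz₀def
    have htend := tendsto_re_iterate hκ hTD hre hpos (hD₂D hz₀)
    have hbig : Tendsto (fun n => Real.exp (T^[n] z₀).1.re / 8 * (1 / 16) / 2) atTop atTop := by
      have := (((Real.tendsto_exp_atTop.comp htend).atTop_div_const (by norm_num : (0 : ℝ) < 8)
        ).atTop_mul_const (by norm_num : (0 : ℝ) < 1 / 16)).atTop_div_const two_pos
      exact this
    obtain ⟨n, hn⟩ := (hbig.eventually_gt_atTop ‖ζ - φ z₀‖).exists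
    obtain ⟨hφn, hsn⟩ := hφTn n z₀ (hD₂D hz₀)
    set w₀ := T^[n] z₀ with hw₀
    have hw₀D : w₀ ∈ D₂ := hTD₂.iterate n hz₀
    have hsn' : w₀.2 = s := hsn
    have hclosed : closedBall w₀.1 (1 / 16) ⊆ {w : ℂ | (w, s) ∈ D} := by
      intro w hw
      rw [mem_closedBall, dist_eq_norm] at hw
      have := mem_stripCone_of_norm_sub_lt (R := R₁) (θ := 3 / 8) (δ := δ / 2) (by linarith)
        (by norm_num) (by positivity) (by ring) (by linarith) hw₀D hw
      rw [hsn'] at this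
      exact this
    set t := w₀.1.re with ht
    have hconv : Convex ℝ ({w : ℂ | (w, s) ∈ D} ∩ {w : ℂ | t - 1 / 16 ≤ w.re}) :=
      (hfib s).inter (convex_halfSpace_re_ge _)
    have hm : ∀ w ∈ ({w : ℂ | (w, s) ∈ D} ∩ {w : ℂ | t - 1 / 16 ≤ w.re}),
        Real.exp t / 8 ≤ (Y (w, s)).re := by
      rintro w ⟨hw, hwt⟩
      refine le_trans ?_ (hYre (w, s) hw)
      have h1 : Real.exp (t - 1 / 16) ≤ Real.exp w.re := Real.exp_le_exp.2 hwt
      have h2 : Real.exp t = Real.exp (t - 1 / 16) * Real.exp (1 / 16) := by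
        rw [← Real.exp_add]; congr 1; ring
      have h3 : Real.exp (1 / 16) ≤ 2 := by
        have := Real.exp_bound_div_one_sub_of_interval (x := 1 / 16) (by norm_num) (by norm_num)
        linarith
      have h4 := Real.exp_pos (t - 1 / 16)
      simp only
      nlinarith
    have himg := ball_subset_image_closedBall_of_le_re_deriv (f := fun w => φ (w, s)) hconv
      (fun w hw => hφder (w, s) hw.1) (by positivity) hm (by norm_num : (0 : ℝ) < 1 / 16)
      (z₀ := w₀.1) (fun w hw => ⟨hclosed hw, by
        rw [mem_closedBall, dist_eq_norm] at hw
        have := (abs_le.1 ((Complex.abs_re_le_norm (w - w₀.1)).trans hw)).1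
        rw [Complex.sub_re] at this
        change t - 1 / 16 ≤ w.re
        linarith⟩)
    have hζ : ζ + n ∈ ball (φ (w₀.1, s)) (Real.exp t / 8 * (1 / 16) / 2) := by
      have h1 : (w₀.1, s) = w₀ := by rw [← hsn']
      rw [h1, mem_ball, dist_eq_norm, hφn, add_sub_add_right_eq_sub]
      exact hn
    obtain ⟨w, hw, hwζ⟩ := himg hζ
    exact ⟨n, (w, s), hclosed hw, rfl, hwζ⟩

end FatouCoordinate

/-! ### Basins from model maps -/

/-- The end `Re L → +∞` of the model domain. -/
def modelEnd (R θ δ : ℝ) : Filter (ℂ × ℂ) :=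
  comap (fun z => z.1.re) atTop ⊓ 𝓟 (stripCone R θ δ)

/-- An automorphism `F` that is conjugate by `Θ` to a map `T` of a domain `D`, where `T` is in turn
conjugate by `Φ` to the translation by `(1, 0)` and the translates of `Φ(D)` cover `ℂ²`: the
preimages of `Θ(D)` under the iterates of `F` fill a copy of `ℂ²`. -/
theorem isBiholomorphicToC2_iUnion_preimage {F : ℂ × ℂ → ℂ × ℂ} (hF : IsAutomorphismC2 F)
    {D : Set (ℂ × ℂ)} {T Θ : ℂ × ℂ → ℂ × ℂ} {φ : ℂ × ℂ → ℂ}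
    (hT : MapsTo T D D) (hT2 : ∀ z ∈ D, (T z).2 = z.2) (hΘ : UnivalentOn Θ D)
    (hconj : ∀ z ∈ D, F (Θ z) = Θ (T z))
    (hΦ : UnivalentOn (fun z => (φ z, z.2)) D) (hφ : ∀ z ∈ D, φ (T z) = φ z + 1)
    (hcover : ∀ ζ s : ℂ, ∃ n : ℕ, ∃ z ∈ D, z.2 = s ∧ φ z = ζ + n) :
    IsBiholomorphicToC2 (⋃ i : ℕ, F^[i] ⁻¹' (Θ '' D)) := by
  obtain ⟨hFd, G, hGd, hGF, hFG⟩ := hF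
  have hFn : ∀ n, Differentiable ℂ F^[n] := fun n => hFd.iterate n
  have hGn : ∀ n, Differentiable ℂ G^[n] := fun n => hGd.iterate n
  have hGFn : ∀ n, Function.LeftInverse G^[n] F^[n] := fun n => hGF.iterate n
  have hFGn : ∀ n, Function.LeftInverse F^[n] G^[n] := fun n => hFG.iterate n
  have hconjn : ∀ n, ∀ z ∈ D, F^[n] (Θ z) = Θ (T^[n] z) := by
    intro n z hz
    induction n with
    | zero => rfl
    | succ n ih =>
      rw [Function.iterate_succ_apply', Function.iterate_succ_apply', ih,
        hconj _ (hT.iterate n hz)]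
  have hφn : ∀ n : ℕ, ∀ z ∈ D, φ (T^[n] z) = φ z + n ∧ (T^[n] z).2 = z.2 := by
    intro n z hz
    induction n with
    | zero => simp
    | succ n ih =>
      rw [Function.iterate_succ_apply', hφ _ (hT.iterate n hz), hT2 _ (hT.iterate n hz), ih.1]
      exact ⟨by push_cast; ring, ih.2⟩
  -- the two unions are glued from copies of `D`, by the charts `χ n` and `Φ n`
  set χ : ℕ → ℂ × ℂ → ℂ × ℂ := fun n => G^[n] ∘ Θ with hχ
  set Φ : ℕ → ℂ × ℂ → ℂ × ℂ := fun n z => (φ z - n, z.2) with hΦdef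
  have hχu : ∀ n, UnivalentOn (χ n) D := fun n =>
    (UnivalentOn.of_leftInverse isOpen_univ (hGn n) (hFn n) (hFGn n)).comp hΘ (mapsTo_univ _ _)
  have hΦu : ∀ n, UnivalentOn (Φ n) D := fun n => by
    have h1 : UnivalentOn (fun z : ℂ × ℂ => (z.1 - (n : ℂ), z.2)) univ :=
      UnivalentOn.of_leftInverse (g := fun z : ℂ × ℂ => (z.1 + (n : ℂ), z.2)) isOpen_univ
        (by fun_prop) (by fun_prop) fun z => by simp
    exact h1.comp hΦ (mapsTo_univ _ _)
  -- both families of charts make the identification `(n, z) ∼ (n + k, T ^ k z)`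
  have key : ∀ n k : ℕ, ∀ z ∈ D, ∀ w ∈ D,
      (χ n z = χ (n + k) w ↔ T^[k] z = w) ∧ (Φ n z = Φ (n + k) w ↔ T^[k] z = w) := by
    intro n k z hz w hw
    have hTz : T^[k] z ∈ D := hT.iterate k hz
    constructor
    · have h1 : χ n z = χ (n + k) w ↔ F^[n + k] (χ n z) = F^[n + k] (χ (n + k) w) :=
        ((hGFn (n + k)).injective.eq_iff).symm
      have h2 : F^[n + k] (χ (n + k) w) = Θ w := hFGn (n + k) (Θ w)
      have h3 : F^[n + k] (χ n z) = Θ (T^[k] z) := by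
        rw [add_comm n k, Function.iterate_add_apply]
        have : F^[n] (χ n z) = Θ z := hFGn n (Θ z)
        rw [this, hconjn k z hz]
      rw [h1, h2, h3]
      exact hΘ.injOn.eq_iff hTz hw
    · rw [← hΦ.injOn.eq_iff hTz hw]
      obtain ⟨h1, h2⟩ := hφn k z hz
      simp only [hΦdef, Prod.mk.injEq, h1, h2]
      refine and_congr_left fun _ => ?_
      push_cast
      constructor <;> intro h <;> linear_combination h
  have heq : ∀ n m, ∀ z ∈ D, ∀ w ∈ D, χ n z = χ m w ↔ Φ n z = Φ m w := by
    intro n m z hz w hw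
    rcases le_total n m with h | h
    · obtain ⟨k, rfl⟩ := Nat.exists_eq_add_of_le h
      rw [(key n k z hz w hw).1, (key n k z hz w hw).2]
    · obtain ⟨k, rfl⟩ := Nat.exists_eq_add_of_le h
      rw [eq_comm, (key m k w hw z hz).1, eq_comm (a := Φ (m + k) z), (key m k w hw z hz).2]
  obtain ⟨P, hPd, hP⟩ := exists_glued_map hχu (fun n => (hΦu n).differentiableOn)
    fun n m z hz w hw h => (heq n m z hz w hw).1 h
  obtain ⟨Q, hQd, hQ⟩ := exists_glued_map hΦu (fun n => (hχu n).differentiableOn)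
    fun n m z hz w hw h => (heq n m z hz w hw).2 h
  have hΩ : (⋃ i : ℕ, F^[i] ⁻¹' (Θ '' D)) = ⋃ n, χ n '' D := by
    refine iUnion_congr fun n => ?_
    ext p
    constructor
    · rintro ⟨z, hz, hzp⟩
      exact ⟨z, hz, by rw [hχ]; simp only [Function.comp_apply]; rw [hzp]; exact hGFn n p⟩
    · rintro ⟨z, hz, rfl⟩
      exact ⟨z, hz, (hFGn n (Θ z)).symm⟩
  have huniv : ∀ y : ℂ × ℂ, ∃ n, ∃ z ∈ D, Φ n z = y := by
    rintro ⟨ζ, s⟩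
    obtain ⟨n, z, hz, h1, h2⟩ := hcover ζ s
    exact ⟨n, z, hz, by simp [hΦdef, h1, h2]⟩
  have huniv' : (⋃ n, Φ n '' D) = univ := by
    refine eq_univ_of_forall fun y => mem_iUnion.2 ?_
    obtain ⟨n, z, hz, h⟩ := huniv y
    exact ⟨n, z, hz, h⟩
  rw [huniv', differentiableOn_univ] at hQd
  rw [hΩ]
  refine ⟨isOpen_iUnion fun n => (hχu n).isOpen_image, P, Q, hPd, hQd, fun y => ?_, ?_, fun y => ?_⟩
  · obtain ⟨n, z, hz, rfl⟩ := huniv y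
    rw [hQ n z hz]
    exact mem_iUnion.2 ⟨n, z, hz, rfl⟩
  · intro x hx
    obtain ⟨n, z, hz, rfl⟩ := mem_iUnion.1 hx
    rw [hP n z hz, hQ n z hz]
  · obtain ⟨n, z, hz, rfl⟩ := huniv y
    rw [hQ n z hz, hP n z hz]

/-- A map that is conjugate, by a univalent map `Θ` of a model domain, to a drift with a fast
decaying transversal part has a basin as soon as `Θ` tends to the origin along `[v]` at the end of
the model domain. -/
theorem exists_basin_of_model {F : ℂ × ℂ → ℂ × ℂ} {v : ℂ × ℂ} {U : Set (ℂ × ℂ)}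
    {κ q R δ : ℝ} {a b : ℂ × ℂ → ℂ} {Θ : ℂ × ℂ → ℂ × ℂ} {c : ℂ × ℂ → ℂ}
    (hκ : 1 ≤ κ) (hκ2 : κ < 2) (hq : κ < q) (hq2 : q ≤ κ + 2) (hδ : 0 < δ)
    (ha : IsDrift κ R (1 / 2) δ a) (hb : DifferentiableOn ℂ b (stripCone R (1 / 2) δ))
    (hbq : ∀ z ∈ stripCone R (1 / 2) δ, ‖b z‖ ≤ Real.exp (-q * z.1.re))
    (hΘ : UnivalentOn Θ (stripCone R (1 / 2) δ)) (hΘU : MapsTo Θ (stripCone R (1 / 2) δ) U)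
    (hconj : ∀ z ∈ stripCone R (1 / 2) δ, F (Θ z) = Θ (z.1 + a z, z.2 + b z))
    (hzero : Tendsto Θ (modelEnd R (1 / 2) δ) (𝓝 0))
    (hdir : Tendsto (fun z => c z • Θ z) (modelEnd R (1 / 2) δ) (𝓝 v)) :
    ∃ V : Set (ℂ × ℂ), V ⊆ U ∧ IsBasinAlong F v V ∧
      (IsAutomorphismC2 F → IsBiholomorphicToC2 (⋃ i : ℕ, F^[i] ⁻¹' V)) := by
  obtain ⟨R₁, δ₁, hδ₁, B, f, hf, hB, hBz⟩ := exists_straightening hκ hq hq2 hδ ha hb hbq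
  obtain ⟨R₂, δ₂, hR₂, hδ₂, hsub, hTD, φ, hΦ, hφT, hcover⟩ :=
    exists_fatouCoordinate hκ hκ2 hδ₁ hf
  set D := stripCone R₂ (3 / 8) δ₂ with hD
  set T : ℂ × ℂ → ℂ × ℂ := fun z => (z.1 + f z, z.2) with hT
  have hTm : MapsTo T D D := hTD
  have hBm : MapsTo B D (stripCone R (1 / 2) δ) := fun z hz => (hBz z (hsub hz)).2.1
  have hΘB : UnivalentOn (Θ ∘ B) D := hΘ.comp (hB.mono hsub (isOpen_stripCone _ _ _)) hBm
  have hconj' : ∀ z ∈ D, F ((Θ ∘ B) z) = (Θ ∘ B) (T z) := by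
    intro z hz
    simp only [Function.comp_apply]
    rw [hconj _ (hBm hz), (hBz z (hsub hz)).2.2]
  have hconjn : ∀ n, ∀ z ∈ D, F^[n] (Θ (B z)) = Θ (B (T^[n] z)) := by
    intro n z hz
    induction n with
    | zero => rfl
    | succ n ih =>
      rw [Function.iterate_succ_apply', Function.iterate_succ_apply', ih]
      exact hconj' _ (hTm.iterate n hz)
  have hend : ∀ z ∈ D, Tendsto (fun n => B (T^[n] z)) atTop (modelEnd R (1 / 2) δ) := by
    intro z hz
    refine tendsto_inf.2 ⟨tendsto_comap_iff.2 ?_, tendsto_principal.2 ?_⟩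
    · have := tendsto_re_iterate hκ hTm (fun w hw => hf.re_add_le (hsub hw))
        (fun w hw => hR₂.trans hw.1.le) hz
      refine this.congr fun n => ?_
      simp only [Function.comp_apply]
      rw [(hBz _ (hsub (hTm.iterate n hz))).1]
    · exact Eventually.of_forall fun n => hBm (hTm.iterate n hz)
  refine ⟨(Θ ∘ B) '' D, ?_, ⟨hΘB.isOpen_image, ?_, ?_, ?_, ?_⟩, fun hF => ?_⟩
  · rintro _ ⟨z, hz, rfl⟩
    exact hΘU (hBm hz)
  · exact (isConnected_stripCone R₂ (by norm_num) hδ₂).image _ hΘB.differentiableOn.continuousOn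
  · rintro _ ⟨z, hz, rfl⟩
    exact ⟨T z, hTm hz, (hconj' z hz).symm⟩
  · rintro _ ⟨z, hz, rfl⟩
    exact (hzero.comp (hend z hz)).congr fun n => (hconjn n z hz).symm
  · rintro _ ⟨z, hz, rfl⟩
    refine ⟨fun n => c (B (T^[n] z)), (hdir.comp (hend z hz)).congr fun n => ?_⟩
    simp only [Function.comp_apply]
    rw [hconjn n z hz]
  · exact isBiholomorphicToC2_iUnion_preimage hF hTm (fun z _ => rfl) hΘB hconj' hΦ hφT hcover

/-! ### The expansion in the blow-up chart -/

/-- The expansion of `F` in the chart `(x, u) ↦ (x, x u)` of the blow-up, along the irregular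
direction `u = 0`. With `K = k - 1` and `n = m + 1 + l` one has `p_k(1, u) = u ^ m * ph u` and
`r(u) = u ^ n * rh u`; irregularity is the condition `1 ≤ l`. -/
structure IrregularExpansion (F : ℂ × ℂ → ℂ × ℂ) (K m l : ℕ) (ph rh : ℂ → ℂ) : Prop where
  one_le_K : 1 ≤ K
  one_le_l : 1 ≤ l
  analyticAt_ph : AnalyticAt ℂ ph 0
  analyticAt_rh : AnalyticAt ℂ rh 0
  ph_ne : ph 0 ≠ 0
  rh_ne : rh 0 ≠ 0
  differentiableAt : ∀ᶠ z in 𝓝 (0 : ℂ × ℂ), DifferentiableAt ℂ F z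
  fst : (fun z : ℂ × ℂ => (F (z.1, z.1 * z.2)).1 -
    (z.1 + z.1 ^ (K + 1) * (z.2 ^ m * ph z.2))) =O[𝓝 0] fun z => z.1 ^ (K + 2)
  snd : (fun z : ℂ × ℂ => (F (z.1, z.1 * z.2)).2 -
    (z.1 * z.2 + z.1 ^ (K + 1) * (z.2 ^ (m + 1 + l) * rh z.2 + z.2 * (z.2 ^ m * ph z.2))))
      =O[𝓝 0] fun z => z.1 ^ (K + 2)

theorem homogPart_smul (F : ℂ × ℂ → ℂ × ℂ) (j : ℕ) (c : ℂ) (x : ℂ × ℂ) :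
    homogPart F j (c • x) = c ^ j • homogPart F j x := by
  have := (iteratedFDeriv ℂ j F 0).map_smul_univ (fun _ => c) (fun _ => x)
  simp only [homogPart]
  rw [this, Finset.prod_const, Finset.card_univ, Fintype.card_fin, smul_comm]

/-- The expansion `F = id + P_k + O(k + 1)`, as the terms of degree between `2` and `k - 1`
vanish. -/
theorem TangentToIdentity.sub_homogPart_isBigO {F : ℂ × ℂ → ℂ × ℂ} (hF : TangentToIdentity F)
    {k : ℕ} (hk : IsOrder F k) :
    (fun z => F z - z - homogPart F k z) =O[𝓝 0] fun z => ‖z‖ ^ (k + 1) := by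
  obtain ⟨p, r, hp⟩ := hF.analyticAt
  have hj : ∀ j x, p j (fun _ => x) = homogPart F j x := by
    intro j x
    have := hp.factorial_smul x j
    rw [homogPart, ← this, ← Nat.cast_smul_eq_nsmul ℂ, smul_smul, inv_mul_cancel₀, one_smul]
    exact_mod_cast j.factorial_ne_zero
  have h0 : ∀ x, homogPart F 0 x = 0 := by
    intro x
    simp [homogPart, hF.map_zero]
  have h1 : ∀ x, homogPart F 1 x = x := by
    intro x
    simp [homogPart, hF.fderiv_eq]
  have h2 : ∀ j, 2 ≤ j → j < k → ∀ x, homogPart F j x = 0 := by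
    intro j h2 hjk x
    by_contra hne
    exact absurd (hk.2 ⟨h2, fun h => hne (by rw [h]; rfl)⟩) (not_le.2 hjk)
  have hsum : ∀ x, p.partialSum (k + 1) x = x + homogPart F k x := by
    intro x
    simp only [FormalMultilinearSeries.partialSum, hj]
    have hk2 : 2 ≤ k := hk.1.1
    rw [Finset.sum_eq_add (a := 1) (b := k) (by omega), h1]
    · intro j hj1 hj2
      rcases Nat.lt_or_ge j 2 with h | h
      · have : j = 0 := by omega
        rw [this, h0]
      · exact h2 j h (by have := Finset.mem_range.1 hj1; omega) x
    · intro h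
      exact absurd (Finset.mem_range.2 (by omega)) h
    · intro h
      exact absurd (Finset.mem_range.2 (by omega)) h
  have := hp.hasFPowerSeriesAt.isBigO_sub_partialSum_pow (k + 1)
  refine this.congr_left fun z => ?_
  rw [hsum, zero_add]
  abel

theorem differentiable_homogPart_one (F : ℂ × ℂ → ℂ × ℂ) (k : ℕ) :
    Differentiable ℂ fun u : ℂ => homogPart F k (1, u) := by
  have h1 : Differentiable ℂ fun y : Fin k → ℂ × ℂ => iteratedFDeriv ℂ k F 0 y :=
    ((iteratedFDeriv ℂ k F 0).contDiff (n := 1)).differentiable one_ne_zero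
  have h2 : Differentiable ℂ fun u : ℂ => iteratedFDeriv ℂ k F 0 (fun _ => (1, u)) :=
    h1.comp (differentiable_pi.2 fun _ => (differentiable_const _).prodMk differentiable_id)
  exact h2.const_smul ((k.factorial : ℂ)⁻¹)

/-- The expansion of `F` at the origin, pulled back by `(x, u) ↦ x (1, u)`; the degree of homogeneity
of `P_k` provides the power of `x`. -/
theorem TangentToIdentity.exists_irregularExpansion {F : ℂ × ℂ → ℂ × ℂ}
    (hF : TangentToIdentity F) (hirr : IsIrregularAtOneZero F) :
    ∃ (K m l : ℕ) (ph rh : ℂ → ℂ), IrregularExpansion F K m l ph rh := by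
  obtain ⟨k, hk, hlt, htop⟩ := hirr
  have hP := differentiable_homogPart_one F k
  have hpd : Differentiable ℂ (pPoly F k) := hP.fst
  have hrd : Differentiable ℂ (rPoly F k) := hP.snd.sub (differentiable_id.mul hP.fst)
  have hn : analyticOrderAt (rPoly F k) 0 ≠ ⊤ := htop.ne
  have hm : analyticOrderAt (pPoly F k) 0 ≠ ⊤ := by
    intro h
    rw [h, top_add] at hlt
    exact not_top_lt hlt
  obtain ⟨m, hm'⟩ := ENat.ne_top_iff_exists.1 hm
  obtain ⟨n, hn'⟩ := ENat.ne_top_iff_exists.1 hn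
  rw [← hm', ← hn'] at hlt
  have hmn : m + 1 < n := by exact_mod_cast hlt
  obtain ⟨ph, hph, hph0, hpheq⟩ := ((hpd.analyticAt 0).analyticOrderAt_eq_natCast).1 hm'.symm
  obtain ⟨rh, hrh, hrh0, hrheq⟩ := ((hrd.analyticAt 0).analyticOrderAt_eq_natCast).1 hn'.symm
  have hk2 : 2 ≤ k := hk.1.1
  obtain ⟨K, rfl⟩ : ∃ K, k = K + 1 := ⟨k - 1, by omega⟩
  obtain ⟨l, rfl⟩ : ∃ l, n = m + 1 + l := Nat.exists_eq_add_of_le hmn.le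
  have htend : Tendsto (fun z : ℂ × ℂ => z.1 • ((1, z.2) : ℂ × ℂ)) (𝓝 0) (𝓝 0) := by
    have : Continuous fun z : ℂ × ℂ => z.1 • ((1, z.2) : ℂ × ℂ) := by fun_prop
    simpa using this.tendsto 0
  have hE := (hF.sub_homogPart_isBigO hk).comp_tendsto htend
  have hE2 : ((fun z => F z - z - homogPart F (K + 1) z) ∘ fun z : ℂ × ℂ =>
      z.1 • ((1, z.2) : ℂ × ℂ)) =O[𝓝 0] fun z => z.1 ^ (K + 2) := by
    refine hE.trans (Asymptotics.IsBigO.of_bound 1 ?_)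
    have h2 : ∀ᶠ z : ℂ × ℂ in 𝓝 0, ‖z.2‖ < 1 :=
      continuous_snd.norm.continuousAt.eventually_lt_const (by simp)
    filter_upwards [h2] with z hz
    simp only [Function.comp_apply, norm_pow, norm_smul, one_mul]
    have : ‖((1, z.2) : ℂ × ℂ)‖ = 1 := by
      simp [Prod.norm_def, hz.le]
    rw [this, mul_one, norm_norm]
  have hu : ∀ {P : ℂ → Prop}, (∀ᶠ u in 𝓝 0, P u) → ∀ᶠ z : ℂ × ℂ in 𝓝 0, P z.2 := fun h =>
    continuous_snd.continuousAt.eventually h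
  refine ⟨K, m, l, ph, rh, by omega, by omega, hph, hrh, hph0, hrh0, ?_, ?_, ?_⟩
  · exact hF.analyticAt.eventually_analyticAt.mono fun z hz => hz.differentiableAt
  · have h1 : (fun z : ℂ × ℂ => (((fun z => F z - z - homogPart F (K + 1) z) ∘ fun z : ℂ × ℂ =>
        z.1 • ((1, z.2) : ℂ × ℂ)) z).1) =O[𝓝 0] fun z => z.1 ^ (K + 2) :=
      Asymptotics.isBigO_fst_prod.trans hE2
    refine h1.congr' ?_ EventuallyEq.rfl
    filter_upwards [hu hpheq] with z hz
    simp only [sub_zero, smul_eq_mul, pPoly] at hz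
    simp only [Function.comp_apply, homogPart_smul, Prod.fst_sub, Prod.smul_fst, smul_eq_mul, hz]
    simp only [Prod.smul_mk, smul_eq_mul, mul_one]
    ring
  · have h1 : (fun z : ℂ × ℂ => (((fun z => F z - z - homogPart F (K + 1) z) ∘ fun z : ℂ × ℂ =>
        z.1 • ((1, z.2) : ℂ × ℂ)) z).2) =O[𝓝 0] fun z => z.1 ^ (K + 2) :=
      Asymptotics.isBigO_snd_prod.trans hE2
    refine h1.congr' ?_ EventuallyEq.rfl
    filter_upwards [hu hpheq, hu hrheq] with z hz hz2
    simp only [sub_zero, smul_eq_mul, pPoly] at hz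
    simp only [sub_zero, smul_eq_mul, rPoly] at hz2
    have hz3 : (homogPart F (K + 1) (1, z.2)).2 =
        z.2 ^ (m + 1 + l) * rh z.2 + z.2 * (z.2 ^ m * ph z.2) := by
      rw [← hz2, ← hz]; ring
    simp only [Function.comp_apply, homogPart_smul, Prod.snd_sub, Prod.smul_snd, smul_eq_mul, hz3]
    simp only [Prod.smul_mk, smul_eq_mul, mul_one]
    ring

/-! ### A branch of the root and a primitive close to the identity -/

/-- The branch `μ Z ^ (-1 / l)` on the slit plane. -/
noncomputable def rootBranch (μ : ℂ) (l : ℕ) (Z : ℂ) : ℂ := μ * Complex.exp (-Complex.log Z / l)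

theorem rootBranch_pow_mul {μ : ℂ} {l : ℕ} (hl : 1 ≤ l) {Z : ℂ} (hZ : Z ≠ 0) :
    rootBranch μ l Z ^ l * Z = μ ^ l := by
  have hl0 : (l : ℂ) ≠ 0 := by exact_mod_cast (by omega : l ≠ 0)
  rw [rootBranch, mul_pow, ← Complex.exp_nat_mul, mul_div_cancel₀ _ hl0, Complex.exp_neg,
    Complex.exp_log hZ, mul_assoc, inv_mul_cancel₀ hZ, mul_one]

theorem rootBranch_ne_zero {μ : ℂ} (hμ : μ ≠ 0) (l : ℕ) (Z : ℂ) : rootBranch μ l Z ≠ 0 :=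
  mul_ne_zero hμ (Complex.exp_ne_zero _)

theorem rootBranch_injOn {μ : ℂ} (hμ : μ ≠ 0) {l : ℕ} (hl : 1 ≤ l) {Z Z' : ℂ} (hZ : Z ≠ 0)
    (hZ' : Z' ≠ 0) (h : rootBranch μ l Z = rootBranch μ l Z') : Z = Z' := by
  have h1 := rootBranch_pow_mul (μ := μ) hl hZ
  have h2 := rootBranch_pow_mul (μ := μ) hl hZ'
  rw [← h, ← h1] at h2
  exact (mul_left_cancel₀ (pow_ne_zero l (rootBranch_ne_zero hμ l Z)) h2).symm

theorem hasDerivAt_rootBranch {μ : ℂ} {l : ℕ} {Z : ℂ} (hZ : Z ∈ Complex.slitPlane) :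
    HasDerivAt (rootBranch μ l) (rootBranch μ l Z * (-Z⁻¹ / l)) Z := by
  have h := (((Complex.hasDerivAt_log hZ).neg.div_const (l : ℂ)).cexp).const_mul μ
  rw [rootBranch, mul_assoc]
  exact h

theorem norm_rootBranch {μ : ℂ} {l : ℕ} {Z : ℂ} (hZ : Z ≠ 0) :
    ‖rootBranch μ l Z‖ = ‖μ‖ * ‖Z‖ ^ (-(1 / l : ℝ)) := by
  rw [rootBranch, norm_mul, Complex.norm_exp, Real.rpow_def_of_pos (norm_pos_iff.2 hZ)]
  congr 2
  rw [show -Complex.log Z / l = ((1 / l : ℝ) : ℂ) * (-Complex.log Z) by push_cast; ring,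
    Complex.re_ofReal_mul, Complex.neg_re, Complex.log_re]
  ring

/-- The branch on a point near `Z`, in terms of the logarithm of the ratio. -/
theorem rootBranch_mul_exp {μ : ℂ} {l : ℕ} (hl : 1 ≤ l) {Z w : ℂ} (hZ : 0 < Z.re)
    (hw : l * ‖w‖ ≤ 1) :
    rootBranch μ l (Z * Complex.exp (-(l * w))) = rootBranch μ l Z * Complex.exp w := by
  have hZ0 : Z ≠ 0 := fun h => by simp [h] at hZ
  have hl0 : (l : ℂ) ≠ 0 := by exact_mod_cast (by omega : l ≠ 0)
  have h1 : Z * Complex.exp (-(l * w)) = Complex.exp (Complex.log Z - l * w) := by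
    rw [sub_eq_add_neg, Complex.exp_add, Complex.exp_log hZ0]
  have h2 : |(l * w).im| ≤ 1 := by
    refine (Complex.abs_im_le_norm _).trans ?_
    simpa using hw
  have h3 : |(Complex.log Z).im| < Real.pi / 2 := by
    rw [Complex.log_im]
    exact Complex.abs_arg_lt_pi_div_two_iff.2 (Or.inl hZ)
  rw [abs_le] at h2
  rw [abs_lt] at h3
  have hpi := Real.pi_gt_three
  have h4 : Complex.log (Z * Complex.exp (-(l * w))) = Complex.log Z - l * w := by
    rw [h1]
    apply Complex.log_exp
    · rw [Complex.sub_im]; linarith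
    · rw [Complex.sub_im]; linarith
  rw [rootBranch, h4, rootBranch, mul_assoc, ← Complex.exp_add]
  congr 2
  field_simp
  ring

/-- The primitive of a function that is close to `1` on a half plane is univalent, and it is so
close to the identity that it takes all values in a narrow sector around the positive axis. -/
theorem exists_primitive_near_id {H : ℂ → ℂ} {R₀ ε δ : ℝ} (hδ : 0 < δ) (hδ4 : δ ≤ 1 / 4)
    (hε : ε ≤ δ / 16) (hH : DifferentiableOn ℂ H {Z | R₀ < Z.re})
    (hH1 : ∀ Z : ℂ, R₀ < Z.re → ‖H Z - 1‖ ≤ ε) :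
    ∃ W : ℂ → ℂ, (∀ Z : ℂ, R₀ < Z.re → HasDerivAt W (H Z) Z) ∧ UnivalentOn W {Z | R₀ < Z.re} ∧
      ∃ R₂ : ℝ, ∀ t : ℝ, R₂ < t → ∀ w : ℂ, ‖w - t‖ ≤ δ * t →
        ∃ Z : ℂ, R₀ < Z.re ∧ W Z = w ∧ ‖Z - t‖ ≤ 2 * δ * t := by
  have hPo : IsOpen {Z : ℂ | R₀ < Z.re} := isOpen_lt continuous_const Complex.continuous_re
  have hPc : Convex ℝ {Z : ℂ | R₀ < Z.re} := convex_halfSpace_re_gt _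
  set x₀ : ℂ := ((R₀ + 1 : ℝ) : ℂ) with hx₀
  have hx₀m : x₀ ∈ {Z : ℂ | R₀ < Z.re} := by
    simp [hx₀]
  set S : Set (ℂ × ℂ) := {z | R₀ < z.1.re} with hS
  have hSo : IsOpen S := hPo.preimage continuous_fst
  have hY : DifferentiableOn ℂ (fun z : ℂ × ℂ => H z.1) S :=
    DifferentiableOn.comp (g := H) (f := Prod.fst) hH differentiable_fst.differentiableOn
      fun z hz => hz
  have hstar : ∀ z ∈ S, ∀ t ∈ Icc (0 : ℝ) 1, (x₀ + t * (z.1 - x₀), z.2) ∈ S := by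
    intro z hz t ht
    have := hPc.add_smul_sub_mem hx₀m hz ht
    rw [Complex.real_smul] at this
    exact this
  set W : ℂ → ℂ := fun w => segmentPrimitive (fun z : ℂ × ℂ => H z.1) x₀ (w, 0) with hW
  have hWd : ∀ Z : ℂ, R₀ < Z.re → HasDerivAt W (H Z) Z := fun Z hZ =>
    hasDerivAt_segmentPrimitive (z := (Z, 0)) hSo hY hstar hZ
  have hW0 : W x₀ = 0 := by simp [hW, segmentPrimitive]
  have hε0 : 0 ≤ ε := (norm_nonneg _).trans (hH1 x₀ hx₀m)
  have hHre : ∀ Z : ℂ, R₀ < Z.re → 1 / 2 ≤ (H Z).re := by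
    intro Z hZ
    have h1 := (abs_le.1 ((Complex.abs_re_le_norm _).trans (hH1 Z hZ))).1
    rw [Complex.sub_re, Complex.one_re] at h1
    linarith
  have hdist : ∀ Z : ℂ, R₀ < Z.re → ‖W Z - Z‖ ≤ 2 * ‖x₀‖ + ε * ‖Z‖ := by
    intro Z hZ
    have h1 := hPc.norm_image_sub_le_of_norm_hasDerivWithin_le (f := fun Z => W Z - Z)
      (f' := fun Z => H Z - 1) (C := ε)
      (fun w hw => ((hWd w hw).sub (hasDerivAt_id w)).hasDerivWithinAt) hH1 hx₀m hZ
    rw [hW0] at h1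
    have h2 : ‖W Z - Z‖ ≤ ‖W Z - Z - (0 - x₀)‖ + ‖x₀‖ := by
      calc ‖W Z - Z‖ = ‖(W Z - Z - (0 - x₀)) - x₀‖ := by congr 1; ring
        _ ≤ _ := norm_sub_le _ _
    have h3 : ε * ‖Z - x₀‖ ≤ ε * ‖Z‖ + ‖x₀‖ := by
      have h4 : ‖Z - x₀‖ ≤ ‖Z‖ + ‖x₀‖ := norm_sub_le _ _
      have h5 : ε * ‖x₀‖ ≤ 1 * ‖x₀‖ := by gcongr; linarith
      nlinarith
    linarith
  refine ⟨W, hWd, UnivalentOn.of_deriv_ne_zero hPo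
    (fun Z hZ => (hWd Z hZ).differentiableAt.differentiableWithinAt)
    (injOn_of_re_deriv_pos hPc hWd fun Z hZ => lt_of_lt_of_le (by norm_num) (hHre Z hZ))
    (fun Z hZ h => ?_), max (2 * |R₀|) (32 * ‖x₀‖ / δ), ?_⟩
  · rw [(hWd Z hZ).deriv] at h
    have := hHre Z hZ
    rw [h, Complex.zero_re] at this
    linarith
  · intro t ht w hw
    obtain ⟨ht1, ht2⟩ := max_lt_iff.1 ht
    have ht0 : 0 < t := lt_of_le_of_lt (by positivity) ht1
    rw [div_lt_iff₀ hδ] at ht2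
    have hδt : 0 < δ * t := by positivity
    have hmem : closedBall w (δ * t) ⊆ {Z : ℂ | R₀ < Z.re} := by
      intro Z hZ
      rw [mem_closedBall, dist_eq_norm] at hZ
      have h1 := (abs_le.1 ((Complex.abs_re_le_norm (Z - w)).trans hZ)).1
      have h2 := (abs_le.1 ((Complex.abs_re_le_norm (w - t)).trans hw)).1
      rw [Complex.sub_re] at h1 h2
      rw [Complex.ofReal_re] at h2
      have h3 : δ * t ≤ 1 / 4 * t := by gcongr
      have h4 := le_abs_self R₀
      change R₀ < Z.re
      linarith
    have hwm : R₀ < w.re := hmem (mem_closedBall_self hδt.le)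
    have himg := ball_subset_image_closedBall_of_le_re_deriv hPc hWd (by norm_num) hHre hδt hmem
    have hwb : w ∈ ball (W w) (1 / 2 * (δ * t) / 2) := by
      rw [mem_ball, dist_eq_norm, norm_sub_rev]
      have h1 := hdist w hwm
      have h2 : ‖w‖ ≤ 5 / 4 * t := by
        have h3 : ‖w‖ ≤ ‖w - t‖ + ‖(t : ℂ)‖ := by
          calc ‖w‖ = ‖(w - t) + t‖ := by congr 1; ring
            _ ≤ _ := norm_add_le _ _
        rw [Complex.norm_real, Real.norm_of_nonneg ht0.le] at h3
        nlinarith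
      have h3 : ε * ‖w‖ ≤ δ / 16 * (5 / 4 * t) := by gcongr
      nlinarith
    obtain ⟨Z, hZ, hZw⟩ := himg hwb
    refine ⟨Z, hmem hZ, hZw, ?_⟩
    rw [mem_closedBall, dist_eq_norm] at hZ
    calc ‖Z - t‖ = ‖(Z - w) + (w - t)‖ := by congr 1; ring
      _ ≤ _ := norm_add_le _ _
      _ ≤ 2 * δ * t := by linarith

open Asymptotics

/-! ### Asymptotics of one iteration in the blow-up chart -/

theorem log_one_add_sub_self_isBigO :
    (fun z : ℂ => Complex.log (1 + z) - z) =O[𝓝 0] fun z => z ^ 2 := by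
  refine IsBigO.of_bound 1 ?_
  have h : ∀ᶠ z : ℂ in 𝓝 0, ‖z‖ < 1 / 2 :=
    continuous_norm.continuousAt.eventually_lt_const (by simp)
  filter_upwards [h] with z hz
  have h1 := Complex.norm_log_one_add_sub_self_le (z := z) (by linarith)
  rw [norm_pow, one_mul]
  refine h1.trans ?_
  have h2 : (1 - ‖z‖)⁻¹ ≤ 2 := by
    rw [inv_le_comm₀ (by linarith) (by norm_num)]
    linarith
  nlinarith [sq_nonneg ‖z‖]

theorem exp_neg_mul_log_one_add_isBigO (l : ℕ) :
    (fun z : ℂ => Complex.exp (-(l * Complex.log (1 + z))) - 1 + l * z) =O[𝓝 0] fun z => z ^ 2 := by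
  have h1 : (fun z : ℂ => Complex.log (1 + z)) =O[𝓝 0] fun z => z := by
    have h2 : (fun z : ℂ => z ^ 2) =O[𝓝 0] fun z => z :=
      (isLittleO_pow_id one_lt_two).isBigO
    have := (log_one_add_sub_self_isBigO.trans h2).add (isBigO_refl (fun z : ℂ => z) (𝓝 0))
    simpa using this
  have h2 : Tendsto (fun z : ℂ => -(l * Complex.log (1 + z))) (𝓝 0) (𝓝 0) := by
    have : Tendsto (fun z : ℂ => Complex.log (1 + z)) (𝓝 0) (𝓝 0) := h1.trans_tendsto tendsto_id
    simpa using (this.const_mul (l : ℂ)).neg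
  have h3 : (fun z : ℂ => Complex.exp z - 1 - z) =O[𝓝 0] fun z => z ^ 2 := by
    refine IsBigO.of_bound 1 ?_
    have h : ∀ᶠ z : ℂ in 𝓝 0, ‖z‖ < 1 :=
      continuous_norm.continuousAt.eventually_lt_const (by simp)
    filter_upwards [h] with z hz
    rw [norm_pow, one_mul]
    exact Complex.norm_exp_sub_one_sub_id_le hz.le
  have h4 := (h3.comp_tendsto h2).trans
    (((h1.const_mul_left (l : ℂ)).neg_left).pow 2)
  have h5 := log_one_add_sub_self_isBigO.const_mul_left (l : ℂ)
  refine (h4.sub h5).congr_left fun z => ?_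
  simp only [Function.comp_apply]
  ring

section OneStep

variable {F : ℂ × ℂ → ℂ × ℂ} {K m l : ℕ} {ph rh : ℂ → ℂ} {ι : Type*} {E : Filter ι} {x u : ι → ℂ}

/-- The relative increment of `x` under `F`, at the point `(x, x u)`. -/
noncomputable def relIncX (F : ℂ × ℂ → ℂ × ℂ) (x u : ℂ) : ℂ := (F (x, x * u)).1 / x - 1

/-- The relative increment of `u` under `F`, at the point `(x, x u)`. -/
noncomputable def relIncU (F : ℂ × ℂ → ℂ × ℂ) (x u : ℂ) : ℂ :=
  (F (x, x * u)).2 / (F (x, x * u)).1 / u - 1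

namespace IrregularExpansion

theorem relIncX_isBigO (h : IrregularExpansion F K m l ph rh) (hx : Tendsto x E (𝓝 0))
    (hu : Tendsto u E (𝓝 0)) (hx0 : ∀ᶠ i in E, x i ≠ 0) :
    (fun i => relIncX F (x i) (u i) - x i ^ K * (u i ^ m * ph (u i))) =O[E]
      fun i => x i ^ (K + 1) := by
  have hxu : Tendsto (fun i => (x i, u i)) E (𝓝 0) := hx.prodMk_nhds hu
  have h1 := (h.fst.comp_tendsto hxu).mul (isBigO_refl (fun i => (x i)⁻¹) E)
  refine h1.congr' ?_ ?_
  · filter_upwards [hx0] with i hi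
    simp only [Function.comp_apply, relIncX]
    field_simp
    ring
  · filter_upwards [hx0] with i hi
    simp only [Function.comp_apply]
    field_simp
    ring

theorem ph_comp_isBigO (h : IrregularExpansion F K m l ph rh) (hu : Tendsto u E (𝓝 0)) :
    (fun i => ph (u i)) =O[E] fun _ => (1 : ℂ) :=
  (h.analyticAt_ph.continuousAt.tendsto.comp hu).isBigO_one ℂ

theorem rh_comp_isBigO (h : IrregularExpansion F K m l ph rh) (hu : Tendsto u E (𝓝 0)) :
    (fun i => rh (u i)) =O[E] fun _ => (1 : ℂ) :=
  (h.analyticAt_rh.continuousAt.tendsto.comp hu).isBigO_one ℂ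

theorem _root_.Filter.Tendsto.pow_isBigO_one (hu : Tendsto u E (𝓝 0)) (j : ℕ) :
    (fun i => u i ^ j) =O[E] fun _ => (1 : ℂ) :=
  (hu.pow j).isBigO_one ℂ

theorem _root_.Filter.Tendsto.pow_isBigO_pow (hx : Tendsto x E (𝓝 0)) {i j : ℕ} (hij : i ≤ j) :
    (fun k => x k ^ j) =O[E] fun k => x k ^ i := by
  obtain ⟨d, rfl⟩ := Nat.exists_eq_add_of_le hij
  have := (isBigO_refl (fun k => x k ^ i) E).mul (hx.pow_isBigO_one d)
  simpa [pow_add] using this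

theorem relIncX_isBigO_pow (h : IrregularExpansion F K m l ph rh) (hx : Tendsto x E (𝓝 0))
    (hu : Tendsto u E (𝓝 0)) (hx0 : ∀ᶠ i in E, x i ≠ 0) :
    (fun i => relIncX F (x i) (u i)) =O[E] fun i => x i ^ K := by
  have h1 := (h.relIncX_isBigO hx hu hx0).trans (hx.pow_isBigO_pow (Nat.le_succ K))
  have h2 : (fun i => x i ^ K * (u i ^ m * ph (u i))) =O[E] fun i => x i ^ K := by
    have := (isBigO_refl (fun k => x k ^ K) E).mul ((hu.pow_isBigO_one m).mul (h.ph_comp_isBigO hu))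
    simpa using this
  have := h1.add h2
  simpa using this

theorem tendsto_relIncX (h : IrregularExpansion F K m l ph rh) (hx : Tendsto x E (𝓝 0))
    (hu : Tendsto u E (𝓝 0)) (hx0 : ∀ᶠ i in E, x i ≠ 0) :
    Tendsto (fun i => relIncX F (x i) (u i)) E (𝓝 0) := by
  refine (h.relIncX_isBigO_pow hx hu hx0).trans_tendsto ?_
  have := hx.pow K
  rwa [zero_pow (by have := h.one_le_K; omega)] at this

theorem log_relIncX_isBigO (h : IrregularExpansion F K m l ph rh) (hx : Tendsto x E (𝓝 0))
    (hu : Tendsto u E (𝓝 0)) (hx0 : ∀ᶠ i in E, x i ≠ 0) :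
    (fun i => Complex.log (1 + relIncX F (x i) (u i)) - x i ^ K * (u i ^ m * ph (u i))) =O[E]
      fun i => x i ^ (K + 1) := by
  have h1 := log_one_add_sub_self_isBigO.comp_tendsto (h.tendsto_relIncX hx hu hx0)
  have h2 := h1.trans ((h.relIncX_isBigO_pow hx hu hx0).pow 2)
  have h3 : (fun i => (x i ^ K) ^ 2) =O[E] fun i => x i ^ (K + 1) := by
    simp only [← pow_mul]
    exact hx.pow_isBigO_pow (by have := h.one_le_K; omega)
  refine ((h2.trans h3).add (h.relIncX_isBigO hx hu hx0)).congr_left fun i => ?_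
  simp only [Function.comp_apply]
  ring

/-- The relative increment of `u` is that of the leading term up to `O(x ^ (K + 1) / u)`; the second
bound is crude, as it ignores the power `u ^ (m + l)`. -/
theorem relIncU_isBigO (h : IrregularExpansion F K m l ph rh) (hx : Tendsto x E (𝓝 0))
    (hu : Tendsto u E (𝓝 0)) (hx0 : ∀ᶠ i in E, x i ≠ 0) (hu0 : ∀ᶠ i in E, u i ≠ 0) :
    (fun i => relIncU F (x i) (u i) - x i ^ K * (u i ^ (m + l) * rh (u i))) =O[E]
        (fun i => x i ^ (K + 1) * (u i)⁻¹) ∧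
      (fun i => relIncU F (x i) (u i)) =O[E] fun i => x i ^ K * (u i)⁻¹ := by
  have hxu : Tendsto (fun i => (x i, u i)) E (𝓝 0) := hx.prodMk_nhds hu
  have hξ := h.tendsto_relIncX hx hu hx0
  set ξ : ι → ℂ := fun i => relIncX F (x i) (u i) with hξdef
  have hξ1 : ∀ᶠ i in E, ‖ξ i‖ < 1 / 2 := by
    have := hξ.norm
    rw [norm_zero] at this
    exact this.eventually_lt_const (by norm_num)
  have hone : (fun _ : ι => (1 : ℂ)) =O[E] fun i => (u i)⁻¹ := by
    refine IsBigO.of_bound 1 ?_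
    have : ∀ᶠ i in E, ‖u i‖ < 1 := by
      have := hu.norm
      rw [norm_zero] at this
      exact this.eventually_lt_const (by norm_num)
    filter_upwards [this, hu0] with i hi hi0
    rw [norm_one, one_mul, norm_inv]
    exact (one_le_inv₀ (norm_pos_iff.2 hi0)).2 hi.le
  set G : ι → ℂ := fun i => x i ^ K * (u i ^ (m + l) * rh (u i)) with hG
  -- `(1 + ξ) η = G + e`
  have he : (fun i => (1 + ξ i) * relIncU F (x i) (u i) - G i) =O[E]
      fun i => x i ^ (K + 1) * (u i)⁻¹ := by
    have h1 := (h.snd.comp_tendsto hxu).mul (isBigO_refl (fun i => (x i)⁻¹ * (u i)⁻¹) E)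
    have h2 : (fun i => ξ i - x i ^ K * (u i ^ m * ph (u i))) =O[E]
        fun i => x i ^ (K + 1) * (u i)⁻¹ := by
      have := (h.relIncX_isBigO hx hu hx0).mul hone
      simpa using this
    have h3 : (fun i => x i ^ (K + 2) * ((x i)⁻¹ * (u i)⁻¹)) =ᶠ[E]
        fun i => x i ^ (K + 1) * (u i)⁻¹ := by
      filter_upwards [hx0, hu0] with i hi hi0
      field_simp
      ring
    refine ((h1.trans_eventuallyEq h3).sub h2).congr' ?_ EventuallyEq.rfl
    · filter_upwards [hx0, hu0, hξ1] with i hi hi0 hi1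
      have hX : (F (x i, x i * u i)).1 ≠ 0 := by
        intro h0
        have : ξ i = -1 := by simp [hξdef, relIncX, h0]
        rw [this] at hi1
        norm_num at hi1
      simp only [Function.comp_apply, relIncU, hG, hξdef, relIncX]
      field_simp
      ring
  have hxK : (fun i => x i ^ (K + 1) * (u i)⁻¹) =O[E] fun i => x i ^ K * (u i)⁻¹ :=
    (hx.pow_isBigO_pow (Nat.le_succ K)).mul (isBigO_refl _ _)
  have hGO : G =O[E] fun i => x i ^ K * (u i)⁻¹ := by
    have h1 := (isBigO_refl (fun i => x i ^ K) E).mul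
      (((hu.pow_isBigO_one (m + l)).mul (h.rh_comp_isBigO hu)).trans (by simpa using hone))
    exact h1
  have h2 : (fun i => relIncU F (x i) (u i)) =O[E]
      fun i => (1 + ξ i) * relIncU F (x i) (u i) := by
    refine IsBigO.of_bound 2 ?_
    filter_upwards [hξ1] with i hi
    have h3 : 1 / 2 ≤ ‖1 + ξ i‖ := by
      have := norm_sub_le (1 + ξ i) (ξ i)
      rw [add_sub_cancel_right, norm_one] at this
      linarith
    rw [norm_mul]
    nlinarith [norm_nonneg (relIncU F (x i) (u i))]
  have hη : (fun i => relIncU F (x i) (u i)) =O[E] fun i => x i ^ K * (u i)⁻¹ := by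
    refine h2.trans ?_
    have := (he.trans hxK).add hGO
    simpa using this
  refine ⟨?_, hη⟩
  have h4 : (fun i => ξ i * relIncU F (x i) (u i)) =O[E] fun i => x i ^ (K + 1) * (u i)⁻¹ := by
    have h5 := (h.relIncX_isBigO_pow hx hu hx0).mul hη
    have h6 : (fun i => x i ^ K * (x i ^ K * (u i)⁻¹)) =O[E] fun i => x i ^ (K + 1) * (u i)⁻¹ := by
      simp only [← mul_assoc, ← pow_add]
      exact (hx.pow_isBigO_pow (by have := h.one_le_K; omega)).mul (isBigO_refl _ _)
    exact h5.trans h6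
  refine (he.sub h4).congr_left fun i => ?_
  ring

/-- The increment of `W` agrees with the increment `-K log (1 + ξ)` of `L` up to an error of
size `x ^ (K + 1) Z ^ 4`; here `W` has derivative `(ph / a) (b / rh)` as a function of `Z`, with
`a = ph 0` and `b = rh 0`, and `u ^ l Z` has the constant value `c = K a / (l b)`. -/
theorem increment_isBigO (h : IrregularExpansion F K m l ph rh) (hx : Tendsto x E (𝓝 0))
    (hu : Tendsto u E (𝓝 0)) (hx0 : ∀ᶠ i in E, x i ≠ 0) (hu0 : ∀ᶠ i in E, u i ≠ 0)
    {Z : ι → ℂ} (huZ : (fun i => (u i)⁻¹) =O[E] Z) (hZ : (fun _ => (1 : ℂ)) =O[E] Z)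
    (hxZ : Tendsto (fun i => x i * Z i ^ 2) E (𝓝 0))
    (hul : ∀ᶠ i in E, u i ^ l * Z i = K * ph 0 / (l * rh 0))
    {R₀ : ℝ} (hZR : ∀ᶠ i in E, R₀ + 1 < (Z i).re) {W H : ℂ → ℂ}
    (hW : ∀ w : ℂ, R₀ < w.re → HasDerivAt W (H w) w) (hH2 : ∀ w : ℂ, R₀ < w.re → ‖H w‖ ≤ 2)
    (hH : ∀ᶠ i in E, H (Z i) = ph (u i) / ph 0 * (rh 0 / rh (u i)))
    (hrh : ∀ᶠ i in E, rh (u i) ≠ 0) :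
    Tendsto (fun i => relIncU F (x i) (u i)) E (𝓝 0) ∧
    Tendsto (fun i => Z i * Complex.exp (-(l * Complex.log (1 + relIncU F (x i) (u i)))) - Z i) E
      (𝓝 0) ∧
    (fun i => -K * Complex.log (1 + relIncX F (x i) (u i)) -
      (W (Z i * Complex.exp (-(l * Complex.log (1 + relIncU F (x i) (u i))))) - W (Z i))) =O[E]
      fun i => x i ^ (K + 1) * Z i ^ 4 := by
  obtain ⟨hη1, hη2⟩ := h.relIncU_isBigO hx hu hx0 hu0
  set η : ι → ℂ := fun i => relIncU F (x i) (u i) with hη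
  set e : ι → ℂ := fun i => Z i * Complex.exp (-(l * Complex.log (1 + η i))) - Z i with he
  have hK := h.one_le_K
  have hZj : ∀ {i j : ℕ}, i ≤ j → (fun k => Z k ^ i) =O[E] fun k => Z k ^ j := by
    intro i j hij
    obtain ⟨d, rfl⟩ := Nat.exists_eq_add_of_le hij
    have := (isBigO_refl (fun k => Z k ^ i) E).mul (hZ.pow d)
    simpa [pow_add] using this
  have hηO : η =O[E] fun i => x i ^ K * Z i := hη2.trans ((isBigO_refl _ _).mul huZ)
  have hη0 : Tendsto η E (𝓝 0) := by
    refine IsBigO.trans_tendsto ?_ hxZ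
    refine hηO.trans ?_
    have h1 := (hx.pow_isBigO_pow hK).mul (hZj one_le_two)
    simpa using h1
  -- second order expansion of the power
  have he1 : (fun i => e i + l * Z i * η i) =O[E] fun i => x i ^ (2 * K) * Z i ^ 3 := by
    have h1 := (isBigO_refl Z E).mul
      (((exp_neg_mul_log_one_add_isBigO l).comp_tendsto hη0).trans (hηO.pow 2))
    refine h1.congr (fun i => ?_) (fun i => ?_)
    · simp only [Function.comp_apply, he]; ring
    · ring
  have heO : e =O[E] fun i => x i ^ K * Z i ^ 2 := by
    have h1 : (fun i => l * Z i * η i) =O[E] fun i => x i ^ K * Z i ^ 2 := by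
      have := ((isBigO_refl Z E).const_mul_left (l : ℂ)).mul hηO
      refine this.congr_right fun i => ?_
      ring
    have h2 : (fun i => x i ^ (2 * K) * Z i ^ 3) =O[E] fun i => x i ^ K * Z i ^ 2 := by
      have h3 : (fun i => x i ^ K * Z i) =O[E] fun _ => (1 : ℂ) := by
        have h4 : Tendsto (fun i => x i ^ K * Z i) E (𝓝 0) := by
          refine IsBigO.trans_tendsto ?_ hxZ
          have h1 := (hx.pow_isBigO_pow hK).mul (hZj one_le_two)
          simpa using h1
        exact h4.isBigO_one ℂ
      have h5 := (isBigO_refl (fun i => x i ^ K * Z i ^ 2) E).mul h3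
      refine h5.congr (fun i => ?_) (fun i => ?_)
      · ring
      · ring
    refine ((he1.trans h2).sub h1).congr_left fun i => ?_
    ring
  have he0 : Tendsto e E (𝓝 0) := by
    refine IsBigO.trans_tendsto ?_ hxZ
    refine heO.trans ?_
    have h1 := (hx.pow_isBigO_pow hK).mul (isBigO_refl (fun i => Z i ^ 2) E)
    simpa using h1
  have htarget : ∀ {j : ℕ}, j ≤ 4 → (fun i => x i ^ (2 * K) * Z i ^ j) =O[E]
      fun i => x i ^ (K + 1) * Z i ^ 4 := fun {j} hj =>
    (hx.pow_isBigO_pow (by omega)).mul (hZj hj)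
  -- first order expansion of `W`
  have hWe : (fun i => W (Z i + e i) - W (Z i) - H (Z i) * e i) =O[E]
      fun i => x i ^ (K + 1) * Z i ^ 4 := by
    have h1 : (fun i => W (Z i + e i) - W (Z i) - H (Z i) * e i) =O[E] fun i => e i ^ 2 := by
      refine IsBigO.of_bound 8 ?_
      have he2 : ∀ᶠ i in E, ‖e i‖ < 1 := by
        have := he0.norm
        rw [norm_zero] at this
        exact this.eventually_lt_const (by norm_num)
      filter_upwards [he2, hZR] with i hi hiR
      have hball : ∀ w ∈ ball (Z i) 1, R₀ < w.re := by
        intro w hw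
        rw [mem_ball, dist_eq_norm] at hw
        have := (abs_lt.1 ((Complex.abs_re_le_norm (w - Z i)).trans_lt hw)).1
        rw [Complex.sub_re] at this
        linarith
      have hc := hball (Z i) (mem_ball_self one_pos)
      have hbd : ∀ w ∈ ball (Z i) 1, ‖W w - W (Z i)‖ ≤ 2 := by
        intro w hw
        have h2 := (convex_ball (Z i) 1).norm_image_sub_le_of_norm_hasDerivWithin_le (f := W)
          (f' := H) (C := 2) (fun v hv => (hW v (hball v hv)).hasDerivWithinAt)
          (fun v hv => hH2 v (hball v hv)) (mem_ball_self one_pos) hw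
        rw [mem_ball, dist_eq_norm] at hw
        linarith
      have hd : DifferentiableOn ℂ (fun w => W w - W (Z i)) (ball (Z i) 1) := fun w hw =>
        ((hW w (hball w hw)).differentiableAt.sub_const _).differentiableWithinAt
      have h3 := norm_sub_sub_deriv_mul_le hd hbd (z := Z i + e i) (by simpa [mem_ball] using hi)
      rw [((hW _ hc).sub_const _).deriv] at h3
      simp only [sub_self, sub_zero, add_sub_cancel_left, div_one] at h3
      rw [norm_pow]
      linarith
    refine h1.trans ((heO.pow 2).trans ?_)
    refine (htarget le_rfl).congr_left fun i => ?_
    ring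
  have hHO : (fun i => H (Z i)) =O[E] fun _ => (1 : ℂ) := by
    refine IsBigO.of_bound 2 ?_
    filter_upwards [hZR] with i hi
    rw [norm_one, mul_one]
    exact hH2 _ (by linarith)
  have h1 : (fun i => H (Z i) * (e i + l * Z i * η i)) =O[E] fun i => x i ^ (K + 1) * Z i ^ 4 := by
    have := hHO.mul (he1.trans (htarget (by norm_num : 3 ≤ 4)))
    simpa using this
  have h2 : (fun i => H (Z i) * (l * Z i * (η i - x i ^ K * (u i ^ (m + l) * rh (u i))))) =O[E]
      fun i => x i ^ (K + 1) * Z i ^ 4 := by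
    have h3 := hHO.mul (((isBigO_refl Z E).const_mul_left (l : ℂ)).mul
      (hη1.trans ((isBigO_refl _ _).mul huZ)))
    have h4 : (fun i => (1 : ℂ) * (Z i * (x i ^ (K + 1) * Z i))) =O[E]
        fun i => x i ^ (K + 1) * Z i ^ 4 := by
      have := (isBigO_refl (fun i => x i ^ (K + 1)) E).mul (hZj (by norm_num : 2 ≤ 4))
      refine this.congr_left fun i => ?_
      ring
    exact h3.trans h4
  have h5 : (fun i => (K : ℂ) * (Complex.log (1 + relIncX F (x i) (u i)) -
      x i ^ K * (u i ^ m * ph (u i)))) =O[E] fun i => x i ^ (K + 1) * Z i ^ 4 := by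
    have h6 := (h.log_relIncX_isBigO hx hu hx0).const_mul_left (K : ℂ)
    have h7 : (fun i => x i ^ (K + 1)) =O[E] fun i => x i ^ (K + 1) * Z i ^ 4 := by
      have := (isBigO_refl (fun i => x i ^ (K + 1)) E).mul (hZj (Nat.zero_le 4))
      simpa using this
    exact h6.trans h7
  refine ⟨hη0, he0, ?_⟩
  have hl0 : (l : ℂ) ≠ 0 := by exact_mod_cast (by have := h.one_le_l; omega : l ≠ 0)
  refine ((((hWe.neg_left).sub h1).add h2).sub h5).congr' ?_ EventuallyEq.rfl
  filter_upwards [hul, hH, hrh] with i h9 hHi h10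
  -- the leading terms agree: this is the choice of `u ^ l Z` and of `H`
  have h8 : H (Z i) * (l * Z i * (x i ^ K * (u i ^ (m + l) * rh (u i)))) =
      K * (x i ^ K * (u i ^ m * ph (u i))) := by
    have h11 := h.ph_ne
    have h12 := h.rh_ne
    have h13 : H (Z i) * (l * Z i * (x i ^ K * (u i ^ (m + l) * rh (u i)))) =
        H (Z i) * l * x i ^ K * u i ^ m * rh (u i) * (u i ^ l * Z i) := by rw [pow_add]; ring
    rw [h13, h9, hHi]
    field_simp
  have h14 : Z i * Complex.exp (-(l * Complex.log (1 + η i))) = Z i + e i := by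
    simp only [he]; ring
  rw [h14]
  linear_combination -h8

end IrregularExpansion

end OneStep

/-! ### Tools for drifts and ends of model domains -/

/-- A criterion for drifts: `a` is a small positive multiple of `exp (-L)`, up to a factor close to
`1`. In the strip `|Im L| < 1/2` the argument of `exp (-L)` has the sign that pushes points back to
the middle of the strip. -/
theorem IsDrift.of_eq_exp_mul {κ R δ : ℝ} {a A : ℂ × ℂ → ℂ} {g : ℂ × ℂ → ℝ}
    (ha : DifferentiableOn ℂ a (stripCone R (1 / 2) δ))
    (haA : ∀ z ∈ stripCone R (1 / 2) δ, a z = Complex.exp (-z.1) * (g z * A z))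
    (hA : ∀ z ∈ stripCone R (1 / 2) δ, ‖A z - 1‖ ≤ 1 / 10)
    (hg : ∀ z ∈ stripCone R (1 / 2) δ, g z ≤ 1 / 2)
    (hgκ : ∀ z ∈ stripCone R (1 / 2) δ, Real.exp (-(κ - 1) * z.1.re) ≤ g z / 2) :
    IsDrift κ R (1 / 2) δ a := by
  have hg0 : ∀ z ∈ stripCone R (1 / 2) δ, 0 < g z := fun z hz => by
    have := (Real.exp_pos _).trans_le (hgκ z hz)
    linarith
  have hAre : ∀ z ∈ stripCone R (1 / 2) δ, 9 / 10 ≤ (A z).re := fun z hz => by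
    have h1 := (abs_le.1 ((Complex.abs_re_le_norm _).trans (hA z hz))).1
    rw [Complex.sub_re, Complex.one_re] at h1
    linarith
  have hAim : ∀ z ∈ stripCone R (1 / 2) δ, |(A z).im| ≤ 1 / 10 := fun z hz => by
    have h1 := (Complex.abs_im_le_norm _).trans (hA z hz)
    rwa [Complex.sub_im, Complex.one_im, sub_zero] at h1
  have hnorm : ∀ z ∈ stripCone R (1 / 2) δ, ‖a z‖ = Real.exp (-z.1.re) * g z * ‖A z‖ :=
    fun z hz => by
      rw [haA z hz, norm_mul, norm_mul, Complex.norm_exp, Complex.norm_real,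
        Real.norm_of_nonneg (hg0 z hz).le, Complex.neg_re, mul_assoc]
  have hA2 : ∀ z ∈ stripCone R (1 / 2) δ, ‖A z‖ ≤ 11 / 10 := fun z hz => by
    have := norm_sub_norm_le (A z) 1
    rw [norm_one] at this
    linarith [hA z hz]
  have hare : ∀ z ∈ stripCone R (1 / 2) δ, (a z).re = Real.exp (-z.1.re) * g z *
      (Real.cos z.1.im * (A z).re + Real.sin z.1.im * (A z).im) := fun z hz => by
    rw [haA z hz, Complex.mul_re, Complex.exp_re, Complex.exp_im, Complex.re_ofReal_mul,
      Complex.im_ofReal_mul, Complex.neg_re, Complex.neg_im, Real.cos_neg, Real.sin_neg]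
    ring
  have haim : ∀ z ∈ stripCone R (1 / 2) δ, (a z).im = Real.exp (-z.1.re) * g z *
      (Real.cos z.1.im * (A z).im - Real.sin z.1.im * (A z).re) := fun z hz => by
    rw [haA z hz, Complex.mul_im, Complex.exp_re, Complex.exp_im, Complex.re_ofReal_mul,
      Complex.im_ofReal_mul, Complex.neg_re, Complex.neg_im, Real.cos_neg, Real.sin_neg]
    ring
  have hpos : ∀ z ∈ stripCone R (1 / 2) δ, 0 < Real.exp (-z.1.re) * g z := fun z hz =>
    mul_pos (Real.exp_pos _) (hg0 z hz)
  refine ⟨ha, fun z hz => ?_, fun z hz => ?_, fun z hz => ?_, fun z hz him => ?_,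
    fun z hz him => ?_⟩
  · rw [hnorm z hz]
    have h1 : 9 / 10 ≤ ‖A z‖ := (hAre z hz).trans (Complex.re_le_norm _)
    have h2 : Real.exp (-κ * z.1.re) = Real.exp (-z.1.re) * Real.exp (-(κ - 1) * z.1.re) := by
      rw [← Real.exp_add]; ring_nf
    rw [h2, mul_assoc]
    gcongr
    have := hgκ z hz
    have := hg0 z hz
    nlinarith
  · rw [hnorm z hz, mul_assoc]
    have h1 : g z * ‖A z‖ ≤ 1 / 2 * (11 / 10) := by
      have := hA2 z hz; have := hg z hz
      gcongr
    have := Real.exp_pos (-z.1.re)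
    nlinarith
  · rw [hnorm z hz, hare z hz, mul_div_assoc]
    refine mul_le_mul_of_nonneg_left ?_ (hpos z hz).le
    have h1 := hA2 z hz
    have h2 := hAre z hz
    have h3 := abs_le.1 (hAim z hz)
    have h4 := Real.one_sub_sq_div_two_le_cos (x := z.1.im)
    have h5 := abs_lt.1 hz.2.1
    have h6 : 7 / 8 ≤ Real.cos z.1.im := by nlinarith
    have h7 : |Real.sin z.1.im| ≤ 1 / 2 := Real.abs_sin_le_abs.trans hz.2.1.le
    have h8 : |Real.sin z.1.im * (A z).im| ≤ 1 / 2 * (1 / 10) := by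
      rw [abs_mul]
      exact mul_le_mul h7 (hAim z hz) (abs_nonneg _) (by norm_num)
    have h9 := (abs_le.1 h8).1
    nlinarith
  · rw [haim z hz]
    refine mul_neg_of_pos_of_neg (hpos z hz) ?_
    have h2 := hAre z hz
    have h3 := abs_le.1 (hAim z hz)
    have h5 := abs_lt.1 hz.2.1
    have h6 := Real.sin_gt_sub_cube (x := z.1.im) (by linarith)
    have h7 : Real.cos z.1.im ≤ 1 := Real.cos_le_one _
    have h8 : 0 ≤ Real.cos z.1.im := by
      have := Real.one_sub_sq_div_two_le_cos (x := z.1.im); nlinarith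
    have h9 : z.1.im * z.1.im ^ 2 ≤ z.1.im * (1 / 4) := by
      gcongr
      nlinarith
    have h10 : 15 / 64 ≤ Real.sin z.1.im := by nlinarith
    have h11 : Real.cos z.1.im * (A z).im ≤ 1 / 10 := by nlinarith
    nlinarith
  · rw [haim z hz]
    refine mul_pos (hpos z hz) ?_
    have h2 := hAre z hz
    have h3 := abs_le.1 (hAim z hz)
    have h5 := abs_lt.1 hz.2.1
    have h6 := Real.sin_gt_sub_cube (x := -z.1.im) (by linarith)
    rw [Real.sin_neg] at h6
    have h7 : Real.cos z.1.im ≤ 1 := Real.cos_le_one _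
    have h8 : 0 ≤ Real.cos z.1.im := by
      have := Real.one_sub_sq_div_two_le_cos (x := z.1.im); nlinarith
    have h9 : -z.1.im * (-z.1.im) ^ 2 ≤ -z.1.im * (1 / 4) := by
      gcongr
      · linarith
      · nlinarith
    have h10 : Real.sin z.1.im ≤ -(15 / 64) := by nlinarith
    have h11 : -(1 / 10) ≤ Real.cos z.1.im * (A z).im := by nlinarith
    nlinarith

theorem tendsto_re_modelEnd (R θ δ : ℝ) :
    Tendsto (fun z : ℂ × ℂ => z.1.re) (modelEnd R θ δ) atTop :=
  tendsto_comap.mono_left inf_le_left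

theorem eventually_mem_modelEnd (R θ δ : ℝ) : ∀ᶠ z in modelEnd R θ δ, z ∈ stripCone R θ δ :=
  mem_inf_of_right (mem_principal_self _)

theorem modelEnd_mono {R θ δ R' θ' δ' : ℝ} (h : stripCone R θ δ ⊆ stripCone R' θ' δ') :
    modelEnd R θ δ ≤ modelEnd R' θ' δ' :=
  inf_le_inf_left _ (principal_mono.2 h)

/-- A property that holds at the end of a model domain holds on a smaller model domain. -/
theorem exists_forall_stripCone_of_eventually {R θ δ : ℝ} {p : ℂ × ℂ → Prop}
    (h : ∀ᶠ z in modelEnd R θ δ, p z) (hR : 0 ≤ R) :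
    ∃ R', R ≤ R' ∧ ∀ z ∈ stripCone R' θ δ, p z := by
  rw [modelEnd, eventually_inf_principal, eventually_comap] at h
  obtain ⟨M, hM⟩ := eventually_atTop.1 h
  refine ⟨max R M, le_max_left _ _, fun z hz => ?_⟩
  exact hM z.1.re ((le_max_right R M).trans hz.1.le) z rfl
    (stripCone_subset (le_max_left _ _) (hR.trans (le_max_left _ _)) le_rfl le_rfl hz)

/-! ### The blow-up chart on a model domain -/

theorem tendsto_rootBranch (μ : ℂ) {l : ℕ} (hl : 1 ≤ l) :
    Tendsto (rootBranch μ l) (Bornology.cobounded ℂ) (𝓝 0) := by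
  rw [tendsto_zero_iff_norm_tendsto_zero]
  have hl0 : (0 : ℝ) < 1 / l := by
    have : (0 : ℝ) < l := by exact_mod_cast hl
    positivity
  have h1 := ((tendsto_rpow_neg_atTop hl0).comp (tendsto_norm_cobounded_atTop (E := ℂ))).const_mul
    ‖μ‖
  rw [mul_zero] at h1
  refine h1.congr' ?_
  filter_upwards [tendsto_norm_cobounded_atTop.eventually_gt_atTop (0 : ℝ)] with Z hZ
  rw [norm_rootBranch (norm_pos_iff.1 hZ)]
  rfl

/-- The chart `z = (L, s) ↦ (x, x u)` with `x = α exp (-L / K)` and `u = μ (Z z) ^ (-1 / l)`. Here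
`W` is the function of `Z` with derivative `(ph u / ph 0) (rh 0 / rh u)`, which is close to `1`, and
`Z z` is the solution of `W (Z z) = L - s`; the constants `μ` and `α` are such that `F` increases
`L` and `W` by the same amount to leading order, namely by approximately
`exp (-L) (u / μ) ^ m / 2`. The constant `c` measures how far `Z z` may be from `Re L`. -/
structure IsBlowupChart (K m l : ℕ) (ph rh : ℂ → ℂ) (μ α : ℂ) (c R₀ R δ : ℝ) (W : ℂ → ℂ)
    (Z : ℂ × ℂ → ℂ) : Prop where
  μ_ne : μ ≠ 0
  α_ne : α ≠ 0
  μ_pow : μ ^ l = K * ph 0 / (l * rh 0)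
  α_pow : α ^ K * (2 * K * ph 0 * μ ^ m) = -1
  one_le_R₀ : 1 ≤ R₀
  one_le_R : 1 ≤ R
  δ_pos : 0 < δ
  hasDerivAt : ∀ w : ℂ, R₀ < w.re →
    HasDerivAt W (ph (rootBranch μ l w) / ph 0 * (rh 0 / rh (rootBranch μ l w))) w
  norm_le : ∀ w : ℂ, R₀ < w.re →
    ‖ph (rootBranch μ l w) / ph 0 * (rh 0 / rh (rootBranch μ l w))‖ ≤ 2
  rh_ne : ∀ w : ℂ, R₀ < w.re → rh (rootBranch μ l w) ≠ 0
  injOn : InjOn W {w | R₀ < w.re}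
  differentiableOn : DifferentiableOn ℂ Z (stripCone R 1 δ)
  re_Z : ∀ z ∈ stripCone R 1 δ, R₀ < (Z z).re
  W_Z : ∀ z ∈ stripCone R 1 δ, W (Z z) = z.1 - z.2
  norm_sub_le : ∀ z ∈ stripCone R 1 δ, ‖Z z - z.1.re‖ ≤ c * z.1.re

/-- A chart exists for every precision `c`: for `Re Z` large `u` is small, so the derivative of `W` is
as close to `1` as desired, and `W` takes all the values `L - s`. -/
theorem IrregularExpansion.exists_isBlowupChart {F : ℂ × ℂ → ℂ × ℂ} {K m l : ℕ} {ph rh : ℂ → ℂ}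
    (h : IrregularExpansion F K m l ph rh) {c : ℝ} (hc : 0 < c) (hc1 : c ≤ 1 / 2) :
    ∃ μ α R₀ R δ W Z, IsBlowupChart K m l ph rh μ α c R₀ R δ W Z := by
  have hK := h.one_le_K
  have hl := h.one_le_l
  have hp := h.ph_ne
  have hr := h.rh_ne
  have hK0 : (K : ℂ) ≠ 0 := by exact_mod_cast (by omega : K ≠ 0)
  have hl0 : (l : ℂ) ≠ 0 := by exact_mod_cast (by omega : l ≠ 0)
  obtain ⟨μ, hμ⟩ := IsAlgClosed.exists_pow_nat_eq (K * ph 0 / (l * rh 0)) hl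
  have hμ0 : μ ≠ 0 := by
    rintro rfl
    rw [zero_pow (by omega)] at hμ
    exact div_ne_zero (mul_ne_zero hK0 hp) (mul_ne_zero hl0 hr) hμ.symm
  have hd : 2 * K * ph 0 * μ ^ m ≠ 0 := by simp [hK0, hp, hμ0]
  obtain ⟨α, hα⟩ := IsAlgClosed.exists_pow_nat_eq (-(2 * K * ph 0 * μ ^ m)⁻¹) hK
  have hα' : α ^ K * (2 * K * ph 0 * μ ^ m) = -1 := by
    rw [hα, neg_mul, inv_mul_cancel₀ hd]
  have hα0 : α ≠ 0 := by
    rintro rfl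
    rw [zero_pow (by omega), zero_mul] at hα'
    norm_num at hα'
  -- `W` covers the sector of opening `c / 2`, which contains `L - s` if `‖s‖ < (c / 4) Re L`
  set δ' : ℝ := c / 2 with hδ'
  set Hu : ℂ → ℂ := fun u => ph u / ph 0 * (rh 0 / rh u) with hHu
  have hHa : AnalyticAt ℂ Hu 0 :=
    (h.analyticAt_ph.div analyticAt_const hp).mul (analyticAt_const.div h.analyticAt_rh hr)
  have hHu0 : Hu 0 = 1 := by simp [hHu, hp, hr]
  have hgood : ∀ᶠ u in 𝓝 (0 : ℂ), DifferentiableAt ℂ Hu u ∧ rh u ≠ 0 ∧ ‖Hu u - 1‖ < δ' / 16 := by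
    have h1 : ∀ᶠ u in 𝓝 (0 : ℂ), ‖Hu u - 1‖ < δ' / 16 := by
      have h2 : ContinuousAt (fun u => ‖Hu u - 1‖) 0 := (hHa.continuousAt.sub_const 1).norm
      refine h2.eventually_lt_const ?_
      simp only [hHu0, sub_self, norm_zero]
      positivity
    filter_upwards [hHa.eventually_analyticAt, h.analyticAt_rh.continuousAt.eventually_ne hr, h1]
      with u h3 h4 h5 using ⟨h3.differentiableAt, h4, h5⟩
  have hev := (tendsto_rootBranch μ hl).eventually hgood
  rw [← comap_norm_atTop, eventually_comap] at hev
  obtain ⟨M, hM⟩ := eventually_atTop.1 hev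
  set R₀ := max 1 M with hR₀
  have hP : ∀ w : ℂ, R₀ < w.re → DifferentiableAt ℂ Hu (rootBranch μ l w) ∧
      rh (rootBranch μ l w) ≠ 0 ∧ ‖Hu (rootBranch μ l w) - 1‖ < δ' / 16 := fun w hw =>
    hM ‖w‖ ((le_max_right 1 M).trans (hw.le.trans (Complex.re_le_norm w))) w rfl
  have hpos : ∀ w : ℂ, R₀ < w.re → 0 < w.re := fun w hw =>
    lt_trans (lt_of_lt_of_le one_pos (le_max_left 1 M)) hw
  obtain ⟨W, hW, hWu, R₂, hR₂⟩ := exists_primitive_near_id (H := fun w => Hu (rootBranch μ l w))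
    (R₀ := R₀) (ε := δ' / 16) (δ := δ') (by positivity) (by linarith) le_rfl
    (fun w hw => ((hP w hw).1.comp w
      (hasDerivAt_rootBranch (Or.inl (hpos w hw))).differentiableAt).differentiableWithinAt)
    (fun w hw => (hP w hw).2.2.le)
  set P : Set ℂ := {w | R₀ < w.re} with hPdef
  set R : ℝ := max (max 1 R₂) (4 / c) with hR
  have hR1 : 1 ≤ R := (le_max_left 1 R₂).trans (le_max_left _ _)
  have hsol : ∀ z ∈ stripCone R 1 (c / 4), ∃ w, R₀ < w.re ∧ W w = z.1 - z.2 ∧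
      ‖w - z.1.re‖ ≤ c * z.1.re := by
    intro z hz
    have h1 : 4 / c < z.1.re := (le_max_right _ _).trans_lt hz.1
    rw [div_lt_iff₀ hc] at h1
    have h2 : ‖z.1 - z.2 - z.1.re‖ ≤ δ' * z.1.re := by
      have h3 : z.1 - z.2 - z.1.re = z.1.im * Complex.I - z.2 := by
        linear_combination -Complex.re_add_im z.1
      rw [h3]
      refine (norm_sub_le _ _).trans ?_
      rw [norm_mul, Complex.norm_I, mul_one, Complex.norm_real, Real.norm_eq_abs]
      have := hz.2.1
      have := hz.2.2
      rw [hδ']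
      nlinarith
    obtain ⟨w, hw, hw1, hw2⟩ := hR₂ z.1.re
      (((le_max_right 1 R₂).trans (le_max_left _ _)).trans_lt hz.1) _ h2
    exact ⟨w, hw, hw1, by rw [hδ'] at hw2; linarith⟩
  have hZ : ∀ z ∈ stripCone R 1 (c / 4), R₀ < (Function.invFunOn W P (z.1 - z.2)).re ∧
      W (Function.invFunOn W P (z.1 - z.2)) = z.1 - z.2 ∧
      ‖Function.invFunOn W P (z.1 - z.2) - z.1.re‖ ≤ c * z.1.re := by
    intro z hz
    obtain ⟨w, hw, hw1, hw2⟩ := hsol z hz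
    have h1 : Function.invFunOn W P (z.1 - z.2) = w := by
      rw [← hw1]
      exact hWu.injOn.leftInvOn_invFunOn hw
    rw [h1]
    exact ⟨hw, hw1, hw2⟩
  refine ⟨μ, α, R₀, R, c / 4, W, fun z => Function.invFunOn W P (z.1 - z.2), hμ0, hα0, hμ, hα',
    le_max_left 1 M, hR1, by positivity, hW, fun w hw => ?_, fun w hw => (hP w hw).2.1, hWu.injOn,
    ?_, fun z hz => (hZ z hz).1, fun z hz => (hZ z hz).2.1, fun z hz => (hZ z hz).2.2⟩
  · have h1 := norm_sub_norm_le (Hu (rootBranch μ l w)) 1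
    have h2 := (hP w hw).2.2
    rw [norm_one] at h1
    change ‖Hu (rootBranch μ l w)‖ ≤ 2
    linarith
  · refine hWu.invFunOn.differentiableOn.comp (t := W '' P)
      (differentiable_fst.sub differentiable_snd).differentiableOn fun z hz => ?_
    obtain ⟨w, hw, hw1, -⟩ := hsol z hz
    exact ⟨w, hw, hw1⟩

namespace IsBlowupChart

variable {K m l : ℕ} {ph rh : ℂ → ℂ} {μ α : ℂ} {c R₀ R δ : ℝ} {W : ℂ → ℂ} {Z : ℂ × ℂ → ℂ}

/-- The chart is univalent: its first component depends only on `L`, and `u` determines `Z` and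
hence `s = L - W (Z z)`. -/
theorem univalentOn (h : IsBlowupChart K m l ph rh μ α c R₀ R δ W Z) (hK : 1 ≤ K) (hl : 1 ≤ l) :
    UnivalentOn (fun z => (α * Complex.exp (-z.1 / K),
      α * Complex.exp (-z.1 / K) * rootBranch μ l (Z z))) (stripCone R 1 δ) := by
  have hK0 : (K : ℂ) ≠ 0 := by exact_mod_cast (by omega : K ≠ 0)
  have hl0 : (l : ℂ) ≠ 0 := by exact_mod_cast (by omega : l ≠ 0)
  have hx0 : ∀ L : ℂ, α * Complex.exp (-L / K) ≠ 0 := fun L =>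
    mul_ne_zero h.α_ne (Complex.exp_ne_zero _)
  have hx : ∀ L : ℂ, HasDerivAt (fun L : ℂ => α * Complex.exp (-L / K))
      (α * (Complex.exp (-L / K) * (-1 / K))) L := fun L =>
    ((((hasDerivAt_id L).neg).div_const (K : ℂ)).cexp).const_mul α
  have hZre : ∀ z ∈ stripCone R 1 δ, 0 < (Z z).re := fun z hz =>
    lt_trans (lt_of_lt_of_le one_pos h.one_le_R₀) (h.re_Z z hz)
  have hZ0 : ∀ z ∈ stripCone R 1 δ, Z z ≠ 0 := fun z hz h0 => by
    have := hZre z hz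
    rw [h0, Complex.zero_re] at this
    exact lt_irrefl _ this
  have hopen := isOpen_stripCone R 1 δ
  have hZd : ∀ z ∈ stripCone R 1 δ, DifferentiableAt ℂ Z z := fun z hz =>
    h.differentiableOn.differentiableAt (hopen.mem_nhds hz)
  have hxd : ∀ z : ℂ × ℂ, DifferentiableAt ℂ (fun z : ℂ × ℂ => α * Complex.exp (-z.1 / K)) z :=
    fun z => (hx z.1).differentiableAt.comp z differentiableAt_fst
  have hdiff : ∀ z ∈ stripCone R 1 δ, DifferentiableAt ℂ (fun z => (α * Complex.exp (-z.1 / K),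
      α * Complex.exp (-z.1 / K) * rootBranch μ l (Z z))) z := fun z hz =>
    (hxd z).prodMk ((hxd z).mul
      ((hasDerivAt_rootBranch (Or.inl (hZre z hz))).differentiableAt.comp z (hZd z hz)))
  refine ⟨hopen, fun z hz => (hdiff z hz).differentiableWithinAt, ?_, fun z hz => ?_⟩
  · intro z hz z' hz' heq
    obtain ⟨h1, h2⟩ := Prod.mk.inj heq
    have hL : z.1 = z'.1 := by
      have h3 := mul_left_cancel₀ h.α_ne h1
      obtain ⟨n, hn⟩ := Complex.exp_eq_exp_iff_exists_int.1 h3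
      have h4 : z'.1 - z.1 = K * (n * (2 * Real.pi * Complex.I)) := by
        field_simp at hn
        linear_combination hn
      have h5 : z'.1.im - z.1.im = K * n * (2 * Real.pi) := by
        rw [← Complex.sub_im, h4, show (K * (n * (2 * Real.pi * Complex.I)) : ℂ) =
          ((K * n * (2 * Real.pi) : ℝ) : ℂ) * Complex.I by push_cast; ring, Complex.im_ofReal_mul,
          Complex.I_im, mul_one]
      have hn0 : n = 0 := by
        by_contra hne
        have h6 : (1 : ℝ) ≤ |(n : ℝ)| := by exact_mod_cast Int.one_le_abs hne
        have h7 : (1 : ℝ) ≤ K := by exact_mod_cast hK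
        have h8 : |z'.1.im - z.1.im| < 2 := by
          have := abs_sub z'.1.im z.1.im
          linarith [hz.2.1, hz'.2.1]
        rw [h5, abs_mul, abs_mul, abs_of_nonneg (by positivity : (0 : ℝ) ≤ 2 * Real.pi),
          Nat.abs_cast] at h8
        have h9 : (1 : ℝ) ≤ K * |(n : ℝ)| := one_le_mul_of_one_le_of_one_le h7 h6
        nlinarith [Real.pi_gt_three]
      rw [hn0] at h4
      simp only [Int.cast_zero, zero_mul, mul_zero] at h4
      exact (sub_eq_zero.1 h4).symm
    rw [h1] at h2
    have h3 := rootBranch_injOn h.μ_ne hl (hZ0 z hz) (hZ0 z' hz') (mul_left_cancel₀ (hx0 _) h2)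
    have h4 := h.W_Z z hz
    rw [h3, h.W_Z z' hz', hL] at h4
    exact Prod.ext hL (sub_right_injective h4).symm
  · have hfib : HasDerivAt (fun w => Z (z.1, w)) (fderiv ℂ Z z (0, 1)) z.2 := by
      have h1 : HasDerivAt (fun w : ℂ => (z.1, w)) ((0 : ℂ), (1 : ℂ)) z.2 :=
        (hasDerivAt_const _ _).prodMk (hasDerivAt_id _)
      exact (hZd z hz).hasFDerivAt.comp_hasDerivAt z.2 h1
    -- differentiate `W (Z (L, s)) = L - s` in `s`
    have hfib0 : fderiv ℂ Z z (0, 1) ≠ 0 := by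
      intro h0
      have h1 := (h.hasDerivAt _ (h.re_Z z hz)).comp z.2 hfib
      have h2 : HasDerivAt (fun w : ℂ => z.1 - w) (-1) z.2 := (hasDerivAt_id z.2).const_sub z.1
      have h3 : (W ∘ fun w => Z (z.1, w)) =ᶠ[𝓝 z.2] fun w => z.1 - w := by
        have h4 : ∀ᶠ w in 𝓝 z.2, (z.1, w) ∈ stripCone R 1 δ :=
          (continuous_const.prodMk continuous_id).continuousAt.eventually (hopen.mem_nhds hz)
        filter_upwards [h4] with w hw using h.W_Z _ hw
      have h5 := (h2.congr_of_eventuallyEq h3).unique h1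
      rw [h0, mul_zero] at h5
      norm_num at h5
    have hroot := ((hasDerivAt_rootBranch (μ := μ) (l := l) (Or.inl (hZre z hz))).comp z.2
      hfib).const_mul (α * Complex.exp (-z.1 / K))
    refine injective_fderiv_of_triangular (hdiff z hz) (hx z.1) ?_
      (Eventually.of_forall fun w => rfl) hroot ?_
    · simp [h.α_ne, hK0]
    · refine mul_ne_zero (hx0 _) (mul_ne_zero (mul_ne_zero (rootBranch_ne_zero h.μ_ne _ _) ?_)
        hfib0)
      simp [hZ0 z hz, hl0]

end IsBlowupChart

/-! ### Asymptotics at the end of the chart -/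

theorem tendsto_rpow_mul_exp_modelEnd (s : ℝ) {b : ℝ} (hb : 0 < b) (R θ δ : ℝ) :
    Tendsto (fun z : ℂ × ℂ => z.1.re ^ s * Real.exp (-b * z.1.re)) (modelEnd R θ δ) (𝓝 0) :=
  (tendsto_rpow_mul_exp_neg_mul_atTop_nhds_zero s b hb).comp (tendsto_re_modelEnd R θ δ)

namespace IsBlowupChart

variable {F : ℂ × ℂ → ℂ × ℂ} {K m l : ℕ} {ph rh : ℂ → ℂ} {μ α : ℂ} {c R₀ R δ : ℝ} {W : ℂ → ℂ}
  {Z : ℂ × ℂ → ℂ}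

/-- The component `x = α exp (-L / K)` of the chart. -/
noncomputable def chartX (α : ℂ) (K : ℕ) (z : ℂ × ℂ) : ℂ := α * Complex.exp (-z.1 / K)

theorem norm_chartX_pow (α : ℂ) (K j : ℕ) (z : ℂ × ℂ) :
    ‖chartX α K z ^ j‖ = ‖α‖ ^ j * Real.exp (-(j / K) * z.1.re) := by
  rw [chartX, mul_pow, ← Complex.exp_nat_mul, norm_mul, norm_pow, Complex.norm_exp,
    show (j : ℂ) * (-z.1 / K) = ((-(j / K) : ℝ) : ℂ) * z.1 by push_cast; ring,
    Complex.re_ofReal_mul]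

theorem one_le_re (h : IsBlowupChart K m l ph rh μ α c R₀ R δ W Z) {z : ℂ × ℂ}
    (hz : z ∈ stripCone R 1 δ) : 1 ≤ z.1.re :=
  h.one_le_R.trans hz.1.le

theorem le_re (h : IsBlowupChart K m l ph rh μ α c R₀ R δ W Z) (hc : c ≤ 1 / 4) {z : ℂ × ℂ}
    (hz : z ∈ stripCone R 1 δ) : z.1.re / 2 ≤ (Z z).re := by
  have h1 := (abs_le.1 ((Complex.abs_re_le_norm _).trans (h.norm_sub_le z hz))).1
  rw [Complex.sub_re, Complex.ofReal_re] at h1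
  have := h.one_le_re hz
  nlinarith

theorem norm_le_two_mul (h : IsBlowupChart K m l ph rh μ α c R₀ R δ W Z) (hc : c ≤ 1 / 4)
    {z : ℂ × ℂ} (hz : z ∈ stripCone R 1 δ) : ‖Z z‖ ≤ 2 * z.1.re := by
  have h1 := norm_sub_norm_le (Z z) z.1.re
  have h2 := h.one_le_re hz
  rw [Complex.norm_real, Real.norm_of_nonneg (by linarith)] at h1
  have := h.norm_sub_le z hz
  nlinarith

theorem tendsto_re_Z (h : IsBlowupChart K m l ph rh μ α c R₀ R δ W Z) (hc : c ≤ 1 / 4) :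
    Tendsto (fun z => (Z z).re) (modelEnd R 1 δ) atTop := by
  refine tendsto_atTop_mono' _ ?_ ((tendsto_re_modelEnd R 1 δ).atTop_div_const two_pos)
  filter_upwards [eventually_mem_modelEnd R 1 δ] with z hz using h.le_re hc hz

theorem tendsto_rootBranch_Z (h : IsBlowupChart K m l ph rh μ α c R₀ R δ W Z) (hc : c ≤ 1 / 4)
    (hl : 1 ≤ l) : Tendsto (fun z => rootBranch μ l (Z z)) (modelEnd R 1 δ) (𝓝 0) := by
  refine (tendsto_rootBranch μ hl).comp ?_
  rw [← comap_norm_atTop, tendsto_comap_iff]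
  exact tendsto_atTop_mono (fun z => Complex.re_le_norm _) (h.tendsto_re_Z hc)

theorem norm_chartX_pow_mul_le (h : IsBlowupChart K m l ph rh μ α c R₀ R δ W Z) (hc : c ≤ 1 / 4)
    (i j : ℕ) {z : ℂ × ℂ} (hz : z ∈ stripCone R 1 δ) :
    ‖chartX α K z ^ i * Z z ^ j‖ ≤
      ‖α‖ ^ i * 2 ^ j * (z.1.re ^ (j : ℝ) * Real.exp (-(i / K) * z.1.re)) := by
  rw [norm_mul, norm_chartX_pow, norm_pow, Real.rpow_natCast]
  have h1 : ‖Z z‖ ^ j ≤ (2 * z.1.re) ^ j := by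
    gcongr
    exact h.norm_le_two_mul hc hz
  calc _ ≤ ‖α‖ ^ i * Real.exp (-(i / K) * z.1.re) * (2 * z.1.re) ^ j := by gcongr
    _ = _ := by rw [mul_pow]; ring

theorem tendsto_chartX_pow_mul (h : IsBlowupChart K m l ph rh μ α c R₀ R δ W Z) (hc : c ≤ 1 / 4)
    (hK : 1 ≤ K) {i : ℕ} (hi : 1 ≤ i) (j : ℕ) :
    Tendsto (fun z => chartX α K z ^ i * Z z ^ j) (modelEnd R 1 δ) (𝓝 0) := by
  have hb : (0 : ℝ) < i / K := by
    have : (0 : ℝ) < K := by exact_mod_cast hK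
    have : (0 : ℝ) < i := by exact_mod_cast hi
    positivity
  have h1 := (tendsto_rpow_mul_exp_modelEnd j hb R 1 δ).const_mul (‖α‖ ^ i * 2 ^ j)
  rw [mul_zero] at h1
  refine squeeze_zero_norm' ?_ h1
  filter_upwards [eventually_mem_modelEnd R 1 δ] with z hz
    using h.norm_chartX_pow_mul_le hc i j hz

theorem tendsto_chartX (h : IsBlowupChart K m l ph rh μ α c R₀ R δ W Z) (hc : c ≤ 1 / 4)
    (hK : 1 ≤ K) : Tendsto (chartX α K) (modelEnd R 1 δ) (𝓝 0) := by
  simpa using h.tendsto_chartX_pow_mul hc hK le_rfl 0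

theorem chartX_ne_zero (h : IsBlowupChart K m l ph rh μ α c R₀ R δ W Z) (z : ℂ × ℂ) :
    chartX α K z ≠ 0 :=
  mul_ne_zero h.α_ne (Complex.exp_ne_zero _)

/-- The estimates of one step in the chart: `u` moves by a small factor, and the increment of
`s = L - W` is exponentially small compared to that of `L`. -/
theorem eventually_increment (h : IsBlowupChart K m l ph rh μ α c R₀ R δ W Z) (hc : c ≤ 1 / 4)
    (hF : IrregularExpansion F K m l ph rh) :
    Tendsto (fun z => relIncU F (chartX α K z) (rootBranch μ l (Z z))) (modelEnd R 1 δ) (𝓝 0) ∧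
    Tendsto (fun z => Z z * Complex.exp (-(l * Complex.log
      (1 + relIncU F (chartX α K z) (rootBranch μ l (Z z))))) - Z z) (modelEnd R 1 δ) (𝓝 0) ∧
    ∀ᶠ z in modelEnd R 1 δ, ‖-K * Complex.log (1 + relIncX F (chartX α K z) (rootBranch μ l (Z z)))
      - (W (Z z * Complex.exp (-(l * Complex.log
        (1 + relIncU F (chartX α K z) (rootBranch μ l (Z z)))))) - W (Z z))‖ ≤
      Real.exp (-(1 + 1 / (2 * K)) * z.1.re) := by
  have hK := hF.one_le_K
  have hl := hF.one_le_l
  have hK0 : (0 : ℝ) < K := by exact_mod_cast hK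
  have hmem := eventually_mem_modelEnd R 1 δ
  have hre := h.tendsto_re_Z hc
  have hZ1 : ∀ᶠ z in modelEnd R 1 δ, 1 ≤ ‖Z z‖ := by
    filter_upwards [hre.eventually_ge_atTop 1] with z hz using hz.trans (Complex.re_le_norm _)
  have hZO : (fun _ => (1 : ℂ)) =O[modelEnd R 1 δ] Z := by
    refine IsBigO.of_bound 1 ?_
    filter_upwards [hZ1] with z hz
    simpa using hz
  have huZ : (fun z => (rootBranch μ l (Z z))⁻¹) =O[modelEnd R 1 δ] Z := by
    refine IsBigO.of_bound ‖μ‖⁻¹ ?_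
    filter_upwards [hZ1] with z hz
    have hz0 : Z z ≠ 0 := norm_pos_iff.1 (by linarith)
    rw [norm_inv, norm_rootBranch hz0, mul_inv, Real.rpow_neg (norm_nonneg _), inv_inv]
    gcongr
    have hl1 : (1 : ℝ) ≤ l := by exact_mod_cast hl
    have h1 : (1 / l : ℝ) ≤ 1 := by
      rw [div_le_one (by linarith)]
      exact hl1
    calc ‖Z z‖ ^ (1 / l : ℝ) ≤ ‖Z z‖ ^ (1 : ℝ) := Real.rpow_le_rpow_of_exponent_le hz h1
      _ = _ := Real.rpow_one _
  have hxZ : Tendsto (fun z => chartX α K z * Z z ^ 2) (modelEnd R 1 δ) (𝓝 0) := by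
    simpa using h.tendsto_chartX_pow_mul hc hK le_rfl 2
  have hul : ∀ᶠ z in modelEnd R 1 δ, rootBranch μ l (Z z) ^ l * Z z = K * ph 0 / (l * rh 0) := by
    filter_upwards [hZ1] with z hz
    rw [rootBranch_pow_mul hl (norm_pos_iff.1 (by linarith)), h.μ_pow]
  obtain ⟨h1, h2, h3⟩ := hF.increment_isBigO (h.tendsto_chartX hc hK)
    (h.tendsto_rootBranch_Z hc hl) (Eventually.of_forall h.chartX_ne_zero)
    (Eventually.of_forall fun z => rootBranch_ne_zero h.μ_ne _ _) huZ hZO hxZ hul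
    (hre.eventually_gt_atTop (R₀ + 1)) h.hasDerivAt h.norm_le
    (Eventually.of_forall fun z => rfl)
    (hmem.mono fun z hz => h.rh_ne _ (h.re_Z z hz))
  refine ⟨h1, h2, ?_⟩
  obtain ⟨C, hC0, hC⟩ := h3.exists_nonneg
  rw [isBigOWith_iff] at hC
  have hb : (0 : ℝ) < 1 / (2 * K) := by positivity
  have h4 := (tendsto_rpow_mul_exp_modelEnd (4 : ℕ) hb R 1 δ).const_mul
    (C * (‖α‖ ^ (K + 1) * 2 ^ 4))
  rw [mul_zero] at h4
  filter_upwards [hC, hmem, h4.eventually_le_const one_pos] with z hz hzm hz1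
  refine hz.trans ?_
  have h5 : Real.exp (-(((K + 1 : ℕ) : ℝ) / K) * z.1.re) =
      Real.exp (-(1 / (2 * K)) * z.1.re) * Real.exp (-(1 + 1 / (2 * K)) * z.1.re) := by
    rw [← Real.exp_add]
    congr 1
    push_cast
    field_simp
    ring
  calc _ ≤ C * (‖α‖ ^ (K + 1) * 2 ^ 4 * (z.1.re ^ ((4 : ℕ) : ℝ) *
        Real.exp (-(((K + 1 : ℕ) : ℝ) / K) * z.1.re))) := by
        gcongr
        exact h.norm_chartX_pow_mul_le hc (K + 1) 4 hzm
    _ = (C * (‖α‖ ^ (K + 1) * 2 ^ 4) * (z.1.re ^ ((4 : ℕ) : ℝ) *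
        Real.exp (-(1 / (2 * K)) * z.1.re))) * Real.exp (-(1 + 1 / (2 * K)) * z.1.re) := by
        rw [h5]; ring
    _ ≤ 1 * Real.exp (-(1 + 1 / (2 * K)) * z.1.re) := by gcongr
    _ = _ := one_mul _

/-- The increment of `L` is `exp (-L) / 2` times `(Re L) ^ (-m / l)`, up to a factor that is close
to `1` as soon as the ratio of `Z z` and `Re L` is. -/
theorem eventually_drift (h : IsBlowupChart K m l ph rh μ α c R₀ R δ W Z) (hc : c ≤ 1 / 4)
    (hF : IrregularExpansion F K m l ph rh)
    (hcm : ∀ w : ℂ, ‖w - 1‖ ≤ c → ‖Complex.exp (-(m / l * Complex.log w)) - 1‖ ≤ 1 / 40) :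
    ∀ᶠ z in modelEnd R 1 δ,
      ‖-K * Complex.log (1 + relIncX F (chartX α K z) (rootBranch μ l (Z z))) * Complex.exp z.1 /
        ((1 / 2 * z.1.re ^ (-(m / l : ℝ)) : ℝ) : ℂ) - 1‖ ≤ 1 / 10 := by
  have hK := hF.one_le_K
  have hl := hF.one_le_l
  have hK0 : (0 : ℝ) < K := by exact_mod_cast hK
  have hl0 : (l : ℂ) ≠ 0 := by exact_mod_cast (by omega : l ≠ 0)
  have hmem := eventually_mem_modelEnd R 1 δ
  have hu := h.tendsto_rootBranch_Z hc hl
  have h3 := (hF.log_relIncX_isBigO (h.tendsto_chartX hc hK) hu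
    (Eventually.of_forall h.chartX_ne_zero))
  obtain ⟨C, hC0, hC⟩ := h3.exists_nonneg
  rw [isBigOWith_iff] at hC
  have hb : (0 : ℝ) < 1 / K := by positivity
  have h4 := (tendsto_rpow_mul_exp_modelEnd (m / l : ℝ) hb R 1 δ).const_mul
    (2 * K * C * ‖α‖ ^ (K + 1))
  rw [mul_zero] at h4
  have hph : ∀ᶠ z in modelEnd R 1 δ, ‖ph (rootBranch μ l (Z z)) / ph 0 - 1‖ < 1 / 40 := by
    have h5 : ContinuousAt (fun v => ‖ph v / ph 0 - 1‖) 0 :=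
      ((hF.analyticAt_ph.continuousAt.div_const _).sub_const 1).norm
    refine (h5.tendsto.comp hu).eventually_lt_const ?_
    simp [hF.ph_ne]
  filter_upwards [hC, hmem, h4.eventually_le_const (by norm_num : (0 : ℝ) < 1 / 40), hph]
    with z hz hzm hz1 hz2
  have ht := h.one_le_re hzm
  have ht0 : 0 < z.1.re := by linarith
  set t := z.1.re with ht_def
  set u := rootBranch μ l (Z z) with hu_def
  set x := chartX α K z with hx_def
  set g : ℝ := 1 / 2 * t ^ (-(m / l : ℝ)) with hg
  have hg0 : 0 < g := by positivity
  have hgC : (g : ℂ) ≠ 0 := by exact_mod_cast hg0.ne'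
  set w : ℂ := Z z / t with hw
  have htC : (t : ℂ) ≠ 0 := by exact_mod_cast ht0.ne'
  have hwc : ‖w - 1‖ ≤ c := by
    rw [hw, div_sub_one htC, norm_div, Complex.norm_real, Real.norm_of_nonneg ht0.le,
      div_le_iff₀ ht0]
    exact h.norm_sub_le z hzm
  have hZ0 : Z z ≠ 0 := by
    intro h0
    have := h.le_re hc hzm
    rw [h0, Complex.zero_re] at this
    linarith
  have hw0 : w ≠ 0 := div_ne_zero hZ0 htC
  have hlog : Complex.log (Z z) = Real.log t + Complex.log w := by
    rw [← Complex.log_ofReal_mul ht0 hw0, hw, mul_div_cancel₀ _ htC]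
  set q : ℂ := Complex.exp (-(m / l * Complex.log w)) with hq
  -- the leading term of the increment
  have hlead : -K * (x ^ K * (u ^ m * ph u)) * Complex.exp z.1 / g = q * (ph u / ph 0) := by
    have h5 : x ^ K * Complex.exp z.1 = α ^ K := by
      have hKC : (K : ℂ) ≠ 0 := by exact_mod_cast hK0.ne'
      rw [hx_def, chartX, mul_pow, ← Complex.exp_nat_mul, mul_div_cancel₀ _ hKC, mul_assoc,
        ← Complex.exp_add, neg_add_cancel, Complex.exp_zero, mul_one]
    have h6 : u ^ m = μ ^ m * (2 * g) * q := by
      have h7 : (2 * g : ℂ) = Complex.exp (-(m / l * Real.log t)) := by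
        rw [hg, Real.rpow_def_of_pos ht0]
        push_cast
        ring_nf
      rw [hu_def, rootBranch, mul_pow, ← Complex.exp_nat_mul, h7, hq, mul_assoc,
        ← Complex.exp_add, hlog]
      congr 2
      field_simp
      ring
    have h8 := h.α_pow
    have h9 := hF.ph_ne
    calc _ = -K * (x ^ K * Complex.exp z.1) * u ^ m * ph u / g := by ring
      _ = -(α ^ K * (2 * K * ph 0 * μ ^ m)) * q * (ph u / ph 0) := by
        rw [h5, h6]; field_simp
      _ = _ := by rw [h8]; ring
  have herr : ‖-K * (Complex.log (1 + relIncX F x u) - x ^ K * (u ^ m * ph u)) * Complex.exp z.1 / g‖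
      ≤ 1 / 40 := by
    refine le_trans ?_ hz1
    have hginv : g⁻¹ = 2 * t ^ (m / l : ℝ) := by
      rw [hg, mul_inv, Real.rpow_neg ht0.le, inv_inv]
      norm_num
    rw [norm_div, norm_mul, norm_mul, norm_neg, Complex.norm_natCast, Complex.norm_exp,
      Complex.norm_real, Real.norm_of_nonneg hg0.le, div_eq_mul_inv, hginv]
    rw [norm_chartX_pow] at hz
    calc _ ≤ K * (C * (‖α‖ ^ (K + 1) * Real.exp (-(((K + 1 : ℕ) : ℝ) / K) * t))) * Real.exp t *
          (2 * t ^ (m / l : ℝ)) := by gcongr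
      _ = 2 * K * C * ‖α‖ ^ (K + 1) * (t ^ (m / l : ℝ) *
          (Real.exp (-(((K + 1 : ℕ) : ℝ) / K) * t) * Real.exp t)) := by ring
      _ = _ := by
        rw [← Real.exp_add]
        congr 4
        push_cast
        field_simp
        ring
  have hsplit : -K * Complex.log (1 + relIncX F x u) * Complex.exp z.1 / g - 1 =
      -K * (Complex.log (1 + relIncX F x u) - x ^ K * (u ^ m * ph u)) * Complex.exp z.1 / g +
      ((q - 1) + (ph u / ph 0 - 1) + (q - 1) * (ph u / ph 0 - 1)) := by
    linear_combination hlead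
  rw [hsplit]
  have h5 := hcm w hwc
  have h6 : ‖(q - 1) * (ph u / ph 0 - 1)‖ ≤ 1 / 40 * (1 / 40) := by
    rw [norm_mul]
    gcongr
  have h7 := norm_add₃_le (a := q - 1) (b := ph u / ph 0 - 1) (c := (q - 1) * (ph u / ph 0 - 1))
  refine (norm_add_le _ _).trans ?_
  linarith

end IsBlowupChart

/-! ### The model of an irregular direction -/

theorem exists_norm_exp_mul_log_sub_one_le (r : ℂ) {ε : ℝ} (hε : 0 < ε) :
    ∃ c : ℝ, 0 < c ∧ c ≤ 1 / 4 ∧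
      ∀ w : ℂ, ‖w - 1‖ ≤ c → ‖Complex.exp (-(r * Complex.log w)) - 1‖ ≤ ε := by
  have h1 : ContinuousAt (fun w => ‖Complex.exp (-(r * Complex.log w)) - 1‖) 1 := by
    have := (Complex.hasDerivAt_log Complex.one_mem_slitPlane).continuousAt
    fun_prop
  have h2 : ∀ᶠ w in 𝓝 (1 : ℂ), ‖Complex.exp (-(r * Complex.log w)) - 1‖ < ε :=
    h1.eventually_lt_const (by simpa using hε)
  obtain ⟨c, hc, hcs⟩ := Metric.nhds_basis_closedBall.eventually_iff.1 h2
  refine ⟨min c (1 / 4), lt_min hc (by norm_num), min_le_right _ _, fun w hw => ?_⟩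
  exact (hcs (by rw [mem_closedBall, dist_eq_norm]; exact hw.trans (min_le_left _ _))).le

/-- In the chart the map is conjugate to a drift with a transversal part that is exponentially small
compared to it, and the end of the chart goes to the origin along `[1 : 0]`. -/
theorem IrregularExpansion.exists_model {F : ℂ × ℂ → ℂ × ℂ} {K m l : ℕ} {ph rh : ℂ → ℂ}
    (h : IrregularExpansion F K m l ph rh) {U : Set (ℂ × ℂ)} (hU : U ∈ 𝓝 0) :
    ∃ (κ q R δ : ℝ) (a b : ℂ × ℂ → ℂ) (Θ : ℂ × ℂ → ℂ × ℂ) (x : ℂ × ℂ → ℂ),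
      1 ≤ κ ∧ κ < 2 ∧ κ < q ∧ q ≤ κ + 2 ∧ 0 < δ ∧ IsDrift κ R (1 / 2) δ a ∧
      DifferentiableOn ℂ b (stripCone R (1 / 2) δ) ∧
      (∀ z ∈ stripCone R (1 / 2) δ, ‖b z‖ ≤ Real.exp (-q * z.1.re)) ∧
      UnivalentOn Θ (stripCone R (1 / 2) δ) ∧ MapsTo Θ (stripCone R (1 / 2) δ) U ∧
      (∀ z ∈ stripCone R (1 / 2) δ, F (Θ z) = Θ (z.1 + a z, z.2 + b z)) ∧
      Tendsto Θ (modelEnd R (1 / 2) δ) (𝓝 0) ∧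
      Tendsto (fun z => x z • Θ z) (modelEnd R (1 / 2) δ) (𝓝 (1, 0)) := by
  have hK := h.one_le_K
  have hl := h.one_le_l
  have hK1 : (1 : ℝ) ≤ K := by exact_mod_cast hK
  have hKC : (K : ℂ) ≠ 0 := by exact_mod_cast (by omega : K ≠ 0)
  obtain ⟨c, hc0, hc4, hcm⟩ := exists_norm_exp_mul_log_sub_one_le (m / l : ℂ)
    (by norm_num : (0 : ℝ) < 1 / 40)
  obtain ⟨μ, α, R₀, R, δ, W, Z, hch⟩ := h.exists_isBlowupChart hc0 (by linarith)
  set x : ℂ × ℂ → ℂ := IsBlowupChart.chartX α K with hx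
  set u : ℂ × ℂ → ℂ := fun z => rootBranch μ l (Z z) with hu
  set ξ : ℂ × ℂ → ℂ := fun z => relIncX F (x z) (u z) with hξ
  set η : ℂ × ℂ → ℂ := fun z => relIncU F (x z) (u z) with hη
  set Z₁ : ℂ × ℂ → ℂ := fun z => Z z * Complex.exp (-(l * Complex.log (1 + η z))) with hZ₁
  set a : ℂ × ℂ → ℂ := fun z => -K * Complex.log (1 + ξ z) with ha
  set b : ℂ × ℂ → ℂ := fun z => a z - (W (Z₁ z) - W (Z z)) with hb
  set g : ℂ × ℂ → ℝ := fun z => 1 / 2 * z.1.re ^ (-(m / l : ℝ)) with hg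
  set A : ℂ × ℂ → ℂ := fun z => a z * Complex.exp z.1 / (g z : ℂ) with hA
  set Θ : ℂ × ℂ → ℂ × ℂ := fun z => (x z, x z * u z) with hΘ
  -- `a` decays like `exp (-Re L)` up to powers of `Re L`, and `b` like `exp (-(1 + 1 / K) Re L)`; the
  -- exponents `κ = 1 + 1 / (4 K)` and `q = 1 + 1 / (2 K)` absorb the powers
  set κ : ℝ := 1 + 1 / (4 * K) with hκ
  have hx0 : ∀ z, x z ≠ 0 := hch.chartX_ne_zero
  have hu0 : ∀ z, u z ≠ 0 := fun z => rootBranch_ne_zero hch.μ_ne _ _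
  have hxt : Tendsto x (modelEnd R 1 δ) (𝓝 0) := hch.tendsto_chartX hc4 hK
  have hut : Tendsto u (modelEnd R 1 δ) (𝓝 0) := hch.tendsto_rootBranch_Z hc4 hl
  have hΘt : Tendsto Θ (modelEnd R 1 δ) (𝓝 0) := by
    have := hxt.prodMk_nhds (hxt.mul hut)
    rw [mul_zero] at this
    exact this
  have hξt : Tendsto ξ (modelEnd R 1 δ) (𝓝 0) :=
    h.tendsto_relIncX hxt hut (Eventually.of_forall hx0)
  obtain ⟨hηt, hZ₁t, hbe⟩ := hch.eventually_increment hc4 h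
  have hηt' : Tendsto η (modelEnd R 1 δ) (𝓝 0) := hηt
  have hsmall : ∀ {f : ℂ × ℂ → ℂ}, Tendsto f (modelEnd R 1 δ) (𝓝 0) → ∀ {ε : ℝ}, 0 < ε →
      ∀ᶠ z in modelEnd R 1 δ, ‖f z‖ < ε := fun {f} hf {ε} hε => by
    have := hf.norm
    rw [norm_zero] at this
    exact this.eventually_lt_const hε
  have hlog : ∀ᶠ z in modelEnd R 1 δ, l * ‖Complex.log (1 + η z)‖ ≤ 1 := by
    have h1 : ContinuousAt (fun v : ℂ => l * ‖Complex.log (1 + v)‖) 0 := by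
      have h2 : ContinuousAt (fun v : ℂ => Complex.log (1 + v)) 0 :=
        (continuousAt_const.add continuousAt_id).clog (by simp)
      exact continuousAt_const.mul h2.norm
    exact (h1.tendsto.comp hηt').eventually_le_const (by simp)
  have hZ₁re : ∀ᶠ z in modelEnd R 1 δ, R₀ < (Z₁ z).re := by
    filter_upwards [(hch.tendsto_re_Z hc4).eventually_gt_atTop (R₀ + 1), hsmall hZ₁t one_pos]
      with z hz1 hz2
    have h1 := (abs_lt.1 ((Complex.abs_re_le_norm _).trans_lt hz2)).1
    rw [Complex.sub_re] at h1
    change R₀ < (Z z * Complex.exp (-(l * Complex.log (1 + η z)))).re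
    linarith
  have hgκ : ∀ᶠ z in modelEnd R 1 δ, Real.exp (-(κ - 1) * z.1.re) ≤ g z / 2 := by
    have hbb : (0 : ℝ) < κ - 1 := by rw [hκ, add_sub_cancel_left]; positivity
    have h1 := (tendsto_rpow_mul_exp_modelEnd (m / l : ℝ) hbb R 1 δ).eventually_le_const
      (by norm_num : (0 : ℝ) < 1 / 4)
    filter_upwards [h1, eventually_mem_modelEnd R 1 δ] with z hz hzm
    have ht : 0 < z.1.re := by linarith [hch.one_le_re hzm]
    simp only [hg]
    rw [Real.rpow_neg ht.le]
    have h2 : 0 < z.1.re ^ (m / l : ℝ) := Real.rpow_pos_of_pos ht _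
    calc _ = (z.1.re ^ (m / l : ℝ) * Real.exp (-(κ - 1) * z.1.re)) * (z.1.re ^ (m / l : ℝ))⁻¹ := by
          field_simp
      _ ≤ 1 / 4 * (z.1.re ^ (m / l : ℝ))⁻¹ := by gcongr
      _ = _ := by ring
  have hsub : ∀ {R' : ℝ}, R ≤ R' → stripCone R' (1 / 2) (δ / 2) ⊆ stripCone R 1 δ :=
    fun {R'} hR' => stripCone_subset hR' (by linarith [hch.one_le_R]) (by norm_num)
      (by linarith [hch.δ_pos])
  have hall : ∀ᶠ z in modelEnd R 1 δ, DifferentiableAt ℂ F (Θ z) ∧ Θ z ∈ U ∧ ‖ξ z‖ < 1 / 2 ∧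
      ‖η z‖ < 1 / 2 ∧ l * ‖Complex.log (1 + η z)‖ ≤ 1 ∧ R₀ < (Z₁ z).re ∧ ‖A z - 1‖ ≤ 1 / 10 ∧
      ‖b z‖ ≤ Real.exp (-(1 + 1 / (2 * K)) * z.1.re) ∧
      Real.exp (-(κ - 1) * z.1.re) ≤ g z / 2 ∧ 2 / δ ≤ z.1.re ∧ 3 ≤ z.1.re := by
    filter_upwards [hΘt.eventually h.differentiableAt, hΘt.eventually hU,
      hsmall hξt (by norm_num : (0 : ℝ) < 1 / 2), hsmall hηt' (by norm_num : (0 : ℝ) < 1 / 2), hlog,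
      hZ₁re, hch.eventually_drift hc4 h hcm, hbe, hgκ,
      (tendsto_re_modelEnd R 1 δ).eventually_ge_atTop (2 / δ),
      (tendsto_re_modelEnd R 1 δ).eventually_ge_atTop 3]
      with z h1 h2 h3 h4 h5 h6 h7 h8 h9 h10 h11
      using ⟨h1, h2, h3, h4, h5, h6, h7, h8, h9, h10, h11⟩
  set R₁ := max R 3 with hR₁
  have hle : modelEnd R₁ (1 / 2) (δ / 2) ≤ modelEnd R 1 δ := modelEnd_mono (hsub (le_max_left _ _))
  obtain ⟨R', hR', hgood⟩ := exists_forall_stripCone_of_eventually (hall.filter_mono hle)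
    (by have := le_max_right R 3; linarith)
  have hRR' : R ≤ R' := (le_max_left R 3).trans hR'
  have hR3 : 3 ≤ R' := (le_max_right R 3).trans hR'
  set D := stripCone R' (1 / 2) (δ / 2) with hD
  have hDs : D ⊆ stripCone R 1 δ := hsub hRR'
  have hle' : modelEnd R' (1 / 2) (δ / 2) ≤ modelEnd R 1 δ := modelEnd_mono hDs
  have hΘ1 : UnivalentOn Θ (stripCone R 1 δ) := hch.univalentOn hK hl
  have hslit : ∀ {v : ℂ}, ‖v‖ < 1 / 2 → 1 + v ∈ Complex.slitPlane := fun {v} hv => by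
    refine Or.inl ?_
    have := (abs_lt.1 ((Complex.abs_re_le_norm v).trans_lt hv)).1
    rw [Complex.add_re, Complex.one_re]
    linarith
  have hslit0 : ∀ {v : ℂ}, ‖v‖ < 1 / 2 → 1 + v ≠ 0 := fun {v} hv =>
    Complex.slitPlane_ne_zero (hslit hv)
  have hZre : ∀ z ∈ D, 0 < (Z z).re := fun z hz =>
    lt_trans (lt_of_lt_of_le one_pos hch.one_le_R₀) (hch.re_Z z (hDs hz))
  have hX : ∀ z ∈ D, (F (Θ z)).1 = x z * (1 + ξ z) := fun z hz => by
    simp only [hξ, relIncX, hΘ]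
    field_simp [hx0 z]
    ring
  have hX0 : ∀ z ∈ D, (F (Θ z)).1 ≠ 0 := fun z hz => by
    rw [hX z hz]
    exact mul_ne_zero (hx0 z) (hslit0 (hgood z hz).2.2.1)
  have hZd : ∀ z ∈ D, DifferentiableAt ℂ Z z := fun z hz =>
    hch.differentiableOn.differentiableAt ((isOpen_stripCone _ _ _).mem_nhds (hDs hz))
  have hxd : ∀ z, DifferentiableAt ℂ x z := fun z => by
    simp only [hx]
    unfold IsBlowupChart.chartX
    fun_prop
  have hud : ∀ z ∈ D, DifferentiableAt ℂ u z := fun z hz =>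
    (hasDerivAt_rootBranch (Or.inl (hZre z hz))).differentiableAt.comp z (hZd z hz)
  have hFd : ∀ z ∈ D, DifferentiableAt ℂ (fun z => F (Θ z)) z := fun z hz =>
    (hgood z hz).1.comp z (hΘ1.differentiableAt (hDs hz))
  have hξd : ∀ z ∈ D, DifferentiableAt ℂ ξ z := fun z hz =>
    ((hFd z hz).fst.mul ((hxd z).inv (hx0 z))).sub_const 1
  have hηd : ∀ z ∈ D, DifferentiableAt ℂ η z := fun z hz =>
    (((hFd z hz).snd.mul ((hFd z hz).fst.inv (hX0 z hz))).mul
      ((hud z hz).inv (hu0 z))).sub_const 1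
  have had : ∀ z ∈ D, DifferentiableAt ℂ a z := fun z hz =>
    (((hξd z hz).const_add 1).clog (hslit (hgood z hz).2.2.1)).const_mul _
  have hZ₁d : ∀ z ∈ D, DifferentiableAt ℂ Z₁ z := fun z hz =>
    (hZd z hz).mul
      ((((hηd z hz).const_add 1).clog (hslit (hgood z hz).2.2.2.1)).const_mul _).neg.cexp
  have hbd : ∀ z ∈ D, DifferentiableAt ℂ b z := fun z hz =>
    (had z hz).sub
      (((hch.hasDerivAt _ (hgood z hz).2.2.2.2.2.1).differentiableAt.comp z (hZ₁d z hz)).sub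
        ((hch.hasDerivAt _ (hch.re_Z z (hDs hz))).differentiableAt.comp z (hZd z hz)))
  have hdrift : IsDrift κ R' (1 / 2) (δ / 2) a := by
    refine IsDrift.of_eq_exp_mul (A := A) (g := g)
      (fun z hz => (had z hz).differentiableWithinAt) (fun z hz => ?_)
      (fun z hz => (hgood z hz).2.2.2.2.2.2.1) (fun z hz => ?_)
      (fun z hz => (hgood z hz).2.2.2.2.2.2.2.2.1)
    · have hg0 : (g z : ℂ) ≠ 0 := by
        have h1 := (Real.exp_pos _).trans_le (hgood z hz).2.2.2.2.2.2.2.2.1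
        exact_mod_cast (by linarith : 0 < g z).ne'
      simp only [hA]
      rw [mul_div_cancel₀ _ hg0, mul_left_comm, ← Complex.exp_add, neg_add_cancel,
        Complex.exp_zero, mul_one]
    · have h1 : z.1.re ^ (-(m / l : ℝ)) ≤ 1 :=
        Real.rpow_le_one_of_one_le_of_nonpos (by linarith [hz.1])
          (neg_nonpos.2 (by positivity))
      simp only [hg]
      linarith
  have hbq : ∀ z ∈ D, ‖b z‖ ≤ Real.exp (-(1 + 1 / (2 * K)) * z.1.re) := fun z hz =>
    (hgood z hz).2.2.2.2.2.2.2.1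
  -- the image point need not be in `D`, but it stays in the larger domain of the chart
  have hnew : ∀ z ∈ D, (z.1 + a z, z.2 + b z) ∈ stripCone R 1 δ := by
    intro z hz
    have h1 := hdrift.half_norm_le_re z hz
    have h2 := hdrift.abs_im_add_lt hR3 (by norm_num) hz hz.2.1
    have h3 : z.1.re ≤ (z.1 + a z).re := by
      rw [Complex.add_re]
      linarith [norm_nonneg (a z)]
    have h4 : ‖b z‖ ≤ 1 := by
      refine (hbq z hz).trans (Real.exp_le_one_iff.2 ?_)
      have h5 : 0 < z.1.re := by linarith [hz.1]
      have h6 : (0 : ℝ) < 1 + 1 / (2 * K) := by positivity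
      nlinarith
    have h5 : 2 / δ ≤ z.1.re := (hgood z hz).2.2.2.2.2.2.2.2.2.1
    rw [div_le_iff₀ hch.δ_pos] at h5
    refine ⟨lt_of_lt_of_le (lt_of_le_of_lt hRR' hz.1) h3, h2.trans (by norm_num), ?_⟩
    have h6 := norm_add_le z.2 (b z)
    have h7 := hz.2.2
    have h8 := mul_le_mul_of_nonneg_left h3 hch.δ_pos.le
    change ‖z.2 + b z‖ < δ * (z.1 + a z).re
    linarith
  have hconj : ∀ z ∈ D, F (Θ z) = Θ (z.1 + a z, z.2 + b z) := by
    intro z hz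
    have hξ0 : 1 + ξ z ≠ 0 := hslit0 (hgood z hz).2.2.1
    have hη0 : 1 + η z ≠ 0 := hslit0 (hgood z hz).2.2.2.1
    have h1 : x (z.1 + a z, z.2 + b z) = x z * (1 + ξ z) := by
      simp only [hx, IsBlowupChart.chartX, ha]
      rw [mul_assoc]
      congr 1
      rw [← Complex.exp_log hξ0, ← Complex.exp_add, Complex.exp_log hξ0]
      congr 1
      field_simp
      ring
    -- `b` is defined in such a way that `W` takes the value `W (Z₁ z)` at the image point
    have h2 : Z (z.1 + a z, z.2 + b z) = Z₁ z := by
      refine hch.injOn (hch.re_Z _ (hnew z hz)) (hgood z hz).2.2.2.2.2.1 ?_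
      rw [hch.W_Z _ (hnew z hz)]
      have h3 := hch.W_Z z (hDs hz)
      simp only [hb]
      linear_combination -h3
    have h3 : u (z.1 + a z, z.2 + b z) = u z * (1 + η z) := by
      simp only [hu]
      rw [h2]
      simp only [hZ₁]
      rw [rootBranch_mul_exp hl (hZre z hz) (hgood z hz).2.2.2.2.1, Complex.exp_log hη0]
    refine Prod.ext ?_ ?_
    · rw [hX z hz]
      exact h1.symm
    · change (F (Θ z)).2 = x (z.1 + a z, z.2 + b z) * u (z.1 + a z, z.2 + b z)
      rw [h1, h3, ← hX z hz]
      have h4 := hX0 z hz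
      have h5 : 1 + η z = (F (Θ z)).2 / (F (Θ z)).1 / u z := by
        simp only [hη, relIncU, hΘ]
        ring
      rw [h5]
      field_simp [hu0 z]
  refine ⟨κ, 1 + 1 / (2 * K), R', δ / 2, a, b, Θ, fun z => (x z)⁻¹, ?_, ?_, ?_, ?_,
    half_pos hch.δ_pos, hdrift, fun z hz => (hbd z hz).differentiableWithinAt, hbq,
    hΘ1.mono hDs (isOpen_stripCone _ _ _), fun z hz => (hgood z hz).2.1, hconj, hΘt.mono_left hle',
    ?_⟩
  · rw [hκ]
    have : (0 : ℝ) < 1 / (4 * K) := by positivity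
    linarith
  · have : (1 : ℝ) / (4 * K) ≤ 1 / 4 := by
      rw [div_le_div_iff₀ (by positivity) (by norm_num)]
      linarith
    rw [hκ]
    linarith
  · rw [hκ]
    gcongr
    norm_num
  · have : (1 : ℝ) / (2 * K) ≤ 1 / 2 := by
      rw [div_le_div_iff₀ (by positivity) (by norm_num)]
      linarith
    have : (0 : ℝ) < 1 / (4 * K) := by positivity
    rw [hκ]
    linarith
  · have h1 : Tendsto (fun z => ((1 : ℂ), u z)) (modelEnd R' (1 / 2) (δ / 2)) (𝓝 (1, 0)) :=
      tendsto_const_nhds.prodMk_nhds (hut.mono_left hle')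
    refine h1.congr fun z => ?_
    simp only [hΘ, Prod.smul_mk, smul_eq_mul]
    rw [inv_mul_cancel₀ (hx0 z), inv_mul_cancel_left₀ (hx0 z)]

/-! ### Linear changes of coordinates -/

theorem TangentToIdentity.conj {F : ℂ × ℂ → ℂ × ℂ} (hF : TangentToIdentity F)
    (A : (ℂ × ℂ) ≃L[ℂ] (ℂ × ℂ)) : TangentToIdentity (fun x => A.symm (F (A x))) where
  analyticAt := by
    have h1 : AnalyticAt ℂ F (A 0) := by rw [A.map_zero]; exact hF.analyticAt
    exact (A.symm.analyticAt _).comp (h1.comp (A.analyticAt 0))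
  map_zero := by simp [hF.map_zero]
  fderiv_eq := by
    have h1 : HasFDerivAt F (ContinuousLinearMap.id ℂ (ℂ × ℂ)) (A 0) := by
      rw [A.map_zero, ← hF.fderiv_eq]
      exact hF.analyticAt.differentiableAt.hasFDerivAt
    have h2 := A.symm.hasFDerivAt.comp (0 : ℂ × ℂ) (h1.comp (0 : ℂ × ℂ) A.hasFDerivAt)
    refine HasFDerivAt.fderiv (h2.congr_fderiv ?_)
    ext <;> simp

theorem theorem2 (F : ℂ × ℂ → ℂ × ℂ) (hF : TangentToIdentity F)
    (v : ℂ × ℂ) (hdeg : IsDegenerateCharacteristicDirection F v)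
    (hirr : IsIrregularDirection F v) :
    ∀ U ∈ 𝓝 (0 : ℂ × ℂ), ∃ V : Set (ℂ × ℂ), V ⊆ U ∧ IsBasinAlong F v V ∧
      (IsAutomorphismC2 F → IsBiholomorphicToC2 (⋃ i : ℕ, F^[i] ⁻¹' V)) := by
  intro U hU
  obtain ⟨A, rfl, hA⟩ := hirr
  obtain ⟨K, m, l, ph, rh, h⟩ := (hF.conj A).exists_irregularExpansion hA
  have hU' : A ⁻¹' U ∈ 𝓝 (0 : ℂ × ℂ) :=
    A.continuous.continuousAt.preimage_mem_nhds (by rwa [map_zero])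
  obtain ⟨κ, q, R, δ, a, b, Θ, x, h1, h2, h3, h4, h5, ha, hb, hbq, hΘ, hΘU, hconj, hzero, hdir⟩ :=
    h.exists_model hU'
  have hAu : UnivalentOn A univ :=
    UnivalentOn.of_leftInverse isOpen_univ A.differentiable A.symm.differentiable
      A.symm_apply_apply
  refine exists_basin_of_model (Θ := A ∘ Θ) (c := x) h1 h2 h3 h4 h5 ha hb hbq
    (hAu.comp hΘ (mapsTo_univ _ _)) hΘU (fun z hz => ?_) ?_ ?_
  · have := congrArg A (hconj z hz)
    simpa using this
  · have := (A.continuous.tendsto 0).comp hzero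
    rwa [map_zero] at this
  · have := (A.continuous.tendsto (1, 0)).comp hdir
    refine this.congr fun z => ?_
    simp
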